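/- Let $F$ be a local field (a field with a nontrivial absolute value for which it is locally compact), $B=F^\times$, $\hat B$ the Pontryagin dual of $B$, and let $\|x\|$ denote the module of $x\in F$, i.e. $\mu_F(xS)=\|x\|\,\mu_F(S)$ for a Haar measure $\mu_F$ on $(F,+)$. Give $B$ the Haar measure $dx=d\mu_F(x)/\|x\|$ and $\hat B$ the Haar measure normalized by $\int_{\hat B}\alpha(x)\,d\alpha=\delta_B(x)$, i.e. $\int_{\hat B}\int_B f(x)\,\alpha(x)^{-1}\,dx\,d\alpha=f(1)$ for all Schwartz–Bruhat functions $f$ on $B$. Let $A=\hat B\times B$ carry the product measure, the Gaussian exponential $\langle(\alpha,x)\rangle=\alpha(x)$ and its Fourier kernel $$\langle(\alpha,x);(\beta,y)\rangle=\frac{\langle(\alpha+\beta,xy)\rangle}{\langle(\alpha,x)\rangle\langle(\beta,y)\rangle}=\alpha(y)\beta(x).$$ Let $\mathcal S(A)$ be the space of Schwartz–Bruhat functions on $A$. For a function $\varphi$ on $A$ representing a tempered distribution, let $\tilde\varphi(b)=\int_A\varphi(a)\langle a;b\rangle^{-1}\,da$ be its inverse Fourier transform, a tempered distribution defined by duality.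 **Theorem.** Let $\varphi:A\to\mathbb C$ be a function with $\varphi(\alpha,x)=\alpha(1+x)$ for $x\neq-1$ (with arbitrary values on the null set $x=-1$). Then $\varphi$ is a quantum dilogarithm over $A$, that is: 1. $\varphi$ is locally integrable and represents a tempered distribution on $A$. 2. (Inversion relation) There is a constant $c\in\mathbb C^\times$ with $\varphi(\alpha,x)\,\varphi(-\alpha,x^{-1})=c\,\alpha(x)$ for almost all $(\alpha,x)\in A$. 3. (Pentagon identity) As distributions in $\big((\alpha,x),(\beta,y)\big)\in A^2$, $$\tilde\varphi(\alpha,x)\,\tilde\varphi(\beta,y)\,\alpha(y)\beta(x)=\int_A\tilde\varphi(\beta-\gamma,y/z)\,\tilde\varphi(\gamma,z)\,\tilde\varphi(\alpha-\gamma,x/z)\,\gamma(z)\,d(\gamma,z).$$ Here the integral is improper. That is, for every $f\in\mathcal S(A^2)$, let $S_f(\chi)$, for $\chi\in\mathcal S(A)$, be the value of the distribution $\tilde\varphi(\alpha-\gamma,x/z)\,\tilde\varphi(\gamma,z)\,\tilde\varphi(\beta-\gamma,y/z)\,\gamma(z)$ on $A^3$ at the test function $f\big((\alpha,x),(\beta,y)\big)\,\chi(\gamma,z)$.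 Then $S_f(\chi)$ tends to the value of the left-hand side at $f$ when $\chi=\int_A\rho(b)\langle b;\cdot\rangle^{-1}\,db$ tends to $1$, where $\rho\ge 0$ runs through the functions in $\mathcal S(A)$ with $\int_A\rho=1$ and with support in smaller and smaller neighbourhoods of the neutral element of $A$. Moreover, away from $y=1$ the distribution $\tilde\varphi$ is represented by the function $$\tilde\varphi(\beta,y)=\beta(y-1)^{-1}\,\|1-y^{-1}\|^{-1},$$ i.e. $\tilde\varphi(f)=\int_A\tilde\varphi(\beta,y)\,f(\beta,y)\,d(\beta,y)$, with absolute convergence, for every $f\in\mathcal S(A)$ that vanishes on $\hat B\times U$ for some neighbourhood $U$ of $1$ in $B$. -/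

import Mathlib

open MeasureTheory Topology
open scoped Pointwise

noncomputable section

namespace QDilog

section SchwartzBruhat

/-- The inverse Fourier transform of `f : G → ℂ` along a pairing `e : H → G → 𝕋`:
`h ↦ ∫_G f(x) / e(h, x) dμ(x)`. -/
def invFourier {G H : Type*} [MeasurableSpace G] (e : H → G → Circle) (μ : Measure G)
    (f : G → ℂ) (h : H) : ℂ :=
  ∫ x, f x * (((e h x)⁻¹ : Circle) : ℂ) ∂μ

/-- `f` is bounded by `M` and decays to order `n` along the powers of the set `C`, with constant
`M`: one has `k ^ n * |f| ≤ M` outside the `k`-fold product set `C ^ k = C ⋯ C`. -/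
def DecayBound {G : Type*} [CommGroup G] (C : Set G) (n : ℕ) (M : ℝ) (f : G → ℂ) : Prop :=
  (∀ x, ‖f x‖ ≤ M) ∧ ∀ (k : ℕ) (x : G), x ∉ C ^ k → (k : ℝ) ^ n * ‖f x‖ ≤ M

/-- The step `S(C, D)` of the Schwartz–Bruhat space: continuous functions on `G` that decay rapidly
along the powers of `C` and whose Fourier transform decays rapidly along the powers of `D`. Here
`e : H → G → 𝕋` is a pairing which identifies `H` with the Pontryagin dual of `G`. -/
structure IsSchwartzBruhatStep {G H : Type*} [CommGroup G] [TopologicalSpace G]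
    [MeasurableSpace G] [CommGroup H] (e : H → G → Circle) (μ : Measure G)
    (C : Set G) (D : Set H) (f : G → ℂ) : Prop where
  continuous : Continuous f
  decay : ∀ n : ℕ, ∃ M : ℝ, DecayBound C n M f
  decay_fourier : ∀ n : ℕ, ∃ M : ℝ, DecayBound D n M (invFourier e μ f)

/-- Schwartz–Bruhat functions on a locally compact abelian group `G`, in Osborne's description:
continuous functions which, together with their Fourier transform, decay faster than every power
of `k` outside the `k`-th power of some compact set. -/
def IsSchwartzBruhat {G H : Type*} [CommGroup G] [TopologicalSpace G]
    [MeasurableSpace G] [CommGroup H] [TopologicalSpace H] (e : H → G → Circle) (μ : Measure G)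
    (f : G → ℂ) : Prop :=
  ∃ (C : Set G) (D : Set H), IsCompact C ∧ IsCompact D ∧ IsSchwartzBruhatStep e μ C D f

/-- The canonical pairing of the Pontryagin dual of `B` with `B`. -/
def dualPairing {B : Type*} [CommGroup B] [TopologicalSpace B]
    (α : PontryaginDual B) (x : B) : Circle :=
  α x

/-- The normalization `∫ α(x) dα = δ(x)` of a measure `ν` on the dual of `B` relative to a Haar
measure `μ` on `B`, as an identity of distributions on `B`, i.e. tested against every
Schwartz–Bruhat function. It singles out one Haar measure on the dual. -/
def IsDualNormalized {B : Type*} [CommGroup B] [TopologicalSpace B]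
    [MeasurableSpace B] [MeasurableSpace (PontryaginDual B)]
    (μ : Measure B) (ν : Measure (PontryaginDual B)) : Prop :=
  ∀ f : B → ℂ, IsSchwartzBruhat (dualPairing (B := B)) μ f →
    ∫ α, invFourier dualPairing μ f α ∂ν = f 1

end SchwartzBruhat

section Gaussian

/-! In this section `A` is an abelian group, written multiplicatively, and `q : A → 𝕋` is a
Gaussian exponential `⟨·⟩` on it. -/

/-- The Fourier kernel `⟨x; y⟩ = ⟨x + y⟩ / (⟨x⟩ ⟨y⟩)` of a Gaussian exponential. -/
def fourierKernel {A : Type*} [CommGroup A] (q : A → Circle) (x y : A) : Circle :=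
  q (x * y) / (q x * q y)

/-- The Gaussian exponential of a product of two Gaussian groups. -/
def gaussProd {A A' : Type*} (q : A → Circle) (q' : A' → Circle) (z : A × A') : Circle :=
  q z.1 * q' z.2

/-- Test functions on a Gaussian group: the Fourier kernel identifies the group with its dual. -/
def IsTest {A : Type*} [CommGroup A] [TopologicalSpace A] [MeasurableSpace A]
    (q : A → Circle) (μ : Measure A) (f : A → ℂ) : Prop :=
  IsSchwartzBruhat (fourierKernel q) μ f

/-- The locally integrable function `φ` represents a tempered distribution `f ↦ ∫ φ f`: the
integral converges on test functions, and is continuous for the inductive limit topology on the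
space of test functions (that is, on each of the Fréchet spaces `S(C, D)`). -/
structure RepresentsTempered {A : Type*} [CommGroup A] [TopologicalSpace A] [MeasurableSpace A]
    (q : A → Circle) (μ : Measure A) (φ : A → ℂ) : Prop where
  locallyIntegrable : LocallyIntegrable φ μ
  integrable : ∀ f, IsTest q μ f → Integrable (fun x => φ x * f x) μ
  continuous : ∀ C D : Set A, IsCompact C → IsCompact D → ∃ (n : ℕ) (K : ℝ), ∀ f : A → ℂ,
    IsSchwartzBruhatStep (fourierKernel q) μ C D f → ∀ M : ℝ,
      DecayBound C n M f → DecayBound D n M (invFourier (fourierKernel q) μ f) →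
        ‖∫ x, φ x * f x ∂μ‖ ≤ K * M

/-- The value at `f` of the distribution `φ̃(x) = ∫ φ(y) / ⟨x; y⟩ dy`, the inverse Fourier transform
of the distribution `φ`. It is defined by duality. -/
def tilde {A : Type*} [CommGroup A] [MeasurableSpace A]
    (q : A → Circle) (μ : Measure A) (φ f : A → ℂ) : ℂ :=
  ∫ x, φ x * invFourier (fourierKernel q) μ f x ∂μ

/-- All integrals that occur in `tilde q μ φ f` converge absolutely. -/
def TildeConverges {A : Type*} [CommGroup A] [MeasurableSpace A]
    (q : A → Circle) (μ : Measure A) (φ f : A → ℂ) : Prop :=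
  Integrable f μ ∧ Integrable (fun x => φ x * invFourier (fourierKernel q) μ f x) μ

/-- `ρ` is a nonnegative test function of integral one that vanishes outside `U`. -/
structure IsMollifier {A : Type*} [CommGroup A] [TopologicalSpace A] [MeasurableSpace A]
    (q : A → Circle) (μ : Measure A) (U : Set A) (ρ : A → ℝ) : Prop where
  test : IsTest q μ (fun x => (ρ x : ℂ))
  nonneg : ∀ x, 0 ≤ ρ x
  integral_eq_one : ∫ x, ρ x ∂μ = 1
  eq_zero : ∀ x, x ∉ U → ρ x = 0

/-- The improper integral `∫_A S(z) dz` of a tempered distribution `S` on `A` (given by its values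
on test functions) exists and equals `L`. That is, `S(χ) → L` when the cut-off function `χ` tends
to the constant function `1` through the Fourier transforms of mollifiers which concentrate at
the neutral element. -/
def HasImproperIntegral {A : Type*} [CommGroup A] [TopologicalSpace A] [MeasurableSpace A]
    (q : A → Circle) (μ : Measure A) (S : (A → ℂ) → ℂ) (L : ℂ) : Prop :=
  ∀ ε : ℝ, 0 < ε → ∃ U ∈ 𝓝 (1 : A), ∀ ρ : A → ℝ, IsMollifier q μ U ρ →
    ‖S (invFourier (fourierKernel q) μ (fun x => (ρ x : ℂ))) - L‖ < ε

/-- The function `φ ⊗ φ` on `A × A`. -/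
def tensorTwo {A : Type*} (φ : A → ℂ) (p : A × A) : ℂ := φ p.1 * φ p.2

/-- The function `φ ⊗ φ ⊗ φ` on `A × A × A`. -/
def tensorThree {A : Type*} (φ : A → ℂ) (p : A × A × A) : ℂ := φ p.1 * φ p.2.1 * φ p.2.2

/-- Multiplication of a test function `f(x, y)` by the Fourier kernel `⟨x; y⟩`. -/
def pentagonTestLeft {A : Type*} [CommGroup A] (q : A → Circle) (f : A × A → ℂ) (p : A × A) : ℂ :=
  f p * (fourierKernel q p.1 p.2 : ℂ)

/-- The test function `f(x, y) χ(z)`, multiplied by `⟨z⟩` and written in the coordinates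
`(u, w, z) = (x - z, y - z, z)`. -/
def pentagonTestRight {A : Type*} [CommGroup A] (q : A → Circle) (f : A × A → ℂ) (χ : A → ℂ)
    (p : A × A × A) : ℂ :=
  f (p.1 * p.2.2, p.2.1 * p.2.2) * χ p.2.2 * (q p.2.2 : ℂ)

/-- The value at `f` of the distribution `φ̃(x) φ̃(y) ⟨x; y⟩` on `A × A`. -/
def pentagonLeft {A : Type*} [CommGroup A] [MeasurableSpace A]
    (q : A → Circle) (μ : Measure A) (φ : A → ℂ) (f : A × A → ℂ) : ℂ :=
  tilde (gaussProd q q) (μ.prod μ) (tensorTwo φ) (pentagonTestLeft q f)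

/-- The value at `f(x, y) χ(z)` of the distribution `φ̃(x - z) φ̃(z) φ̃(y - z) ⟨z⟩` on
`A × A × A`. -/
def pentagonRight {A : Type*} [CommGroup A] [MeasurableSpace A]
    (q : A → Circle) (μ : Measure A) (φ : A → ℂ) (f : A × A → ℂ) (χ : A → ℂ) : ℂ :=
  tilde (gaussProd q (gaussProd q q)) (μ.prod (μ.prod μ)) (tensorThree φ)
    (pentagonTestRight q f χ)

/-- The distributional pentagon identity
`φ̃(x) φ̃(y) ⟨x; y⟩ = ∫_A φ̃(x - z) φ̃(z) φ̃(y - z) ⟨z⟩ dz`: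
both sides agree on every test function `f(x, y)` on `A × A`. -/
structure PentagonIdentity {A : Type*} [CommGroup A] [TopologicalSpace A] [MeasurableSpace A]
    (q : A → Circle) (μ : Measure A) (φ : A → ℂ) : Prop where
  left_converges : ∀ f : A × A → ℂ, IsTest (gaussProd q q) (μ.prod μ) f →
    TildeConverges (gaussProd q q) (μ.prod μ) (tensorTwo φ) (pentagonTestLeft q f)
  right_converges : ∀ f : A × A → ℂ, IsTest (gaussProd q q) (μ.prod μ) f →
    ∀ χ : A → ℂ, IsTest q μ χ →
      TildeConverges (gaussProd q (gaussProd q q)) (μ.prod (μ.prod μ)) (tensorThree φ)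
        (pentagonTestRight q f χ)
  identity : ∀ f : A × A → ℂ, IsTest (gaussProd q q) (μ.prod μ) f →
    HasImproperIntegral q μ (pentagonRight q μ φ f) (pentagonLeft q μ φ f)

/-- A quantum dilogarithm over the group `A` with Gaussian exponential `q` and Haar measure `μ`:
an almost everywhere defined locally integrable function, representing a tempered distribution,
that satisfies the inversion relation and the pentagon identity. -/
structure IsQuantumDilogarithm {A : Type*} [CommGroup A] [TopologicalSpace A] [MeasurableSpace A]
    (q : A → Circle) (μ : Measure A) (φ : A → ℂ) : Prop where
  tempered : RepresentsTempered q μ φ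
  inversion : ∃ c : ℂ, c ≠ 0 ∧ ∀ᵐ x ∂μ, φ x * φ x⁻¹ = c * (q x : ℂ)
  pentagon : PentagonIdentity q μ φ

end Gaussian

section LocalField

/-- The module `‖x‖` of an element of a local field, characterized by `μ(x S) = ‖x‖ μ(S)`. -/
def modulus {F : Type*} [NontriviallyNormedField F] [LocallyCompactSpace F] (x : F) : ℝ :=
  open Classical in
  if h : x = 0 then 0 else (distribHaarChar F (Units.mk0 x h) : ℝ)

/-- The Haar measure `dx / ‖x‖` on the multiplicative group of a local field. -/
def mulHaar {F : Type*} [NontriviallyNormedField F] [LocallyCompactSpace F] [MeasurableSpace F]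
    (μ : Measure F) : Measure Fˣ :=
  (μ.comap (Units.val : Fˣ → F)).withDensity
    fun x => ENNReal.ofReal (modulus (x : F))⁻¹

/-- The Gaussian exponential `⟨(α, x)⟩ = α(x)` on the product of the dual of `B` with `B`. -/
def dualGauss {B : Type*} [CommGroup B] [TopologicalSpace B] (a : PontryaginDual B × B) : Circle :=
  a.1 a.2

/-- The function `(β, y) ↦ β(y - 1)⁻¹ ‖1 - y⁻¹‖⁻¹`, defined for `y ≠ 1` (and set to zero when
`y = 1`). -/
def tildeFormula {F : Type*} [NontriviallyNormedField F] [LocallyCompactSpace F]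
    (b : PontryaginDual Fˣ × Fˣ) : ℂ :=
  open Classical in
  if h : (b.2 : F) - 1 = 0 then 0
  else (((b.1 (Units.mk0 _ h))⁻¹ : Circle) : ℂ) * (((modulus (1 - (b.2 : F)⁻¹))⁻¹ : ℝ) : ℂ)

end LocalField

end QDilog

end

open MeasureTheory Topology
open scoped Pointwise

noncomputable section

set_option linter.unusedSectionVars false

namespace QDilog

section Weights

/-- A weight that decays like `1 / k` outside the `k`-fold product set of `C`. -/
def theta {G : Type*} [CommGroup G] (C : Set G) (x : G) : ℝ :=
  open Classical in ⨅ k : ℕ, if x ∈ C ^ k then (1 : ℝ) else 1 / ((k : ℝ) + 1)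

variable {G : Type*} [CommGroup G]

lemma theta_term_nonneg (C : Set G) (x : G) (k : ℕ) :
    0 ≤ (open Classical in if x ∈ C ^ k then (1 : ℝ) else 1 / ((k : ℝ) + 1)) := by
  split_ifs <;> positivity

lemma theta_bddBelow (C : Set G) (x : G) :
    BddBelow (Set.range fun k : ℕ =>
      (open Classical in if x ∈ C ^ k then (1 : ℝ) else 1 / ((k : ℝ) + 1))) :=
  ⟨0, by rintro _ ⟨k, rfl⟩; exact theta_term_nonneg C x k⟩

lemma theta_nonneg (C : Set G) (x : G) : 0 ≤ theta C x :=
  le_ciInf fun k => theta_term_nonneg C x k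

lemma theta_le_one (C : Set G) (x : G) : theta C x ≤ 1 := by
  refine (ciInf_le (theta_bddBelow C x) 0).trans ?_
  split_ifs <;> simp

lemma theta_le_of_notMem {C : Set G} {x : G} {k : ℕ} (h : x ∉ C ^ k) :
    theta C x ≤ 1 / ((k : ℝ) + 1) := by
  refine (ciInf_le (theta_bddBelow C x) k).trans ?_
  rw [if_neg h]

lemma le_theta {C : Set G} {x : G} {c : ℝ} (h1 : c ≤ 1)
    (h : ∀ k : ℕ, x ∉ C ^ k → c ≤ 1 / ((k : ℝ) + 1)) : c ≤ theta C x := by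
  refine le_ciInf fun k => ?_
  split_ifs with hk
  exacts [h1, h k hk]

lemma theta_le_theta {G' : Type*} [CommGroup G'] {C : Set G} {C' : Set G'} {x : G} {x' : G'}
    (h : ∀ k : ℕ, x ∈ C ^ k → x' ∈ C' ^ k) : theta C x ≤ theta C' x' :=
  le_theta (theta_le_one C x) fun k hk => theta_le_of_notMem fun hx => hk (h k hx)

lemma theta_mono {C C' : Set G} (h : C ⊆ C') (x : G) : theta C x ≤ theta C' x :=
  theta_le_theta fun _ hx => Set.pow_subset_pow_left h hx

lemma theta_map_le {G' : Type*} [CommGroup G'] (L : G →* G') (C : Set G) (x : G) :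
    theta C x ≤ theta (L '' C) (L x) :=
  theta_le_theta fun k hx => by
    rw [← Set.image_pow]
    exact Set.mem_image_of_mem L hx

lemma theta_inv (C : Set G) (x : G) : theta C⁻¹ x⁻¹ = theta C x := by
  apply le_antisymm <;> refine theta_le_theta fun k hx => ?_
  · rwa [inv_pow, Set.inv_mem_inv] at hx
  · rwa [inv_pow, Set.inv_mem_inv]

lemma theta_mul_le (C : Set G) (x y : G) : theta C x * theta C y ≤ 2 * theta C (x * y) := by
  have key : theta C x * theta C y / 2 ≤ theta C (x * y) := by
    have hx0 := theta_nonneg C x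
    have hy0 := theta_nonneg C y
    have hx1 := theta_le_one C x
    have hy1 := theta_le_one C y
    refine le_theta (by nlinarith) fun k hk => ?_
    have hor : x ∉ C ^ (k / 2) ∨ y ∉ C ^ (k - k / 2) := by
      by_contra! hcon
      apply hk
      have := Set.mul_mem_mul hcon.1 hcon.2
      rwa [← pow_add, show k / 2 + (k - k / 2) = k by omega] at this
    have aux : ∀ j : ℕ, k ≤ 2 * j + 1 → 1 / ((j : ℝ) + 1) ≤ 2 * (1 / ((k : ℝ) + 1)) := by
      intro j hj
      have hj' : (k : ℝ) ≤ 2 * j + 1 := by exact_mod_cast hj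
      rw [mul_one_div, div_le_div_iff₀ (by positivity) (by positivity)]
      linarith
    rcases hor with h | h
    · have := (theta_le_of_notMem h).trans (aux _ (by omega))
      nlinarith
    · have := (theta_le_of_notMem h).trans (aux _ (by omega))
      nlinarith
  linarith

lemma theta_eq_one {C : Set G} (h1 : 1 ∈ C) {x : G} (hx : x ∈ C) :
    theta C x = 1 := by
  refine le_antisymm (theta_le_one C x) (le_theta le_rfl fun k hk => ?_)
  rcases Nat.eq_zero_or_pos k with rfl | hk'
  · simp
  · exact absurd (Set.pow_subset_pow_right h1 hk' (by simpa using hx)) hk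

lemma theta_fst_le {G' : Type*} [CommGroup G'] (C : Set (G × G')) (x : G) (y : G') :
    theta C (x, y) ≤ theta (Prod.fst '' C) x :=
  theta_map_le (MonoidHom.fst G G') C (x, y)

lemma theta_snd_le {G' : Type*} [CommGroup G'] (C : Set (G × G')) (x : G) (y : G') :
    theta C (x, y) ≤ theta (Prod.snd '' C) y :=
  theta_map_le (MonoidHom.snd G G') C (x, y)

lemma le_theta_prod {G' : Type*} [CommGroup G'] (C : Set G) (C' : Set G') (x : G) (y : G') :
    theta C x * theta C' y ≤ theta (C ×ˢ C') (x, y) := by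
  have hx0 := theta_nonneg C x
  have hy0 := theta_nonneg C' y
  have hx1 := theta_le_one C x
  have hy1 := theta_le_one C' y
  refine le_theta (by nlinarith) fun k hk => ?_
  have : ∀ k : ℕ, (C ×ˢ C') ^ k = (C ^ k) ×ˢ (C' ^ k) := by
    intro k
    induction k with
    | zero => ext ⟨a, b⟩; simp [Prod.ext_iff]
    | succ n ih => rw [pow_succ, pow_succ, pow_succ, ih, Set.prod_mul_prod_comm]
  rw [this, Set.mem_prod, not_and_or] at hk
  rcases hk with h | h
  · have := theta_le_of_notMem h
    dsimp only at this
    nlinarith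
  · have := theta_le_of_notMem h
    dsimp only at this
    nlinarith

lemma DecayBound.norm_le_theta {C : Set G} {n : ℕ} {M : ℝ} {f : G → ℂ} (h : DecayBound C n M f)
    (x : G) : ‖f x‖ ≤ 2 ^ n * M * theta C x ^ n := by
  have hM : 0 ≤ M := (norm_nonneg _).trans (h.1 x)
  rcases Nat.eq_zero_or_pos n with rfl | hn
  · simpa using h.1 x
  have hn0 : (n : ℝ) ≠ 0 := by positivity
  rcases hM.eq_or_lt with rfl | hM
  · have := h.1 x
    simpa using this
  have hc : 0 ≤ ‖f x‖ / (2 ^ n * M) := by positivity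
  have hle : (‖f x‖ / (2 ^ n * M)) ^ (1 / (n : ℝ)) ≤ theta C x := by
    refine le_theta (Real.rpow_le_one hc ?_ (by positivity)) fun k hk => ?_
    · rw [div_le_one (by positivity)]
      refine (h.1 x).trans ?_
      have : (1 : ℝ) ≤ 2 ^ n := one_le_pow₀ (by norm_num)
      nlinarith
    · have hpow : ((k : ℝ) + 1) ^ n * ‖f x‖ ≤ 2 ^ n * M := by
        rcases Nat.eq_zero_or_pos k with rfl | hk0
        · have : (1 : ℝ) ≤ 2 ^ n := one_le_pow₀ (by norm_num)
          have := h.1 x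
          norm_num
          nlinarith
        · have hk1 : (1 : ℝ) ≤ k := by exact_mod_cast hk0
          calc ((k : ℝ) + 1) ^ n * ‖f x‖ ≤ (2 * k) ^ n * ‖f x‖ := by
                gcongr; linarith
            _ = 2 ^ n * ((k : ℝ) ^ n * ‖f x‖) := by ring
            _ ≤ 2 ^ n * M := by gcongr; exact h.2 k x hk
      have hle : ‖f x‖ / (2 ^ n * M) ≤ (1 / ((k : ℝ) + 1)) ^ n := by
        rw [div_pow, one_pow, div_le_div_iff₀ (by positivity) (by positivity)]
        linarith
      calc (‖f x‖ / (2 ^ n * M)) ^ (1 / (n : ℝ)) ≤ ((1 / ((k : ℝ) + 1)) ^ n) ^ (1 / (n : ℝ)) :=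
            Real.rpow_le_rpow hc hle (by positivity)
        _ = 1 / ((k : ℝ) + 1) := by
            rw [one_div (n : ℝ), Real.pow_rpow_inv_natCast (by positivity) hn.ne']
  have := pow_le_pow_left₀ (by positivity) hle n
  rw [← Real.rpow_natCast, ← Real.rpow_mul hc, one_div_mul_cancel hn0, Real.rpow_one,
    div_le_iff₀ (by positivity)] at this
  linarith

lemma decayBound_of_theta {C : Set G} {n : ℕ} {M : ℝ} {f : G → ℂ} (hM : 0 ≤ M)
    (h : ∀ x, ‖f x‖ ≤ M * theta C x ^ n) : DecayBound C n M f := by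
  refine ⟨fun x => (h x).trans ?_, fun k x hk => ?_⟩
  · exact mul_le_of_le_one_right hM (pow_le_one₀ (theta_nonneg C x) (theta_le_one C x))
  · have h1 := theta_le_of_notMem hk
    have h2 : (k : ℝ) * theta C x ≤ 1 := by
      calc (k : ℝ) * theta C x ≤ k * (1 / (k + 1)) := by gcongr
        _ ≤ 1 := by rw [mul_one_div, div_le_one (by positivity)]; linarith
    calc (k : ℝ) ^ n * ‖f x‖ ≤ k ^ n * (M * theta C x ^ n) := by gcongr; exact h x
      _ = M * (k * theta C x) ^ n := by ring
      _ ≤ M := mul_le_of_le_one_right hM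
        (pow_le_one₀ (mul_nonneg (by positivity) (theta_nonneg C x)) h2)

end Weights

section Growth

variable {G : Type*} [CommGroup G]

lemma exists_eq_prod_pow_of_mem_pow (t : Finset G) (k : ℕ) :
    ∀ x ∈ (t : Set G) ^ k, ∃ m : t → Fin (k + 1), x = ∏ h : t, (h : G) ^ (m h : ℕ) := by
  classical
  induction k with
  | zero =>
    intro x hx
    refine ⟨fun _ => 0, ?_⟩
    simpa using hx
  | succ k ih =>
    intro x hx
    rw [pow_succ] at hx
    obtain ⟨y, hy, g, hg, rfl⟩ := Set.mem_mul.1 hx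
    obtain ⟨m, rfl⟩ := ih y hy
    refine ⟨fun h => ⟨m h + if h = ⟨g, hg⟩ then 1 else 0, ?_⟩, ?_⟩
    · have := (m h).2
      split_ifs <;> omega
    · simp only [pow_add, Finset.prod_mul_distrib, pow_ite, pow_one, pow_zero,
        Finset.prod_ite_eq', Finset.mem_univ, if_true]

variable [TopologicalSpace G] [IsTopologicalGroup G] [LocallyCompactSpace G]
  [MeasurableSpace G] [BorelSpace G]

lemma exists_measure_pow_le (μ : Measure G) [μ.IsHaarMeasure] {C : Set G} (hC : IsCompact C) :
    ∃ (C' : Set G) (d : ℕ), IsCompact C' ∧ C ⊆ C' ∧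
      ∀ k : ℕ, μ (C' ^ k) ≤ ((k : ENNReal) + 1) ^ d * μ C' := by
  classical
  obtain ⟨K, hK, hK1⟩ := exists_compact_mem_nhds (1 : G)
  set C' := C ∪ K with hC'
  have hcomp : IsCompact C' := hC.union hK
  have h1 : (1 : G) ∈ interior C' :=
    interior_mono Set.subset_union_right (mem_interior_iff_mem_nhds.2 hK1)
  obtain ⟨t, ht⟩ := (hcomp.mul hcomp).elim_finite_subcover
    (fun g : G => g • interior C') (fun g => isOpen_interior.smul g) (fun x _ =>
      Set.mem_iUnion.2 ⟨x, ⟨1, h1, by simp⟩⟩)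
  have hstep : C' * C' ⊆ (t : Set G) * C' := by
    intro x hx
    obtain ⟨g, hg, y, hy, rfl⟩ := Set.mem_iUnion₂.1 (ht hx)
    exact Set.mul_mem_mul hg (interior_subset hy)
  have hpow : ∀ k : ℕ, C' ^ (k + 1) ⊆ (t : Set G) ^ k * C' := by
    intro k
    induction k with
    | zero => simp
    | succ k ih =>
      calc C' ^ (k + 1 + 1) = C' ^ (k + 1) * C' := pow_succ _ _
        _ ⊆ (t : Set G) ^ k * C' * C' := Set.mul_subset_mul_right ih
        _ = (t : Set G) ^ k * (C' * C') := mul_assoc _ _ _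
        _ ⊆ (t : Set G) ^ k * ((t : Set G) * C') := Set.mul_subset_mul_left hstep
        _ = (t : Set G) ^ (k + 1) * C' := by rw [pow_succ, mul_assoc]
  refine ⟨C', t.card, hcomp, Set.subset_union_left, fun k => ?_⟩
  have h1' : (1 : G) ∈ C' := interior_subset h1
  have hsub : C' ^ k ⊆ ⋃ m : t → Fin (k + 1), (∏ h : t, (h : G) ^ (m h : ℕ)) • C' := by
    intro x hx
    obtain ⟨y, hy, c, hc, rfl⟩ := Set.mem_mul.1
      (hpow k (Set.pow_subset_pow_right h1' (Nat.le_succ k) hx))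
    obtain ⟨m, rfl⟩ := exists_eq_prod_pow_of_mem_pow t k y hy
    exact Set.mem_iUnion.2 ⟨m, ⟨c, hc, rfl⟩⟩
  calc μ (C' ^ k) ≤ μ (⋃ m : t → Fin (k + 1), (∏ h : t, (h : G) ^ (m h : ℕ)) • C') :=
        measure_mono hsub
    _ ≤ ∑ m : t → Fin (k + 1), μ ((∏ h : t, (h : G) ^ (m h : ℕ)) • C') :=
        measure_iUnion_fintype_le μ _
    _ = ((k : ENNReal) + 1) ^ t.card * μ C' := by
        simp [measure_smul]

variable [T2Space G]

lemma measurable_theta {C : Set G} (hC : IsCompact C) : Measurable (theta C) := by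
  classical
  have hpow : ∀ k : ℕ, MeasurableSet (C ^ k) := by
    intro k
    have : IsCompact (C ^ k) := by
      induction k with
      | zero => simp
      | succ k ih => rw [pow_succ]; exact ih.mul hC
    exact this.isClosed.measurableSet
  unfold theta
  refine Measurable.iInf fun k => ?_
  exact Measurable.ite (hpow k) measurable_const measurable_const

lemma exists_integrable_theta_pow (μ : Measure G) [μ.IsHaarMeasure] {C : Set G}
    (hC : IsCompact C) : ∃ N : ℕ, ∀ n : ℕ, N ≤ n → Integrable (fun x => theta C x ^ n) μ := by
  obtain ⟨C', d, hC', hsub, hd⟩ := exists_measure_pow_le μ hC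
  refine ⟨d + 2, fun n hn => ?_⟩
  have hmeas : Measurable fun x => theta C x ^ n := (measurable_theta hC).pow_const n
  refine ⟨hmeas.aestronglyMeasurable, ?_⟩
  rw [hasFiniteIntegral_iff_norm]
  have hCm : ∀ k : ℕ, MeasurableSet (C' ^ k) := by
    intro k
    have : IsCompact (C' ^ k) := by
      induction k with
      | zero => simp
      | succ k ih => rw [pow_succ]; exact ih.mul hC'
    exact this.isClosed.measurableSet
  have hpt : ∀ x, ENNReal.ofReal ‖theta C x ^ n‖ ≤
      ∑' k : ℕ, (C' ^ k).indicator (fun _ => ENNReal.ofReal ((2 / ((k : ℝ) + 1)) ^ (d + 2))) x := by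
    intro x
    have hle : theta C x ^ n ≤ theta C' x ^ (d + 2) :=
      (pow_le_pow_of_le_one (theta_nonneg C x) (theta_le_one C x) hn).trans
        (pow_le_pow_left₀ (theta_nonneg C x) (theta_mono hsub x) _)
    rw [Real.norm_of_nonneg (pow_nonneg (theta_nonneg C x) _)]
    refine (ENNReal.ofReal_le_ofReal hle).trans ?_
    by_cases hx : ∃ k : ℕ, x ∈ C' ^ k
    · classical
      refine le_trans ?_ (ENNReal.le_tsum (Nat.find hx))
      rw [Set.indicator_of_mem (Nat.find_spec hx)]
      refine ENNReal.ofReal_le_ofReal (pow_le_pow_left₀ (theta_nonneg _ _) ?_ _)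
      rcases Nat.eq_zero_or_pos (Nat.find hx) with h0 | hpos
      · rw [h0]; norm_num
        linarith [theta_le_one C' x]
      · obtain ⟨j, hj⟩ := Nat.exists_eq_succ_of_ne_zero hpos.ne'
        have := theta_le_of_notMem (Nat.find_min hx (m := j) (by omega))
        refine this.trans ?_
        rw [hj]
        push_cast
        rw [div_le_div_iff₀ (by positivity) (by positivity)]
        have : (0 : ℝ) ≤ j := by positivity
        linarith
    · push Not at hx
      have h0 : theta C' x ≤ 0 := by
        refine le_of_forall_pos_lt_add fun ε hε => ?_
        obtain ⟨k, hk⟩ := exists_nat_one_div_lt hε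
        simpa using (theta_le_of_notMem (hx k)).trans_lt hk
      rw [le_antisymm h0 (theta_nonneg _ _)]
      simp
  refine (lintegral_mono hpt).trans_lt ?_
  rw [lintegral_tsum fun k => (measurable_const.indicator (hCm k)).aemeasurable]
  have hterm : ∀ k : ℕ, ∫⁻ x, (C' ^ k).indicator
      (fun _ => ENNReal.ofReal ((2 / ((k : ℝ) + 1)) ^ (d + 2))) x ∂μ ≤
      ENNReal.ofReal (2 ^ (d + 2) * (1 / ((k : ℝ) + 1)) ^ 2) * μ C' := by
    intro k
    rw [lintegral_indicator (hCm k), setLIntegral_const]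
    refine (mul_le_mul_right (hd k) _).trans ?_
    rw [← mul_assoc]
    refine mul_le_mul_left (le_of_eq ?_) _
    rw [show ((k : ENNReal) + 1) = ENNReal.ofReal ((k : ℝ) + 1) by
        rw [ENNReal.ofReal_add (by positivity) zero_le_one]; simp,
      ← ENNReal.ofReal_pow (by positivity), ← ENNReal.ofReal_mul (by positivity)]
    congr 1
    have : ((k : ℝ) + 1) ≠ 0 := by positivity
    rw [div_pow, pow_add, pow_add]
    field_simp
  refine (ENNReal.tsum_le_tsum hterm).trans_lt ?_
  rw [ENNReal.tsum_mul_right]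
  refine ENNReal.mul_lt_top ?_ hC'.measure_lt_top
  have hs : Summable fun k : ℕ => (2 : ℝ) ^ (d + 2) * (1 / ((k : ℝ) + 1)) ^ 2 := by
    refine Summable.mul_left _ ?_
    have := (summable_nat_add_iff 1).2 (Real.summable_one_div_nat_pow.2 one_lt_two)
    simpa using this
  rw [← ENNReal.ofReal_tsum_of_nonneg (fun k => by positivity) hs]
  exact ENNReal.ofReal_lt_top

end Growth

/-- Second countable locally compact Hausdorff abelian groups with their Borel structure. -/
class IsLCA (G : Type*) [CommGroup G] [TopologicalSpace G] [MeasurableSpace G] : Prop extends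
  IsTopologicalGroup G, LocallyCompactSpace G, T2Space G, SecondCountableTopology G, BorelSpace G

instance {G H : Type*} [CommGroup G] [TopologicalSpace G] [MeasurableSpace G] [IsLCA G]
    [CommGroup H] [TopologicalSpace H] [MeasurableSpace H] [IsLCA H] : IsLCA (G × H) where

section Rapid

variable {G : Type*} [CommGroup G] [TopologicalSpace G]
  {G₁ : Type*} [CommGroup G₁] [TopologicalSpace G₁]
  {G₂ : Type*} [CommGroup G₂] [TopologicalSpace G₂]
  {E : Type*} [SeminormedAddCommGroup E] {E' : Type*} [SeminormedAddCommGroup E']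

/-- Faster decay than every power of `k` outside the powers `C ^ k` of a compact set. -/
def Rapid (f : G → E) : Prop :=
  ∃ C : Set G, IsCompact C ∧ ∀ n : ℕ, ∃ M : ℝ, 0 ≤ M ∧ ∀ x, ‖f x‖ ≤ M * theta C x ^ n

lemma Rapid.exists_superset {f : G → E} (hf : Rapid f) {K : Set G} (hK : IsCompact K) :
    ∃ C : Set G, IsCompact C ∧ K ⊆ C ∧
      ∀ n : ℕ, ∃ M : ℝ, 0 ≤ M ∧ ∀ x, ‖f x‖ ≤ M * theta C x ^ n := by
  obtain ⟨C, hC, h⟩ := hf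
  refine ⟨C ∪ K, hC.union hK, Set.subset_union_right, fun n => ?_⟩
  obtain ⟨M, hM, h⟩ := h n
  refine ⟨M, hM, fun x => (h x).trans ?_⟩
  gcongr
  exacts [theta_nonneg _ _, theta_mono Set.subset_union_left x]

lemma Rapid.mono {f : G → E} (hf : Rapid f) {g : G → E'} {c : ℝ} (hc : 0 ≤ c)
    (h : ∀ x, ‖g x‖ ≤ c * ‖f x‖) : Rapid g := by
  obtain ⟨C, hC, hd⟩ := hf
  refine ⟨C, hC, fun n => ?_⟩
  obtain ⟨M, hM, hd⟩ := hd n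
  refine ⟨c * M, by positivity, fun x => (h x).trans ?_⟩
  rw [mul_assoc]
  gcongr
  exact hd x

lemma Rapid.bounded {f : G → E} (hf : Rapid f) : ∃ M : ℝ, 0 ≤ M ∧ ∀ x, ‖f x‖ ≤ M := by
  obtain ⟨C, hC, h⟩ := hf
  obtain ⟨M, hM, h⟩ := h 0
  exact ⟨M, hM, fun x => by simpa using h x⟩

lemma Rapid.comp_equiv {f : G → E} (hf : Rapid f) (L : G₁ ≃ₜ* G) :
    Rapid fun x => f (L x) := by
  obtain ⟨C, hC, h⟩ := hf
  refine ⟨L.symm '' C, hC.image L.symm.continuous, fun n => ?_⟩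
  obtain ⟨M, hM, h⟩ := h n
  refine ⟨M, hM, fun x => (h _).trans ?_⟩
  gcongr
  · exact theta_nonneg _ _
  · have := theta_map_le (L.symm : G →* G₁) C (L x)
    simpa using this

lemma Rapid.prod_of_bounds {F : G₁ × G₂ → E}
    (h₁ : ∃ C : Set G₁, IsCompact C ∧ ∀ n : ℕ, ∃ M : ℝ, 0 ≤ M ∧
      ∀ x z, ‖F (x, z)‖ ≤ M * theta C x ^ n)
    (h₂ : ∃ C : Set G₂, IsCompact C ∧ ∀ n : ℕ, ∃ M : ℝ, 0 ≤ M ∧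
      ∀ x z, ‖F (x, z)‖ ≤ M * theta C z ^ n) :
    Rapid F := by
  obtain ⟨C₁, hC₁, h₁⟩ := h₁
  obtain ⟨C₂, hC₂, h₂⟩ := h₂
  refine ⟨C₁ ×ˢ C₂, hC₁.prod hC₂, fun n => ?_⟩
  obtain ⟨M₁, hM₁, h₁⟩ := h₁ (2 * n)
  obtain ⟨M₂, hM₂, h₂⟩ := h₂ (2 * n)
  refine ⟨M₁ + M₂, by positivity, ?_⟩
  rintro ⟨x, z⟩
  have t₁ := theta_nonneg C₁ x
  have t₂ := theta_nonneg C₂ z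
  have key : ‖F (x, z)‖ ≤ (M₁ + M₂) * (theta C₁ x * theta C₂ z) ^ n := by
    refine le_of_sq_le_sq ?_ (by positivity) |>.trans_eq rfl
    calc ‖F (x, z)‖ ^ 2 = ‖F (x, z)‖ * ‖F (x, z)‖ := sq _
      _ ≤ (M₁ * theta C₁ x ^ (2 * n)) * (M₂ * theta C₂ z ^ (2 * n)) :=
          mul_le_mul (h₁ x z) (h₂ x z) (norm_nonneg _) (by positivity)
      _ = (M₁ * M₂) * ((theta C₁ x * theta C₂ z) ^ n) ^ 2 := by ring
      _ ≤ (M₁ + M₂) ^ 2 * ((theta C₁ x * theta C₂ z) ^ n) ^ 2 := by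
          gcongr; nlinarith
      _ = ((M₁ + M₂) * (theta C₁ x * theta C₂ z) ^ n) ^ 2 := by ring
  refine key.trans ?_
  gcongr
  exact le_theta_prod C₁ C₂ x z

lemma Rapid.prod_bound {F : G₁ × G₂ → E} (hF : Rapid F) :
    ∃ (C₁ : Set G₁) (C₂ : Set G₂), IsCompact C₁ ∧ IsCompact C₂ ∧ ∀ n : ℕ, ∃ M : ℝ, 0 ≤ M ∧
      ∀ x z, ‖F (x, z)‖ ≤ M * (theta C₁ x ^ n * theta C₂ z ^ n) := by
  obtain ⟨C, hC, h⟩ := hF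
  refine ⟨_, _, hC.image continuous_fst, hC.image continuous_snd, fun n => ?_⟩
  obtain ⟨M, hM, h⟩ := h (2 * n)
  refine ⟨M, hM, fun x z => (h _).trans ?_⟩
  gcongr
  rw [two_mul, pow_add]
  have h0 := theta_nonneg C (x, z)
  exact mul_le_mul (pow_le_pow_left₀ h0 (theta_fst_le C x z) n)
    (pow_le_pow_left₀ h0 (theta_snd_le C x z) n) (pow_nonneg h0 _)
    (pow_nonneg (theta_nonneg _ _) _)

lemma Rapid.fst {F : G₁ × G₂ → E} (hF : Rapid F) (z : G₂) : Rapid fun x => F (x, z) := by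
  obtain ⟨C₁, C₂, hC₁, hC₂, h⟩ := hF.prod_bound
  refine ⟨C₁, hC₁, fun n => ?_⟩
  obtain ⟨M, hM, h⟩ := h n
  refine ⟨M, hM, fun x => (h x z).trans ?_⟩
  gcongr
  exact mul_le_of_le_one_right (pow_nonneg (theta_nonneg _ _) _)
    (pow_le_one₀ (theta_nonneg _ _) (theta_le_one _ _))

lemma Rapid.snd {F : G₁ × G₂ → E} (hF : Rapid F) (x : G₁) : Rapid fun z => F (x, z) := by
  obtain ⟨C₁, C₂, hC₁, hC₂, h⟩ := hF.prod_bound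
  refine ⟨C₂, hC₂, fun n => ?_⟩
  obtain ⟨M, hM, h⟩ := h n
  refine ⟨M, hM, fun z => (h x z).trans ?_⟩
  gcongr
  exact mul_le_of_le_one_left (pow_nonneg (theta_nonneg _ _) _)
    (pow_le_one₀ (theta_nonneg _ _) (theta_le_one _ _))

lemma Rapid.comp_mul_left {f : G → E} (hf : Rapid f) (g : G) : Rapid fun x => f (g * x) := by
  obtain ⟨C, hC, hsub, h⟩ := hf.exists_superset (K := {1, g⁻¹}) (Set.toFinite _).isCompact
  have h1 : theta C g⁻¹ = 1 := theta_eq_one (hsub (by simp)) (hsub (by simp))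
  refine ⟨C, hC, fun n => ?_⟩
  obtain ⟨M, hM, h⟩ := h n
  refine ⟨M * 2 ^ n, by positivity, fun x => (h _).trans ?_⟩
  have := theta_mul_le C g⁻¹ (g * x)
  rw [h1, one_mul, inv_mul_cancel_left] at this
  rw [mul_assoc, ← mul_pow]
  gcongr
  exact theta_nonneg _ _

lemma Rapid.mul_prod {f : G₁ → ℂ} {g : G₂ → ℂ} (hf : Rapid f) (hg : Rapid g) :
    Rapid fun p : G₁ × G₂ => f p.1 * g p.2 := by
  obtain ⟨Mf, hMf, hbf⟩ := hf.bounded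
  obtain ⟨Mg, hMg, hbg⟩ := hg.bounded
  obtain ⟨C₁, hC₁, h₁⟩ := hf
  obtain ⟨C₂, hC₂, h₂⟩ := hg
  refine Rapid.prod_of_bounds ⟨C₁, hC₁, fun n => ?_⟩ ⟨C₂, hC₂, fun n => ?_⟩
  · obtain ⟨M, hM, h⟩ := h₁ n
    refine ⟨Mg * M, by positivity, fun x z => ?_⟩
    rw [norm_mul, mul_comm, mul_assoc]
    exact mul_le_mul (hbg z) (h x) (norm_nonneg _) hMg
  · obtain ⟨M, hM, h⟩ := h₂ n
    refine ⟨Mf * M, by positivity, fun x z => ?_⟩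
    rw [norm_mul, mul_assoc]
    exact mul_le_mul (hbf x) (h z) (norm_nonneg _) hMf

lemma Rapid.integrable [MeasurableSpace G] [IsLCA G] {F : Type*} [NormedAddCommGroup F] {f : G → F}
    (hf : Rapid f) {μ : Measure G} [μ.IsHaarMeasure] (hm : AEStronglyMeasurable f μ) :
    Integrable f μ := by
  obtain ⟨C, hC, h⟩ := hf
  obtain ⟨N, hN⟩ := exists_integrable_theta_pow μ hC
  obtain ⟨M, hM, h⟩ := h N
  exact ((hN N le_rfl).const_mul M).mono' hm (ae_of_all _ h)

/-- Partial integration of a rapidly decreasing function. -/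
lemma Rapid.integral_fst [MeasurableSpace G₁] [IsLCA G₁] {F : G₁ × G₂ → E}
    (hF : Rapid F) (μ : Measure G₁) [μ.IsHaarMeasure] {T : Type*} (u : T → G₂ → G₁ → ℂ)
    (hu : ∀ t z x, ‖u t z x‖ ≤ ‖F (x, z)‖) :
    ∃ C : Set G₂, IsCompact C ∧ ∀ n : ℕ, ∃ M : ℝ, 0 ≤ M ∧
      ∀ t z, ‖∫ x, u t z x ∂μ‖ ≤ M * theta C z ^ n := by
  obtain ⟨C₁, C₂, hC₁, hC₂, h⟩ := hF.prod_bound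
  obtain ⟨N, hN⟩ := exists_integrable_theta_pow μ hC₁
  refine ⟨C₂, hC₂, fun n => ?_⟩
  obtain ⟨M, hM, h⟩ := h (max N n)
  refine ⟨(∫ x, theta C₁ x ^ max N n ∂μ) * M,
    mul_nonneg (integral_nonneg fun x => pow_nonneg (theta_nonneg _ _) _) hM, fun t z => ?_⟩
  have hz : theta C₂ z ^ max N n ≤ theta C₂ z ^ n :=
    pow_le_pow_of_le_one (theta_nonneg _ _) (theta_le_one _ _) (le_max_right _ _)
  calc ‖∫ x, u t z x ∂μ‖ ≤ ∫ x, theta C₁ x ^ max N n * (M * theta C₂ z ^ n) ∂μ := by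
        refine norm_integral_le_of_norm_le ((hN _ (le_max_left _ _)).mul_const _)
          (ae_of_all _ fun x => ((hu t z x).trans (h x z)).trans ?_)
        have := pow_nonneg (theta_nonneg C₁ x) (max N n)
        calc M * (theta C₁ x ^ max N n * theta C₂ z ^ max N n)
            ≤ M * (theta C₁ x ^ max N n * theta C₂ z ^ n) := by gcongr
          _ = _ := by ring
    _ = _ := by rw [integral_mul_const]; ring

end Rapid

section Pairing

variable {G : Type*} [CommGroup G] [TopologicalSpace G] [MeasurableSpace G] [IsLCA G]
  {H : Type*} [CommGroup H] [TopologicalSpace H] [MeasurableSpace H] [IsLCA H]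
  {G₁ : Type*} [CommGroup G₁] [TopologicalSpace G₁] [MeasurableSpace G₁] [IsLCA G₁]
  {H₁ : Type*} [CommGroup H₁] [TopologicalSpace H₁] [MeasurableSpace H₁] [IsLCA H₁]
  {G₂ : Type*} [CommGroup G₂] [TopologicalSpace G₂] [MeasurableSpace G₂] [IsLCA G₂]
  {H₂ : Type*} [CommGroup H₂] [TopologicalSpace H₂] [MeasurableSpace H₂] [IsLCA H₂]
  {e : H → G → Circle} {e₁ : H₁ → G₁ → Circle} {e₂ : H₂ → G₂ → Circle}
  {μ : Measure G} [μ.IsHaarMeasure] {ν : Measure H} [ν.IsHaarMeasure]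
  {μ₁ : Measure G₁} [μ₁.IsHaarMeasure] {ν₁ : Measure H₁} [ν₁.IsHaarMeasure]
  {μ₂ : Measure G₂} [μ₂.IsHaarMeasure] {ν₂ : Measure H₂} [ν₂.IsHaarMeasure]

lemma isSchwartzBruhat_iff {f : G → ℂ} :
    IsSchwartzBruhat e μ f ↔ Continuous f ∧ Rapid f ∧ Rapid (invFourier e μ f) := by
  constructor
  · rintro ⟨C, D, hC, hD, h⟩
    refine ⟨h.continuous, ⟨C, hC, fun n => ?_⟩, ⟨D, hD, fun n => ?_⟩⟩
    · obtain ⟨M, hM⟩ := h.decay n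
      exact ⟨2 ^ n * M, mul_nonneg (by positivity) ((norm_nonneg _).trans (hM.1 1)),
        hM.norm_le_theta⟩
    · obtain ⟨M, hM⟩ := h.decay_fourier n
      exact ⟨2 ^ n * M, mul_nonneg (by positivity) ((norm_nonneg _).trans (hM.1 1)),
        hM.norm_le_theta⟩
  · rintro ⟨hc, ⟨C, hC, h⟩, ⟨D, hD, h'⟩⟩
    refine ⟨C, D, hC, hD, hc, fun n => ?_, fun n => ?_⟩
    · obtain ⟨M, hM, h⟩ := h n
      exact ⟨M, decayBound_of_theta hM h⟩
    · obtain ⟨M, hM, h⟩ := h' n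
      exact ⟨M, decayBound_of_theta hM h⟩

/-- A jointly continuous bicharacter. -/
structure IsPairing (e : H → G → Circle) : Prop where
  continuous : Continuous fun p : H × G => e p.1 p.2
  map_mul_left : ∀ h h' x, e (h * h') x = e h x * e h' x
  map_mul_right : ∀ h x x', e h (x * x') = e h x * e h x'

namespace IsPairing

lemma map_one_left (he : IsPairing e) (x : G) : e 1 x = 1 := by
  simpa using he.map_mul_left 1 1 x

lemma map_one_right (he : IsPairing e) (h : H) : e h 1 = 1 := by
  simpa using he.map_mul_right h 1 1

lemma map_inv_left (he : IsPairing e) (h : H) (x : G) : e h⁻¹ x = (e h x)⁻¹ := by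
  rw [eq_inv_iff_mul_eq_one, ← he.map_mul_left, inv_mul_cancel, he.map_one_left]

lemma map_inv_right (he : IsPairing e) (h : H) (x : G) : e h x⁻¹ = (e h x)⁻¹ := by
  rw [eq_inv_iff_mul_eq_one, ← he.map_mul_right, inv_mul_cancel, he.map_one_right]

lemma map_div_left (he : IsPairing e) (h h' : H) (x : G) : e (h / h') x = e h x / e h' x := by
  rw [div_eq_mul_inv, he.map_mul_left, he.map_inv_left, div_eq_mul_inv]

lemma map_div_right (he : IsPairing e) (h : H) (x x' : G) : e h (x / x') = e h x / e h x' := by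
  rw [div_eq_mul_inv, he.map_mul_right, he.map_inv_right, div_eq_mul_inv]

lemma flip (he : IsPairing e) : IsPairing fun x h => e h x :=
  ⟨he.continuous.comp continuous_swap, fun x x' h => he.map_mul_right h x x',
    fun x h h' => he.map_mul_left h h' x⟩

end IsPairing

/-- The pairing of products. -/
def prodPairing (e₁ : H₁ → G₁ → Circle) (e₂ : H₂ → G₂ → Circle) (h : H₁ × H₂) (x : G₁ × G₂) :
    Circle :=
  e₁ h.1 x.1 * e₂ h.2 x.2

lemma IsPairing.prod (he₁ : IsPairing e₁) (he₂ : IsPairing e₂) :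
    IsPairing (prodPairing e₁ e₂) := by
  refine ⟨?_, fun h h' x => ?_, fun h x x' => ?_⟩
  · exact (he₁.continuous.comp (by fun_prop : Continuous fun p : (H₁ × H₂) × G₁ × G₂ =>
      (p.1.1, p.2.1))).mul (he₂.continuous.comp
        (by fun_prop : Continuous fun p : (H₁ × H₂) × G₁ × G₂ => (p.1.2, p.2.2)))
  · simp only [prodPairing, Prod.fst_mul, Prod.snd_mul, he₁.map_mul_left, he₂.map_mul_left]
    exact mul_mul_mul_comm _ _ _ _
  · simp only [prodPairing, Prod.fst_mul, Prod.snd_mul, he₁.map_mul_right, he₂.map_mul_right]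
    exact mul_mul_mul_comm _ _ _ _

/-- Fourier inversion at the neutral element. -/
def InversionHolds (e : H → G → Circle) (μ : Measure G) (ν : Measure H) : Prop :=
  ∀ f : G → ℂ, IsSchwartzBruhat e μ f → ∫ h, invFourier e μ f h ∂ν = f 1

lemma continuous_coe_inv (he : IsPairing e) :
    Continuous fun p : H × G => (((e p.1 p.2)⁻¹ : Circle) : ℂ) :=
  continuous_subtype_val.comp he.continuous.inv

@[simp]
lemma norm_coe_circle (c : Circle) : ‖(c : ℂ)‖ = 1 := Circle.norm_coe c

lemma integrable_mul_circle {X : Type*} [MeasurableSpace X] {m : Measure X} {f : X → ℂ}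
    (hf : Integrable f m) {c : X → Circle} (hc : AEStronglyMeasurable (fun x => (c x : ℂ)) m) :
    Integrable (fun x => f x * c x) m :=
  hf.norm.mono' (hf.1.mul hc) (ae_of_all _ fun x => by simp)

lemma IsPairing.continuous_right (he : IsPairing e) (h : H) : Continuous (e h) :=
  he.continuous.comp (by fun_prop : Continuous fun x : G => (h, x))

lemma IsPairing.continuous_left (he : IsPairing e) (x : G) : Continuous fun h => e h x :=
  he.continuous.comp (by fun_prop : Continuous fun h : H => (h, x))

lemma IsPairing.measurable_coe_inv (he : IsPairing e) (h : H) (m : Measure G) :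
    AEStronglyMeasurable (fun x => (((e h x)⁻¹ : Circle) : ℂ)) m :=
  ((continuous_coe_inv he).comp (by fun_prop : Continuous fun x : G => (h, x))).aestronglyMeasurable

lemma continuous_invFourier (he : IsPairing e) {f : G → ℂ} (hf : Integrable f μ) :
    Continuous (invFourier e μ f) := by
  refine continuous_of_dominated (bound := fun x => ‖f x‖) ?_ ?_ hf.norm ?_
  · exact fun h => hf.1.mul (he.measurable_coe_inv h μ)
  · exact fun h => ae_of_all _ fun x => by simp
  · exact ae_of_all _ fun x => continuous_const.mul
      ((continuous_coe_inv he).comp (by fun_prop : Continuous fun h : H => (h, x)))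

lemma norm_invFourier_le (e : H → G → Circle) (f : G → ℂ) (h : H) :
    ‖invFourier e μ f h‖ ≤ ∫ x, ‖f x‖ ∂μ := by
  refine (norm_integral_le_integral_norm _).trans_eq ?_
  simp

section Test

variable {f : G → ℂ}

lemma IsSchwartzBruhat.continuous (hf : IsSchwartzBruhat e μ f) : Continuous f :=
  (isSchwartzBruhat_iff.1 hf).1

lemma IsSchwartzBruhat.rapid (hf : IsSchwartzBruhat e μ f) : Rapid f :=
  (isSchwartzBruhat_iff.1 hf).2.1

lemma IsSchwartzBruhat.rapid_fourier (hf : IsSchwartzBruhat e μ f) : Rapid (invFourier e μ f) :=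
  (isSchwartzBruhat_iff.1 hf).2.2

lemma IsSchwartzBruhat.integrable (hf : IsSchwartzBruhat e μ f) : Integrable f μ :=
  hf.rapid.integrable hf.continuous.aestronglyMeasurable

lemma IsSchwartzBruhat.continuous_fourier (hf : IsSchwartzBruhat e μ f) (he : IsPairing e) :
    Continuous (invFourier e μ f) :=
  continuous_invFourier he hf.integrable

lemma IsSchwartzBruhat.integrable_fourier (hf : IsSchwartzBruhat e μ f) (he : IsPairing e)
    (ν : Measure H) [ν.IsHaarMeasure] : Integrable (invFourier e μ f) ν :=
  hf.rapid_fourier.integrable (hf.continuous_fourier he).aestronglyMeasurable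

lemma invFourier_translate (he : IsPairing e) (f : G → ℂ) (x : G) (h : H) :
    invFourier e μ (fun t => f (x * t)) h = invFourier e μ f h * e h x := by
  unfold invFourier
  rw [← integral_mul_left_eq_self _ x⁻¹, ← integral_mul_const]
  refine integral_congr_ae (ae_of_all _ fun t => ?_)
  simp only [mul_inv_cancel_left, he.map_mul_right, he.map_inv_right, mul_inv, inv_inv,
    Circle.coe_mul]
  ring

lemma IsSchwartzBruhat.translate (hf : IsSchwartzBruhat e μ f) (he : IsPairing e) (x : G) :
    IsSchwartzBruhat e μ fun t => f (x * t) := by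
  refine isSchwartzBruhat_iff.2 ⟨hf.continuous.comp (continuous_const_mul x),
    hf.rapid.comp_mul_left x, hf.rapid_fourier.mono zero_le_one fun h => ?_⟩
  rw [invFourier_translate he]
  simp

lemma InversionHolds.inversion (hI : InversionHolds e μ ν) (he : IsPairing e)
    (hf : IsSchwartzBruhat e μ f) (x : G) : ∫ h, invFourier e μ f h * e h x ∂ν = f x := by
  have := hI _ (hf.translate he x)
  simpa only [invFourier_translate he, mul_one] using this

/-- Invariance of test functions under isomorphisms of the pairing. -/
lemma invFourier_comp_equiv (L : G₁ ≃ₜ* G) (L' : H₁ → H)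
    (hL : ∀ h x, e₁ h x = e (L' h) (L x)) {c : NNReal} (hc : μ₁.map L = c • μ) (f : G → ℂ) (h : H₁) :
    invFourier e₁ μ₁ (fun x => f (L x)) h = (c : ℂ) * invFourier e μ f (L' h) := by
  have hm : MeasurableEmbedding L := L.toHomeomorph.measurableEmbedding
  have := hm.integral_map (μ := μ₁) (fun x => f x * (((e (L' h) x)⁻¹ : Circle) : ℂ))
  unfold invFourier
  simp only [hL]
  rw [← this, hc, integral_smul_nnreal_measure]
  rfl

lemma IsSchwartzBruhat.comp_equiv (hf : IsSchwartzBruhat e μ f) (L : G₁ ≃ₜ* G) (L' : H₁ ≃ₜ* H)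
    (hL : ∀ h x, e₁ h x = e (L' h) (L x)) :
    IsSchwartzBruhat e₁ μ₁ fun x => f (L x) := by
  refine isSchwartzBruhat_iff.2 ⟨hf.continuous.comp L.continuous, hf.rapid.comp_equiv L,
    (hf.rapid_fourier.comp_equiv L').mono
      (c := Measure.haarScalarFactor (μ₁.map L) μ) (by positivity) fun h => ?_⟩
  rw [invFourier_comp_equiv L L' hL (Measure.isMulLeftInvariant_eq_smul (μ₁.map L) μ)]
  simp

/-- Partial Fourier integrals of test functions are test functions. -/
lemma invFourier_slice {f : G₁ × G₂ → ℂ} (hf : Integrable f (μ₁.prod μ₂)) (he₁ : IsPairing e₁)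
    (he₂ : IsPairing e₂) (h₁ : H₁) (h₂ : H₂) :
    invFourier e₂ μ₂ (fun z => ∫ x, f (x, z) * (((e₁ h₁ x)⁻¹ : Circle) : ℂ) ∂μ₁) h₂ =
      invFourier (prodPairing e₁ e₂) (μ₁.prod μ₂) f (h₁, h₂) := by
  unfold invFourier
  rw [integral_prod_symm _ (integrable_mul_circle hf
    ((he₁.prod he₂).measurable_coe_inv (h₁, h₂) _))]
  refine integral_congr_ae (ae_of_all _ fun z => ?_)
  simp only
  rw [← integral_mul_const]
  refine integral_congr_ae (ae_of_all _ fun x => ?_)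
  simp only [prodPairing, mul_inv, Circle.coe_mul]
  ring

lemma Rapid.dominated {F : G₁ × G₂ → ℂ} (hF : Rapid F) (μ₁ : Measure G₁)
    [μ₁.IsHaarMeasure] :
    ∃ b : G₁ → ℝ, Integrable b μ₁ ∧ ∀ x z, ‖F (x, z)‖ ≤ b x := by
  obtain ⟨C₁, C₂, hC₁, hC₂, h⟩ := hF.prod_bound
  obtain ⟨N, hN⟩ := exists_integrable_theta_pow μ₁ hC₁
  obtain ⟨M, hM, h⟩ := h N
  refine ⟨fun x => M * theta C₁ x ^ N, (hN N le_rfl).const_mul M, fun x z => (h x z).trans ?_⟩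
  exact mul_le_mul_of_nonneg_left (mul_le_of_le_one_right (pow_nonneg (theta_nonneg _ _) _)
    (pow_le_one₀ (theta_nonneg _ _) (theta_le_one _ _))) hM

lemma continuous_slice {f : G₁ × G₂ → ℂ} (hf : Rapid f) (hc : Continuous f)
    (he₁ : IsPairing e₁) : Continuous fun p : H₁ × G₂ =>
      ∫ x, f (x, p.2) * (((e₁ p.1 x)⁻¹ : Circle) : ℂ) ∂μ₁ := by
  obtain ⟨b, hb, hbd⟩ := hf.dominated μ₁
  refine continuous_of_dominated (bound := b) ?_ ?_ hb ?_
  · exact fun p => (hc.comp (by fun_prop : Continuous fun x : G₁ => (x, p.2))).aestronglyMeasurable.mul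
      (he₁.measurable_coe_inv p.1 μ₁)
  · exact fun p => ae_of_all _ fun x => by simpa using hbd x p.2
  · exact ae_of_all _ fun x => (hc.comp (by fun_prop : Continuous fun p : H₁ × G₂ => (x, p.2))).mul
      ((continuous_coe_inv he₁).comp (by fun_prop : Continuous fun p : H₁ × G₂ => (p.1, x)))

lemma IsSchwartzBruhat.slice {f : G₁ × G₂ → ℂ}
    (hf : IsSchwartzBruhat (prodPairing e₁ e₂) (μ₁.prod μ₂) f)
    (he₁ : IsPairing e₁) (he₂ : IsPairing e₂) (h₁ : H₁) :
    IsSchwartzBruhat e₂ μ₂ fun z => ∫ x, f (x, z) * (((e₁ h₁ x)⁻¹ : Circle) : ℂ) ∂μ₁ := by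
  refine isSchwartzBruhat_iff.2 ⟨?_, ?_, ?_⟩
  · exact (continuous_slice hf.rapid hf.continuous he₁).comp
      (by fun_prop : Continuous fun z : G₂ => (h₁, z))
  · obtain ⟨C, hC, h⟩ := hf.rapid.integral_fst μ₁
      (fun (_ : Unit) z x => f (x, z) * (((e₁ h₁ x)⁻¹ : Circle) : ℂ)) (by simp)
    exact ⟨C, hC, fun n => (h n).imp fun M hM => ⟨hM.1, hM.2 ()⟩⟩
  · have : invFourier e₂ μ₂ (fun z => ∫ x, f (x, z) * (((e₁ h₁ x)⁻¹ : Circle) : ℂ) ∂μ₁) =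
        fun h₂ => invFourier (prodPairing e₁ e₂) (μ₁.prod μ₂) f (h₁, h₂) :=
      funext fun h₂ => invFourier_slice hf.integrable he₁ he₂ h₁ h₂
    rw [this]
    exact hf.rapid_fourier.snd h₁

/-- Inversion on a product follows from inversion on the factors. -/
lemma InversionHolds.prod (hI₁ : InversionHolds e₁ μ₁ ν₁) (hI₂ : InversionHolds e₂ μ₂ ν₂)
    (he₁ : IsPairing e₁) (he₂ : IsPairing e₂) :
    InversionHolds (prodPairing e₁ e₂) (μ₁.prod μ₂) (ν₁.prod ν₂) := by
  intro f hf
  have hswap : IsSchwartzBruhat (prodPairing e₂ e₁) (μ₂.prod μ₁) fun p => f p.swap :=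
    hf.comp_equiv
      { MulEquiv.prodComm (M := G₂) (N := G₁) with
        continuous_toFun := continuous_swap, continuous_invFun := continuous_swap }
      { MulEquiv.prodComm (M := H₂) (N := H₁) with
        continuous_toFun := continuous_swap, continuous_invFun := continuous_swap }
      fun h x => mul_comm _ _
  have hs : ∀ h₂, invFourier e₂ μ₂ (fun z => f (1, z)) h₂ =
      ∫ h₁, invFourier (prodPairing e₁ e₂) (μ₁.prod μ₂) f (h₁, h₂) ∂ν₁ := by
    intro h₂
    have := hI₁ _ (hswap.slice he₂ he₁ h₂)
    simp only [invFourier_slice hswap.integrable he₂ he₁] at this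
    refine Eq.trans this.symm (integral_congr_ae (ae_of_all _ fun h₁ => ?_))
    simp only [invFourier]
    rw [← integral_prod_swap]
    refine integral_congr_ae (ae_of_all _ fun x => ?_)
    simp only [prodPairing, Prod.fst_swap, Prod.snd_swap, Prod.swap_swap, mul_comm (e₁ h₁ _)]
  have htest : IsSchwartzBruhat e₂ μ₂ fun z => f (1, z) := by
    refine isSchwartzBruhat_iff.2 ⟨hf.continuous.comp (by fun_prop), hf.rapid.snd 1, ?_⟩
    rw [funext hs]
    obtain ⟨C, hC, h⟩ := hf.rapid_fourier.integral_fst ν₁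
      (fun (_ : Unit) z x => invFourier (prodPairing e₁ e₂) (μ₁.prod μ₂) f (x, z)) (by simp)
    exact ⟨C, hC, fun n => (h n).imp fun M hM => ⟨hM.1, hM.2 ()⟩⟩
  rw [integral_prod_symm _ (hf.integrable_fourier (he₁.prod he₂) _)]
  simp only [← hs]
  exact hI₂ _ htest

lemma IsSchwartzBruhat.tensor {f : G₁ → ℂ} {g : G₂ → ℂ} (hf : IsSchwartzBruhat e₁ μ₁ f)
    (hg : IsSchwartzBruhat e₂ μ₂ g) :
    IsSchwartzBruhat (prodPairing e₁ e₂) (μ₁.prod μ₂) fun p => f p.1 * g p.2 := by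
  have hF : invFourier (prodPairing e₁ e₂) (μ₁.prod μ₂) (fun p => f p.1 * g p.2) =
      fun h => invFourier e₁ μ₁ f h.1 * invFourier e₂ μ₂ g h.2 := by
    funext h
    unfold invFourier
    rw [← integral_prod_mul]
    refine integral_congr_ae (ae_of_all _ fun x => ?_)
    simp only [prodPairing, mul_inv, Circle.coe_mul]
    ring
  refine isSchwartzBruhat_iff.2 ⟨?_, hf.rapid.mul_prod hg.rapid, ?_⟩
  · exact (hf.continuous.comp continuous_fst).mul (hg.continuous.comp continuous_snd)
  · rw [hF]
    exact hf.rapid_fourier.mul_prod hg.rapid_fourier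

end Test

end Pairing

section Uniqueness

variable {G : Type*} [CommGroup G] [TopologicalSpace G] [MeasurableSpace G] [IsLCA G]
  {H : Type*} [CommGroup H] [TopologicalSpace H] [MeasurableSpace H] [IsLCA H]
  {e : H → G → Circle}
  {μ : Measure G} [μ.IsHaarMeasure] {ν : Measure H} [ν.IsHaarMeasure]

lemma IsLCA.polishSpace (H : Type*) [CommGroup H] [TopologicalSpace H] [MeasurableSpace H]
    [IsLCA H] : PolishSpace H := by
  let := IsTopologicalGroup.rightUniformSpace H
  have : IsUniformGroup H := isUniformGroup_of_commGroup
  have := IsUniformGroup.uniformity_countably_generated (α := H)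
  have := IsRightUniformGroup.completeSpace_of_weaklyLocallyCompactSpace (G := H)
  infer_instance

/-- A character of `H` as a bounded continuous function. -/
def charBCF (he : IsPairing e) (x : G) : BoundedContinuousFunction H ℂ :=
  BoundedContinuousFunction.ofNormedAddCommGroup (fun h => (e h x : ℂ))
    (continuous_subtype_val.comp (he.continuous_left x)) 1 fun h => by simp

/-- The algebra of trigonometric polynomials. -/
def trigPoly (he : IsPairing e) : StarSubalgebra ℂ (BoundedContinuousFunction H ℂ) where
  carrier := Submodule.span ℂ (Set.range (charBCF he))
  mul_mem' := by
    intro a b ha hb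
    induction ha, hb using Submodule.span_induction₂ with
    | mem_mem x y hx hy =>
      obtain ⟨x, rfl⟩ := hx
      obtain ⟨y, rfl⟩ := hy
      refine Submodule.subset_span ⟨x * y, ?_⟩
      ext h
      simp [charBCF, he.map_mul_right]
    | zero_left y hy => simp
    | zero_right x hx => simp
    | add_left x y z _ _ _ h h' => simpa [add_mul] using Submodule.add_mem _ h h'
    | add_right x y z _ _ _ h h' => simpa [mul_add] using Submodule.add_mem _ h h'
    | smul_left r x y _ _ h => simpa using Submodule.smul_mem _ r h
    | smul_right r x y _ _ h => simpa using Submodule.smul_mem _ r h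
  add_mem' := fun ha hb => Submodule.add_mem _ ha hb
  algebraMap_mem' := by
    intro r
    have : algebraMap ℂ (BoundedContinuousFunction H ℂ) r = r • charBCF he 1 := by
      ext h
      simp [charBCF, he.map_one_right, BoundedContinuousFunction.algebraMap_apply]
    rw [this]
    exact Submodule.smul_mem _ _ (Submodule.subset_span ⟨1, rfl⟩)
  star_mem' := by
    intro a ha
    induction ha using Submodule.span_induction with
    | mem x hx =>
      obtain ⟨x, rfl⟩ := hx
      refine Submodule.subset_span ⟨x⁻¹, ?_⟩
      ext h
      simp [charBCF, he.map_inv_right, ← Circle.coe_inv_eq_conj]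
    | zero => simp
    | add x y _ _ h h' => simpa using Submodule.add_mem _ h h'
    | smul r x _ h => simpa using Submodule.smul_mem _ (star r) h

lemma ae_eq_zero_of_integral_char_real (he : IsPairing e) (hsep : ∀ h, (∀ x, e h x = 1) → h = 1)
    {v : H → ℝ} (hv : Integrable v ν) (h0 : ∀ x, ∫ h, (v h : ℂ) * e h x ∂ν = 0) :
    v =ᵐ[ν] 0 := by
  have := IsLCA.polishSpace H
  have hfin : ∀ w : H → ℝ, Integrable w ν → ∫⁻ h, ENNReal.ofReal (w h) ∂ν ≠ ⊤ := fun w hw =>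
    ((lintegral_mono fun h => ENNReal.ofReal_le_ofReal (le_abs_self _)).trans_lt
      ((hasFiniteIntegral_iff_norm w).1 hw.2)).ne
  have hm : ∀ w : H → ℝ, Integrable w ν → AEMeasurable (fun h => ENNReal.ofReal (w h)) ν :=
    fun w hw => hw.1.aemeasurable.ennreal_ofReal
  have hv' : Integrable (fun h => -v h) ν := hv.neg
  set P := ν.withDensity fun h => ENNReal.ofReal (v h)
  set P' := ν.withDensity fun h => ENNReal.ofReal (-v h)
  have : IsFiniteMeasure P := isFiniteMeasure_withDensity (hfin _ hv)
  have : IsFiniteMeasure P' := isFiniteMeasure_withDensity (hfin _ hv')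
  have hint : ∀ (w : H → ℝ), Integrable w ν → ∀ g : BoundedContinuousFunction H ℂ,
      Integrable (fun h => (w h : ℂ) * g h) ν := fun w hw g =>
    (hw.ofReal (𝕜 := ℂ)).mul_bdd (c := ‖g‖) g.continuous.aestronglyMeasurable
      (ae_of_all _ g.norm_coe_le_norm)
  have hdens : ∀ g : BoundedContinuousFunction H ℂ,
      ∫ h, g h ∂P - ∫ h, g h ∂P' = ∫ h, (v h : ℂ) * g h ∂ν := by
    intro g
    rw [integral_withDensity_eq_integral_toReal_smul₀ (hm _ hv) (by simp),
      integral_withDensity_eq_integral_toReal_smul₀ (hm _ hv') (by simp), ← integral_sub]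
    · refine integral_congr_ae (ae_of_all _ fun h => ?_)
      simp only [ENNReal.toReal_ofReal', Complex.real_smul]
      rw [← sub_mul, ← Complex.ofReal_sub]
      congr 2
      rcases le_total 0 (v h) with h' | h' <;> simp [h']
    · simpa only [ENNReal.toReal_ofReal', Complex.real_smul] using hint _ hv.pos_part g
    · simpa only [ENNReal.toReal_ofReal', Complex.real_smul] using hint _ hv'.pos_part g
  have heq : P = P' := by
    refine ext_of_forall_mem_subalgebra_integral_eq_of_polish (𝕜 := ℂ) (A := trigPoly he) ?_ ?_
    · intro h h' hne
      have : ∃ x, e h x ≠ e h' x := by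
        by_contra! hcon
        refine hne (div_eq_one.1 (hsep _ fun x => ?_))
        rw [he.map_div_left, hcon x, div_self']
      obtain ⟨x, hx⟩ := this
      refine ⟨charBCF he x, ⟨(charBCF he x).toContinuousMap,
        ⟨charBCF he x, Submodule.subset_span ⟨x, rfl⟩, rfl⟩, rfl⟩, ?_⟩
      exact fun h => hx (Circle.coe_injective h)
    · intro g hg
      rw [← sub_eq_zero, hdens]
      change g ∈ Submodule.span ℂ (Set.range (charBCF he)) at hg
      induction hg using Submodule.span_induction with
      | mem g hg => obtain ⟨x, rfl⟩ := hg; exact h0 x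
      | zero => simp
      | add g g' _ _ h h' =>
        simp only [BoundedContinuousFunction.coe_add, Pi.add_apply, mul_add]
        rw [integral_add (hint v hv g) (hint v hv g'), h, h', add_zero]
      | smul r g _ h =>
        have : ∀ a, (v a : ℂ) * (r • g) a = r * ((v a : ℂ) * g a) := fun a => by
          simp only [BoundedContinuousFunction.coe_smul, smul_eq_mul]; ring
        simp only [this]
        rw [integral_const_mul, h, mul_zero]
  have := (withDensity_eq_iff (hm _ hv) (hm _ hv') (hfin _ hv)).1 heq
  filter_upwards [this] with h hh
  have h2 := congrArg ENNReal.toReal hh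
  simp only [ENNReal.toReal_ofReal'] at h2
  rcases le_total 0 (v h) with h' | h' <;> simp_all

/-- Uniqueness of Fourier coefficients. -/
lemma ae_eq_zero_of_integral_char (he : IsPairing e) (hsep : ∀ h, (∀ x, e h x = 1) → h = 1)
    {u : H → ℂ} (hu : Integrable u ν) (h0 : ∀ x, ∫ h, u h * ((e h x)⁻¹ : Circle) ∂ν = 0) :
    u =ᵐ[ν] 0 := by
  have hc : ∀ x, AEStronglyMeasurable (fun h => (e h x : ℂ)) ν := fun x =>
    (continuous_subtype_val.comp (he.continuous_left x)).aestronglyMeasurable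
  have h1 : ∀ x, ∫ h, u h * (e h x : ℂ) ∂ν = 0 := fun x => by
    have := h0 x⁻¹
    simpa only [he.map_inv_right, inv_inv] using this
  have h2 : ∀ x, ∫ h, (starRingEnd ℂ) (u h) * (e h x : ℂ) ∂ν = 0 := fun x => by
    have := congrArg (starRingEnd ℂ) (h0 x)
    rw [← integral_conj] at this
    simpa only [map_mul, ← Circle.coe_inv_eq_conj, inv_inv, map_zero] using this
  have hu' : Integrable (fun h => (starRingEnd ℂ) (u h)) ν :=
    hu.norm.mono' (Complex.continuous_conj.comp_aestronglyMeasurable hu.1)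
      (ae_of_all _ fun h => by simp)
  have hre : (fun h => (u h).re) =ᵐ[ν] 0 := by
    refine ae_eq_zero_of_integral_char_real he hsep hu.re fun x => ?_
    have : ∀ h, (((u h).re : ℝ) : ℂ) * e h x =
        (1 / 2) * (u h * e h x + (starRingEnd ℂ) (u h) * e h x) := fun h => by
      rw [← add_mul, Complex.add_conj]; push_cast; ring
    simp only [this]
    rw [integral_const_mul, integral_add (integrable_mul_circle hu (hc x))
      (integrable_mul_circle hu' (hc x)), h1, h2]
    simp
  have him : (fun h => (u h).im) =ᵐ[ν] 0 := by
    refine ae_eq_zero_of_integral_char_real he hsep hu.im fun x => ?_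
    have : ∀ h, (((u h).im : ℝ) : ℂ) * e h x =
        (1 / (2 * Complex.I)) * (u h * e h x - (starRingEnd ℂ) (u h) * e h x) := fun h => by
      rw [← sub_mul, Complex.sub_conj]
      have := Complex.I_ne_zero
      push_cast
      field_simp
    simp only [this]
    rw [integral_const_mul, integral_sub (integrable_mul_circle hu (hc x))
      (integrable_mul_circle hu' (hc x)), h1, h2]
    simp
  filter_upwards [hre, him] with h h1 h2
  exact Complex.ext h1 h2

lemma eq_zero_of_integral_char (he : IsPairing e) (hsep : ∀ h, (∀ x, e h x = 1) → h = 1)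
    {u : H → ℂ} (hu : Integrable u ν) (huc : Continuous u)
    (h0 : ∀ x, ∫ h, u h * ((e h x)⁻¹ : Circle) ∂ν = 0) (h : H) : u h = 0 := by
  have := (huc.ae_eq_iff_eq ν continuous_zero).1 (ae_eq_zero_of_integral_char he hsep hu h0)
  exact congrFun this h

end Uniqueness

section Flip

variable {G : Type*} [CommGroup G] [TopologicalSpace G] [MeasurableSpace G] [IsLCA G]
  {H : Type*} [CommGroup H] [TopologicalSpace H] [MeasurableSpace H] [IsLCA H]
  {e : H → G → Circle}
  {μ : Measure G} [μ.IsHaarMeasure] {ν : Measure H} [ν.IsHaarMeasure]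

lemma continuous_coe_pairing (he : IsPairing e) : Continuous fun p : H × G => (e p.1 p.2 : ℂ) :=
  continuous_subtype_val.comp he.continuous

/-- Inversion for `G` implies inversion for its dual, as soon as there is one nonzero test
function on `G`. -/
lemma InversionHolds.flip (he : IsPairing e) (hsep : ∀ h, (∀ x, e h x = 1) → h = 1)
    (hI : InversionHolds e μ ν) {p : G → ℂ} (hp : IsSchwartzBruhat e μ p) (hp0 : p ≠ 0) :
    InversionHolds (fun x h => e h x) ν μ := by
  intro f hf
  set F : G → ℂ := invFourier (fun x h => e h x) ν f with hF
  set k : H → ℂ := invFourier e μ p with hk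
  have hFi : Integrable F μ := hf.integrable_fourier he.flip μ
  have hki : Integrable k ν := hp.integrable_fourier he ν
  have hkc : Continuous k := hp.continuous_fourier he
  obtain ⟨s, hs⟩ : ∃ s, k s ≠ 0 := by
    by_contra! hcon
    refine hp0 (funext fun x => ?_)
    have := hI.inversion he hp x
    rw [← this]
    simp [← hk, hcon]
  set E : H → ℂ := fun α => invFourier e μ F α⁻¹ with hE
  have hEc : Continuous E := (continuous_invFourier he hFi).comp continuous_inv
  have hks : Integrable (fun α => k (α * s)) ν := hki.comp_mul_right s
  have hksc : Continuous fun α => k (α * s) := hkc.comp (continuous_mul_const s)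
  have hfb : ∃ M, ∀ α, ‖f α‖ ≤ M := hf.rapid.bounded.imp fun M h => h.2
  obtain ⟨M, hM⟩ := hfb
  have hci : ∀ x : G, Continuous fun α : H => (((e α x)⁻¹ : Circle) : ℂ) := fun x =>
    (continuous_coe_inv he).comp (by fun_prop : Continuous fun α : H => (α, x))
  have hfk : Integrable (fun α => f α * k (α * s)) ν :=
    hks.bdd_mul (c := M) hf.continuous.aestronglyMeasurable (ae_of_all _ hM)
  have hEk : Integrable (fun α => E α * k (α * s)) ν :=
    hks.bdd_mul (c := ∫ x, ‖F x‖ ∂μ) hEc.aestronglyMeasurable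
      (ae_of_all _ fun α => norm_invFourier_le e F α⁻¹)
  have hu : ∀ α, f α * k (α * s) - E α * k (α * s) = 0 := by
    refine eq_zero_of_integral_char he hsep (hfk.sub hEk)
      ((hf.continuous.mul hksc).sub (hEc.mul hksc)) fun y => ?_
    have e1 : ∫ α, f α * k (α * s) * ((e α y)⁻¹ : Circle) ∂ν =
        ∫ x, p x * ((e s x)⁻¹ : Circle) * F (y * x) ∂μ := by
      calc ∫ α, f α * k (α * s) * ((e α y)⁻¹ : Circle) ∂ν
          = ∫ α, ∫ x, f α * p x *
            (((e α y)⁻¹ * (e (α * s) x)⁻¹ : Circle) : ℂ) ∂μ ∂ν := by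
            refine integral_congr_ae (ae_of_all _ fun α => ?_)
            simp only [hk, invFourier, Circle.coe_mul]
            rw [mul_assoc, mul_comm, mul_assoc, ← integral_mul_const]
            refine integral_congr_ae (ae_of_all _ fun x => ?_)
            simp only
            ring
        _ = ∫ x, ∫ α, f α * p x *
            (((e α y)⁻¹ * (e (α * s) x)⁻¹ : Circle) : ℂ) ∂ν ∂μ := by
            refine integral_integral_swap ?_
            refine integrable_mul_circle (f := fun z : H × G => f z.1 * p z.2)
              (c := fun z : H × G => (e z.1 y)⁻¹ * (e (z.1 * s) z.2)⁻¹)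
              (hf.integrable.mul_prod hp.integrable) (Continuous.aestronglyMeasurable ?_)
            refine continuous_subtype_val.comp (Continuous.mul ?_ ?_)
            · exact ((he.continuous_left y).comp continuous_fst).inv
            · exact (he.continuous.comp (by fun_prop : Continuous fun z : H × G =>
                (z.1 * s, z.2))).inv
        _ = _ := by
            refine integral_congr_ae (ae_of_all _ fun x => ?_)
            simp only [hF, invFourier]
            rw [← integral_const_mul]
            refine integral_congr_ae (ae_of_all _ fun α => ?_)
            simp only [he.map_mul_left, he.map_mul_right, mul_inv, Circle.coe_mul]
            ring
    have e2 : ∫ α, E α * k (α * s) * ((e α y)⁻¹ : Circle) ∂ν =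
        ∫ x, p x * ((e s x)⁻¹ : Circle) * F (y * x) ∂μ := by
      calc ∫ α, E α * k (α * s) * ((e α y)⁻¹ : Circle) ∂ν
          = ∫ α, ∫ x, k (α * s) * F x * ((e α (x / y) : Circle) : ℂ) ∂μ ∂ν := by
            refine integral_congr_ae (ae_of_all _ fun α => ?_)
            simp only [hE, invFourier]
            rw [mul_assoc, ← integral_mul_const]
            refine integral_congr_ae (ae_of_all _ fun x => ?_)
            simp only [div_eq_mul_inv, he.map_mul_right, he.map_inv_right, he.map_inv_left, inv_inv,
              Circle.coe_mul]
            ring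
        _ = ∫ x, ∫ α, k (α * s) * F x * ((e α (x / y) : Circle) : ℂ) ∂ν ∂μ := by
            refine integral_integral_swap ?_
            refine integrable_mul_circle (f := fun z : H × G => k (z.1 * s) * F z.2)
              (c := fun z : H × G => e z.1 (z.2 / y))
              (hks.mul_prod hFi) (Continuous.aestronglyMeasurable ?_)
            exact (continuous_coe_pairing he).comp (by fun_prop : Continuous fun z : H × G =>
                (z.1, z.2 / y))
        _ = ∫ x, F x * (p (x / y) * ((e s (x / y))⁻¹ : Circle)) ∂μ := by
            refine integral_congr_ae (ae_of_all _ fun x => ?_)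
            simp only
            rw [← hI.inversion he hp (x / y), ← integral_mul_const, ← integral_const_mul]
            refine Eq.trans ?_ (integral_mul_right_eq_self (μ := ν) (fun α =>
              F x * (k α * (e α (x / y) : ℂ) * (((e s (x / y))⁻¹ : Circle) : ℂ))) s)
            refine integral_congr_ae (ae_of_all _ fun α => ?_)
            simp only [he.map_mul_left, Circle.coe_mul]
            have : (e s (x / y) : ℂ) * (((e s (x / y))⁻¹ : Circle) : ℂ) = 1 := by
              rw [← Circle.coe_mul, mul_inv_cancel, Circle.coe_one]
            linear_combination (-(F x * k (α * s) * (e α (x / y) : ℂ))) * this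
        _ = _ := by
            rw [← integral_mul_left_eq_self _ y]
            refine integral_congr_ae (ae_of_all _ fun x => ?_)
            simp only [mul_div_cancel_left]
            ring
    have : ∀ α, (f α * k (α * s) - E α * k (α * s)) * ((e α y)⁻¹ : Circle) =
        f α * k (α * s) * ((e α y)⁻¹ : Circle) - E α * k (α * s) * ((e α y)⁻¹ : Circle) :=
      fun α => sub_mul _ _ _
    simp only [this]
    rw [integral_sub (integrable_mul_circle hfk (hci y).aestronglyMeasurable)
      (integrable_mul_circle hEk (hci y).aestronglyMeasurable), e1, e2, sub_self]
  have h1 := hu 1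
  rw [one_mul, ← sub_mul, mul_eq_zero, or_iff_left hs, sub_eq_zero] at h1
  rw [h1]
  simp only [hE, invFourier, inv_one, he.map_one_left, Circle.coe_one, mul_one]

/-- The pairing which makes `H × G` self-dual. -/
def swapPairing (e : H → G → Circle) (a b : H × G) : Circle :=
  e a.1 b.2 * e b.1 a.2

lemma IsPairing.swap (he : IsPairing e) : IsPairing (swapPairing e) := by
  refine ⟨?_, fun h h' x => ?_, fun h x x' => ?_⟩
  · exact (he.continuous.comp (by fun_prop : Continuous fun p : (H × G) × H × G =>
      (p.1.1, p.2.2))).mul (he.continuous.comp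
        (by fun_prop : Continuous fun p : (H × G) × H × G => (p.2.1, p.1.2)))
  · simp only [swapPairing, Prod.fst_mul, Prod.snd_mul, he.map_mul_left, he.map_mul_right]
    exact mul_mul_mul_comm _ _ _ _
  · simp only [swapPairing, Prod.fst_mul, Prod.snd_mul, he.map_mul_right, he.map_mul_left]
    exact mul_mul_mul_comm _ _ _ _

/-- The exchange of factors. -/
def prodCommEquiv (G H : Type*) [CommGroup G] [TopologicalSpace G] [CommGroup H]
    [TopologicalSpace H] : G × H ≃ₜ* H × G :=
  { MulEquiv.prodComm (M := G) (N := H) with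
    continuous_toFun := continuous_swap, continuous_invFun := continuous_swap }

lemma IsSchwartzBruhat.of_swap {f : H × G → ℂ}
    (hf : IsSchwartzBruhat (swapPairing e) (ν.prod μ) f) :
    IsSchwartzBruhat (prodPairing (fun x h => e h x) e) (ν.prod μ) f :=
  hf.comp_equiv (ContinuousMulEquiv.refl _) (prodCommEquiv G H) fun _ _ => mul_comm _ _

lemma invFourier_swapPairing (f : H × G → ℂ) (m : Measure (H × G)) (h : H) (x : G) :
    invFourier (swapPairing e) m f (h, x) =
      invFourier (prodPairing (fun x h => e h x) e) m f (x, h) := by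
  simp only [invFourier, swapPairing, prodPairing, mul_comm]

lemma InversionHolds.swap (he : IsPairing e) (hsep : ∀ h, (∀ x, e h x = 1) → h = 1)
    (hI : InversionHolds e μ ν) :
    InversionHolds (swapPairing e) (ν.prod μ) (ν.prod μ) := by
  intro f hf
  have hf' := hf.of_swap
  have hswap : ∫ a, invFourier (swapPairing e) (ν.prod μ) f a ∂ν.prod μ =
      ∫ a, invFourier (prodPairing (fun x h => e h x) e) (ν.prod μ) f a ∂μ.prod ν := by
    rw [← integral_prod_swap]
    exact integral_congr_ae (ae_of_all _ fun a => invFourier_swapPairing f _ a.2 a.1)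
  rw [hswap]
  by_cases hp : ∃ x, (fun z => ∫ α, f (α, z) * (((e α x)⁻¹ : Circle) : ℂ) ∂ν) ≠ 0
  · obtain ⟨x, hx⟩ := hp
    exact (hI.flip he hsep (hf'.slice he.flip he x) hx).prod hI he.flip he f hf'
  · push Not at hp
    have h0 : ∀ a, invFourier (prodPairing (fun x h => e h x) e) (ν.prod μ) f a = 0 := by
      rintro ⟨x, h⟩
      rw [← invFourier_slice hf.integrable he.flip he, hp x]
      simp [invFourier]
    simp only [h0, integral_zero]
    refine (eq_zero_of_integral_char he hsep (ν := ν) (u := fun α => f (α, 1)) ?_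
      (hf.continuous.comp (by fun_prop)) (fun x => congrFun (hp x) 1) 1).symm
    exact (hf.rapid.fst 1).integrable (hf.continuous.comp (by fun_prop)).aestronglyMeasurable

end Flip

section Gaussian

variable {G : Type*} [CommGroup G] [TopologicalSpace G] [MeasurableSpace G] [IsLCA G]
  {H : Type*} [CommGroup H] [TopologicalSpace H] [MeasurableSpace H] [IsLCA H]
  {e : H → G → Circle}
  {μ : Measure G} [μ.IsHaarMeasure] {ν : Measure H} [ν.IsHaarMeasure]

lemma Rapid.correlation {f : G → ℂ} (hf : Rapid f) (μ : Measure G) [μ.IsHaarMeasure]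
    {T : Type*} (u : T → G → G → ℂ) (hu : ∀ s x t, ‖u s x t‖ ≤ ‖f t‖ * ‖f (t * x)‖) :
    ∃ C : Set G, IsCompact C ∧ ∀ n : ℕ, ∃ M : ℝ, 0 ≤ M ∧
      ∀ s x, ‖∫ t, u s x t ∂μ‖ ≤ M * theta C x ^ n := by
  obtain ⟨C₀, hC₀, h⟩ := hf
  set C := C₀ ∪ C₀⁻¹ with hC
  have hCc : IsCompact C := hC₀.union hC₀.inv
  have hCi : C⁻¹ = C := by rw [hC, Set.union_inv, inv_inv, Set.union_comm]
  have hsymm : ∀ t, theta C t⁻¹ = theta C t := fun t => by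
    conv_lhs => rw [← hCi]
    exact theta_inv C t
  obtain ⟨N, hN⟩ := exists_integrable_theta_pow μ hCc
  refine ⟨C, hCc, fun n => ?_⟩
  obtain ⟨M, hM, h⟩ := h (N + n)
  have hb : ∀ t, ‖f t‖ ≤ M * theta C t ^ (N + n) := fun t => (h t).trans (by
    gcongr
    exacts [theta_nonneg _ _, theta_mono Set.subset_union_left t])
  refine ⟨(∫ t, theta C t ^ N ∂μ) * (M * M * 2 ^ n),
    mul_nonneg (integral_nonneg fun x => pow_nonneg (theta_nonneg _ _) _) (by positivity),
    fun s x => ?_⟩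
  calc ‖∫ t, u s x t ∂μ‖ ≤ ∫ t, theta C t ^ N * (M * M * 2 ^ n * theta C x ^ n) ∂μ := by
        refine norm_integral_le_of_norm_le ((hN N le_rfl).mul_const _)
          (ae_of_all _ fun t => (hu s x t).trans ?_)
        have h0 := theta_nonneg C t
        have h1 := theta_nonneg C (t * x)
        have h2 : theta C t * theta C (t * x) ≤ 2 * theta C x := by
          have := theta_mul_le C t⁻¹ (t * x)
          rwa [hsymm, inv_mul_cancel_left] at this
        calc ‖f t‖ * ‖f (t * x)‖
            ≤ (M * theta C t ^ (N + n)) * (M * theta C (t * x) ^ (N + n)) :=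
              mul_le_mul (hb t) (hb _) (norm_nonneg _) (by positivity)
          _ ≤ (M * theta C t ^ (N + n)) * (M * theta C (t * x) ^ n) := by
              gcongr ?_ * (?_ * ?_)
              exact pow_le_pow_of_le_one h1 (theta_le_one _ _) (Nat.le_add_left n N)
          _ = theta C t ^ N * (M * M * (theta C t * theta C (t * x)) ^ n) := by ring
          _ ≤ theta C t ^ N * (M * M * (2 * theta C x) ^ n) := by gcongr
          _ = _ := by ring
    _ = _ := by rw [integral_mul_const]; ring

/-- The ambiguity function. -/
def ambiguity (e : H → G → Circle) (μ : Measure G) (f : G → ℂ) (x : G) (η : H) : ℂ :=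
  ∫ t, f t * (starRingEnd ℂ) (f (t * x)) * (((e η t)⁻¹ : Circle) : ℂ) ∂μ

lemma conj_coe_circle (c : Circle) : (starRingEnd ℂ) (c : ℂ) = ((c⁻¹ : Circle) : ℂ) :=
  (Circle.coe_inv_eq_conj c).symm

lemma ambiguity_eq_fourier (he : IsPairing e) (hI : InversionHolds e μ ν) {f : G → ℂ}
    (hf : IsSchwartzBruhat e μ f) (x : G) (η : H) :
    ambiguity e μ f x η = ∫ ξ, (starRingEnd ℂ) (invFourier e μ f ξ) * (((e ξ x)⁻¹ : Circle) : ℂ) *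
      invFourier e μ f (ξ * η) ∂ν := by
  have hFi := hf.integrable_fourier he ν
  have hFc : Integrable (fun ξ => (starRingEnd ℂ) (invFourier e μ f ξ)) ν :=
    hFi.norm.mono' (Complex.continuous_conj.comp_aestronglyMeasurable hFi.1)
      (ae_of_all _ fun h => by simp)
  calc ambiguity e μ f x η
      = ∫ t, ∫ ξ, f t * (starRingEnd ℂ) (invFourier e μ f ξ) *
          (((e (ξ * η) t)⁻¹ * (e ξ x)⁻¹ : Circle) : ℂ) ∂ν ∂μ := by
        refine integral_congr_ae (ae_of_all _ fun t => ?_)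
        simp only
        rw [← hI.inversion he hf (t * x), ← integral_conj, ← integral_const_mul,
          ← integral_mul_const]
        refine integral_congr_ae (ae_of_all _ fun ξ => ?_)
        simp only [map_mul, conj_coe_circle, he.map_mul_left, he.map_mul_right, mul_inv,
          Circle.coe_mul]
        ring
    _ = ∫ ξ, ∫ t, f t * (starRingEnd ℂ) (invFourier e μ f ξ) *
          (((e (ξ * η) t)⁻¹ * (e ξ x)⁻¹ : Circle) : ℂ) ∂μ ∂ν := by
        refine integral_integral_swap ?_
        refine integrable_mul_circle
          (f := fun z : G × H => f z.1 * (starRingEnd ℂ) (invFourier e μ f z.2))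
          (c := fun z : G × H => (e (z.2 * η) z.1)⁻¹ * (e z.2 x)⁻¹)
          (hf.integrable.mul_prod hFc) (Continuous.aestronglyMeasurable ?_)
        refine continuous_subtype_val.comp (Continuous.mul ?_ ?_)
        · exact (he.continuous.comp (by fun_prop : Continuous fun z : G × H =>
            (z.2 * η, z.1))).inv
        · exact ((he.continuous_left x).comp continuous_snd).inv
    _ = _ := by
        refine integral_congr_ae (ae_of_all _ fun ξ => ?_)
        simp only
        rw [invFourier, invFourier, ← integral_const_mul]
        refine integral_congr_ae (ae_of_all _ fun t => ?_)
        simp only [Circle.coe_mul]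
        ring

lemma ambiguity_mul_gaussian {q : G → Circle} {σ : G → H} (he : IsPairing e)
    (hqσ : ∀ x y, q (x * y) = q x * q y * e (σ x) y) (f : G → ℂ) (x : G) (η : H) :
    ambiguity e μ (fun t => f t * q t) x η =
      (((q x)⁻¹ : Circle) : ℂ) * ambiguity e μ f x (η * σ x) := by
  unfold ambiguity
  rw [← integral_const_mul]
  refine integral_congr_ae (ae_of_all _ fun t => ?_)
  simp only [mul_comm t x, hqσ, map_mul, conj_coe_circle, he.map_mul_left, mul_inv, Circle.coe_mul]
  have : (q t : ℂ) * (((q t)⁻¹ : Circle) : ℂ) = 1 := by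
    rw [← Circle.coe_mul, mul_inv_cancel, Circle.coe_one]
  linear_combination (f t * (starRingEnd ℂ) (f (x * t)) * (((q x)⁻¹ : Circle) : ℂ) *
    (((e (σ x) t)⁻¹ : Circle) : ℂ) * (((e η t)⁻¹ : Circle) : ℂ)) * this

lemma fourier_mul_conj_fourier (he : IsPairing e) {h : G → ℂ} (hh : Integrable h μ) (ξ ξ' : H) :
    invFourier e μ h ξ * (starRingEnd ℂ) (invFourier e μ h ξ') =
      ∫ x, ambiguity e μ h x (ξ / ξ') * e ξ' x ∂μ := by
  have hhc : Integrable (fun ξ => (starRingEnd ℂ) (h ξ)) μ :=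
    hh.norm.mono' (Complex.continuous_conj.comp_aestronglyMeasurable hh.1)
      (ae_of_all _ fun h => by simp)
  have hprod : Integrable (fun z : G × G => h z.1 * (starRingEnd ℂ) (h (z.1 * z.2)))
      (μ.prod μ) :=
    (measurePreserving_prod_mul μ μ).integrable_comp_of_integrable (hh.mul_prod hhc)
  calc invFourier e μ h ξ * (starRingEnd ℂ) (invFourier e μ h ξ')
      = ∫ t, ∫ x, h t * (starRingEnd ℂ) (h (t * x)) *
          (((e (ξ / ξ') t)⁻¹ * e ξ' x : Circle) : ℂ) ∂μ ∂μ := by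
        rw [invFourier, ← integral_mul_const]
        refine integral_congr_ae (ae_of_all _ fun t => ?_)
        simp only
        rw [invFourier, ← integral_conj, ← integral_const_mul, ← integral_mul_left_eq_self _ t]
        refine integral_congr_ae (ae_of_all _ fun x => ?_)
        simp only [map_mul, conj_coe_circle, inv_inv, he.map_mul_right, div_eq_mul_inv,
          he.map_mul_left, he.map_inv_left, mul_inv, Circle.coe_mul]
        ring
    _ = ∫ x, ∫ t, h t * (starRingEnd ℂ) (h (t * x)) *
          (((e (ξ / ξ') t)⁻¹ * e ξ' x : Circle) : ℂ) ∂μ ∂μ := by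
        refine integral_integral_swap ?_
        refine integrable_mul_circle
          (f := fun z : G × G => h z.1 * (starRingEnd ℂ) (h (z.1 * z.2)))
          (c := fun z : G × G => (e (ξ / ξ') z.1)⁻¹ * e ξ' z.2)
          hprod (Continuous.aestronglyMeasurable ?_)
        refine continuous_subtype_val.comp (Continuous.mul ?_ ?_)
        · exact ((he.continuous_right _).comp continuous_fst).inv
        · exact (he.continuous_right _).comp continuous_snd
    _ = _ := by
        refine integral_congr_ae (ae_of_all _ fun x => ?_)
        simp only
        rw [ambiguity, ← integral_mul_const]
        refine integral_congr_ae (ae_of_all _ fun t => ?_)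
        simp only [Circle.coe_mul]
        ring

/-- Multiplication by characters of the second degree preserves test functions. -/
lemma IsSchwartzBruhat.mul_gaussian (he : IsPairing e) (hI : InversionHolds e μ ν) {f : G → ℂ}
    (hf : IsSchwartzBruhat e μ f) {q : G → Circle} (hq : Continuous q) (σ : G →* H)
    (hσ : Continuous σ) (hqσ : ∀ x y, q (x * y) = q x * q y * e (σ x) y) :
    IsSchwartzBruhat e μ fun x => f x * q x := by
  set h : G → ℂ := fun x => f x * q x with hh
  have hc : Continuous h := hf.continuous.mul (continuous_subtype_val.comp hq)
  have hr : Rapid h := hf.rapid.mono zero_le_one fun x => by simp [hh]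
  have hi : Integrable h μ := hr.integrable hc.aestronglyMeasurable
  refine isSchwartzBruhat_iff.2 ⟨hc, hr, ?_⟩
  by_cases h0 : ∃ ξ', invFourier e μ h ξ' ≠ 0
  swap
  · push Not at h0
    exact ⟨∅, isCompact_empty, fun n => ⟨0, le_rfl, fun x => by simp [h0 x]⟩⟩
  obtain ⟨ξ', hξ'⟩ := h0
  suffices hs : Rapid fun ξ => invFourier e μ h (ξ' * ξ) by
    simpa using hs.comp_mul_left ξ'⁻¹
  obtain ⟨C, hC, hW₁⟩ := hf.rapid.correlation μ
    (fun (η : H) x t => f t * (starRingEnd ℂ) (f (t * x)) * (((e η t)⁻¹ : Circle) : ℂ)) (by simp)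
  obtain ⟨D, hD, hW₂⟩ := hf.rapid_fourier.correlation ν
    (fun (x : G) η ξ => (starRingEnd ℂ) (invFourier e μ f ξ) * (((e ξ x)⁻¹ : Circle) : ℂ) *
      invFourier e μ f (ξ * η)) (by simp)
  set B := D ∪ (σ '' C)⁻¹ with hB
  obtain ⟨N, hN⟩ := exists_integrable_theta_pow μ hC
  refine ⟨B, hD.union (hC.image hσ).inv, fun n => ?_⟩
  obtain ⟨M₁, hM₁, hW₁⟩ := hW₁ (2 * (N + n))
  obtain ⟨M₂, hM₂, hW₂⟩ := hW₂ (2 * n)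
  have key : ∀ x η, ‖ambiguity e μ f x (η * σ x)‖ ≤
      theta C x ^ N * ((M₁ + M₂) * 2 ^ n * theta B η ^ n) := by
    intro x η
    have b₁ : ‖ambiguity e μ f x (η * σ x)‖ ≤ M₁ * theta C x ^ (2 * (N + n)) := hW₁ _ _
    have b₂ : ‖ambiguity e μ f x (η * σ x)‖ ≤ M₂ * theta D (η * σ x) ^ (2 * n) := by
      rw [ambiguity_eq_fourier he hI hf]
      exact hW₂ _ _
    have t₁ := theta_nonneg C x
    have t₂ := theta_nonneg D (η * σ x)
    have t₃ := theta_nonneg B η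
    have hle : theta C x * theta D (η * σ x) ≤ 2 * theta B η := by
      have hx : theta C x ≤ theta B (σ x)⁻¹ :=
        (theta_map_le σ C x).trans ((theta_inv _ _).symm.le.trans
          (theta_mono Set.subset_union_right _))
      have hy : theta D (η * σ x) ≤ theta B (η * σ x) := theta_mono Set.subset_union_left _
      have := theta_mul_le B (σ x)⁻¹ (η * σ x)
      rw [mul_comm η, inv_mul_cancel_left] at this
      rw [mul_comm η] at hy ⊢
      exact (mul_le_mul hx hy (theta_nonneg _ _) (theta_nonneg _ _)).trans this
    refine le_of_sq_le_sq ?_ (by positivity)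
    calc ‖ambiguity e μ f x (η * σ x)‖ ^ 2
        = ‖ambiguity e μ f x (η * σ x)‖ * ‖ambiguity e μ f x (η * σ x)‖ := sq _
      _ ≤ (M₁ * theta C x ^ (2 * (N + n))) * (M₂ * theta D (η * σ x) ^ (2 * n)) :=
          mul_le_mul b₁ b₂ (norm_nonneg _) (by positivity)
      _ = (M₁ * M₂) * (theta C x ^ N * (theta C x * theta D (η * σ x)) ^ n) ^ 2 := by ring
      _ ≤ (M₁ + M₂) ^ 2 * (theta C x ^ N * (2 * theta B η) ^ n) ^ 2 := by
          gcongr; nlinarith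
      _ = _ := by ring
  have hpos : 0 < ‖invFourier e μ h ξ'‖ := norm_pos_iff.2 hξ'
  refine ⟨(∫ x, theta C x ^ N ∂μ) * ((M₁ + M₂) * 2 ^ n) / ‖invFourier e μ h ξ'‖,
    div_nonneg (mul_nonneg (integral_nonneg fun x => pow_nonneg (theta_nonneg _ _) _)
      (by positivity)) hpos.le, fun ξ => ?_⟩
  rw [div_mul_eq_mul_div, le_div_iff₀ hpos]
  calc ‖invFourier e μ h (ξ' * ξ)‖ * ‖invFourier e μ h ξ'‖
      = ‖invFourier e μ h (ξ' * ξ) * (starRingEnd ℂ) (invFourier e μ h ξ')‖ := by simp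
    _ = ‖∫ x, ambiguity e μ h x ξ * e ξ' x ∂μ‖ := by
        rw [fourier_mul_conj_fourier he hi, mul_div_cancel_left]
    _ ≤ ∫ x, theta C x ^ N * ((M₁ + M₂) * 2 ^ n * theta B ξ ^ n) ∂μ := by
        refine norm_integral_le_of_norm_le ((hN N le_rfl).mul_const _) (ae_of_all _ fun x => ?_)
        rw [hh, ambiguity_mul_gaussian he hqσ]
        simpa using key x ξ
    _ = _ := by rw [integral_mul_const]; ring

/-- Inversion as an automorphism. -/
def invEquiv (G : Type*) [CommGroup G] [TopologicalSpace G] [IsTopologicalGroup G] : G ≃ₜ* G :=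
  { MulEquiv.inv G with
    continuous_toFun := continuous_inv, continuous_invFun := continuous_inv }

/-- The Fourier transform of a test function is a test function. -/
lemma IsSchwartzBruhat.fourier (he : IsPairing e) (hI : InversionHolds e μ ν) {f : G → ℂ}
    (hf : IsSchwartzBruhat e μ f) :
    IsSchwartzBruhat (fun x h => e h x) ν (invFourier e μ f) := by
  refine isSchwartzBruhat_iff.2 ⟨hf.continuous_fourier he, hf.rapid_fourier, ?_⟩
  have : invFourier (fun x h => e h x) ν (invFourier e μ f) = fun x => f x⁻¹ := by
    funext x
    rw [← hI.inversion he hf x⁻¹]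
    simp only [he.map_inv_right]
    rfl
  rw [this]
  exact hf.rapid.comp_equiv (invEquiv G)

end Gaussian

section PartialFourier

variable {G : Type*} [CommGroup G] [TopologicalSpace G] [MeasurableSpace G] [IsLCA G]
  {H : Type*} [CommGroup H] [TopologicalSpace H] [MeasurableSpace H] [IsLCA H]
  {e : H → G → Circle}
  {μ : Measure G} [μ.IsHaarMeasure] {ν : Measure H} [ν.IsHaarMeasure]

/-- The Fourier integral along the first factor. -/
def partialFourier (e : H → G → Circle) (ν : Measure H) (f : H × G → ℂ) (p u : G) : ℂ :=
  ∫ π, f (π, p) * (((e π u)⁻¹ : Circle) : ℂ) ∂ν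

variable {f : H × G → ℂ}

lemma IsSchwartzBruhat.partialFourier (hf : IsSchwartzBruhat (swapPairing e) (ν.prod μ) f)
    (he : IsPairing e) (u : G) : IsSchwartzBruhat e μ fun p => partialFourier e ν f p u :=
  hf.of_swap.slice he.flip he u

lemma invFourier_partialFourier (hf : IsSchwartzBruhat (swapPairing e) (ν.prod μ) f)
    (he : IsPairing e) (u : G) (h : H) :
    invFourier e μ (fun p => QDilog.partialFourier e ν f p u) h =
      invFourier (swapPairing e) (ν.prod μ) f (h, u) := by
  rw [invFourier_swapPairing]
  exact invFourier_slice hf.integrable he.flip he u h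

lemma partialFourier_eq_integral (hI : InversionHolds e μ ν)
    (hf : IsSchwartzBruhat (swapPairing e) (ν.prod μ) f) (he : IsPairing e) (p u : G) :
    partialFourier e ν f p u =
      ∫ h, invFourier (swapPairing e) (ν.prod μ) f (h, u) * e h p ∂ν := by
  simp only [← invFourier_partialFourier hf he]
  exact (hI.inversion he (hf.partialFourier he u) p).symm

lemma continuous_partialFourier (hf : IsSchwartzBruhat (swapPairing e) (ν.prod μ) f)
    (he : IsPairing e) : Continuous fun z : G × G => partialFourier e ν f z.1 z.2 :=
  (continuous_slice hf.rapid hf.continuous he.flip).comp continuous_swap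

lemma rapid_partialFourier (hI : InversionHolds e μ ν)
    (hf : IsSchwartzBruhat (swapPairing e) (ν.prod μ) f) (he : IsPairing e) :
    Rapid fun z : G × G => partialFourier e ν f z.1 z.2 := by
  refine Rapid.prod_of_bounds ?_ ?_
  · obtain ⟨C, hC, h⟩ := hf.rapid.integral_fst ν
      (fun (u : G) p π => f (π, p) * (((e π u)⁻¹ : Circle) : ℂ)) (by simp)
    exact ⟨C, hC, fun n => (h n).imp fun M hM => ⟨hM.1, fun x z => hM.2 z x⟩⟩
  · obtain ⟨C, hC, h⟩ := hf.rapid_fourier.integral_fst ν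
      (fun (p : G) u h => invFourier (swapPairing e) (ν.prod μ) f (h, u) * e h p) (by simp)
    refine ⟨C, hC, fun n => (h n).imp fun M hM => ⟨hM.1, fun x z => ?_⟩⟩
    rw [partialFourier_eq_integral hI hf he]
    exact hM.2 x z

/-- Evaluation of the Fourier transform of the function `(α, x) ↦ e(α, σ x)`. -/
lemma integral_mul_invFourier (hI : InversionHolds e μ ν)
    (hf : IsSchwartzBruhat (swapPairing e) (ν.prod μ) f) (he : IsPairing e)
    {φ : H × G → ℂ} {σ : G → G} (hφ : ∀ᵐ x ∂μ, ∀ α, φ (α, x) = e α (σ x))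
    (hm : Integrable (fun a => φ a * invFourier (swapPairing e) (ν.prod μ) f a) (ν.prod μ)) :
    ∫ a, φ a * invFourier (swapPairing e) (ν.prod μ) f a ∂(ν.prod μ) =
      ∫ x, partialFourier e ν f (σ x) x ∂μ := by
  rw [integral_prod_symm _ hm]
  refine integral_congr_ae ?_
  filter_upwards [hφ] with x hx
  rw [partialFourier_eq_integral hI hf he]
  refine integral_congr_ae (ae_of_all _ fun α => ?_)
  simp only [hx α]
  ring

end PartialFourier

section LocalFieldMeasure

variable {F : Type*} [NontriviallyNormedField F] [LocallyCompactSpace F]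
  [MeasurableSpace F] [BorelSpace F]

lemma properSpace_localField (F : Type*) [NontriviallyNormedField F] [LocallyCompactSpace F] :
    ProperSpace F := .of_locallyCompactSpace F

lemma secondCountable_localField (F : Type*) [NontriviallyNormedField F]
    [LocallyCompactSpace F] : SecondCountableTopology F :=
  have := properSpace_localField F
  inferInstance

lemma isOpenEmbedding_unitsVal (F : Type*) [NontriviallyNormedField F] :
    IsOpenEmbedding (Units.val : Fˣ → F) := by
  refine ⟨Units.isEmbedding_val₀, ?_⟩
  have : Set.range (Units.val : Fˣ → F) = {0}ᶜ := by
    ext x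
    exact ⟨fun ⟨u, hu⟩ => hu ▸ u.ne_zero, fun hx => ⟨Units.mk0 x hx, rfl⟩⟩
  rw [this]
  exact isOpen_compl_singleton

instance : BorelSpace Fˣ := ⟨by
  rw [Units.instMeasurableSpace, BorelSpace.measurable_eq (α := F)]
  exact ((congrArg (@borel Fˣ) Units.isEmbedding_val₀.eq_induced).trans borel_comap).symm⟩

instance : IsLCA Fˣ :=
  have := secondCountable_localField F
  { is_open_generated_countable := Units.isEmbedding_val₀.secondCountableTopology.1 }

lemma measurableEmbedding_unitsVal : MeasurableEmbedding (Units.val : Fˣ → F) :=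
  (isOpenEmbedding_unitsVal F).measurableEmbedding

lemma isPairing_dualPairing : IsPairing (dualPairing (B := Fˣ)) := by
  refine ⟨?_, fun _ _ _ => rfl, fun h x x' => map_mul h x x'⟩
  have h : Continuous fun α : PontryaginDual Fˣ => (ContinuousMonoidHom.toContinuousMap α) :=
    (ContinuousMonoidHom.isInducing_toContinuousMap Fˣ Circle).continuous
  exact (continuous_eval (F := C(Fˣ, Circle))).comp (h.prodMap continuous_id)

instance [MeasurableSpace (PontryaginDual Fˣ)] [BorelSpace (PontryaginDual Fˣ)] :
    IsLCA (PontryaginDual Fˣ) :=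
  have : SecondCountableTopology (PontryaginDual Fˣ) :=
    (ContinuousMonoidHom.isEmbedding_toContinuousMap Fˣ Circle).secondCountableTopology
  { is_open_generated_countable := this.1 }

section Modulus

variable (μ : Measure F) [μ.IsAddHaarMeasure]

lemma modulus_of_unit (x : Fˣ) : modulus (x : F) = distribHaarChar F x := by
  have : Units.mk0 (x : F) x.ne_zero = x := Units.ext rfl
  simp [modulus, this]

lemma modulus_mul_unit (x y : Fˣ) : modulus ((x * y : Fˣ) : F) = modulus (x : F) * modulus (y : F) := by
  simp only [modulus_of_unit, map_mul, NNReal.coe_mul]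

lemma modulus_unit_pos (x : Fˣ) : 0 < modulus (x : F) := by
  rw [modulus_of_unit]
  exact distribHaarChar_pos

lemma ofReal_modulus_mul (x : Fˣ) (s : Set F) :
    ENNReal.ofReal (modulus (x : F)) * μ s = μ (x • s) := by
  have := secondCountable_localField F
  rw [modulus_of_unit, ENNReal.ofReal_coe_nnreal, distribHaarChar_mul]

lemma smul_closedBall_one (x : Fˣ) :
    x • Metric.closedBall (0 : F) 1 = Metric.closedBall 0 ‖(x : F)‖ := by
  have := smul_closedBall' x.ne_zero (0 : F) 1
  rw [smul_zero, mul_one] at this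
  exact this

lemma measure_closedBall_norm (x : Fˣ) :
    μ (Metric.closedBall 0 ‖(x : F)‖) =
      ENNReal.ofReal (modulus (x : F)) * μ (Metric.closedBall 0 1) := by
  rw [ofReal_modulus_mul, smul_closedBall_one]

lemma measure_closedBall_one_pos : μ (Metric.closedBall (0 : F) 1) ≠ 0 :=
  (Metric.measure_closedBall_pos μ 0 one_pos).ne'

lemma measure_closedBall_lt_top (x : F) (r : ℝ) : μ (Metric.closedBall x r) < ⊤ := by
  have := properSpace_localField F
  exact (isCompact_closedBall x r).measure_lt_top

lemma modulus_le_modulus {x y : Fˣ} (h : ‖(x : F)‖ ≤ ‖(y : F)‖) :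
    modulus (x : F) ≤ modulus (y : F) := by
  have hle := measure_mono (μ := (Measure.addHaar : Measure F))
    (Metric.closedBall_subset_closedBall (x := (0 : F)) h)
  rw [measure_closedBall_norm, measure_closedBall_norm,
    ENNReal.mul_le_mul_iff_left (measure_closedBall_one_pos _)
      (measure_closedBall_lt_top _ _ _).ne] at hle
  exact (ENNReal.ofReal_le_ofReal_iff (modulus_unit_pos y).le).1 hle

lemma measurable_modulus : Measurable fun x : Fˣ => modulus (x : F) := by
  have hmono : Monotone fun r : ℝ => (Measure.addHaar : Measure F) (Metric.closedBall 0 r) :=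
    fun r s h => measure_mono (Metric.closedBall_subset_closedBall h)
  have : (fun x : Fˣ => modulus (x : F)) = fun x : Fˣ =>
      ((Measure.addHaar : Measure F) (Metric.closedBall 0 ‖(x : F)‖) /
        (Measure.addHaar : Measure F) (Metric.closedBall 0 1)).toReal := by
    funext x
    rw [measure_closedBall_norm, ENNReal.mul_div_cancel_right (measure_closedBall_one_pos _)
      (measure_closedBall_lt_top _ _ _).ne, ENNReal.toReal_ofReal (modulus_unit_pos x).le]
  rw [this]
  exact ((hmono.measurable.comp (measurable_norm.comp
    measurableEmbedding_unitsVal.measurable)).div_const _).ennreal_toReal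

lemma exists_modulus_ge_two (F : Type*) [NontriviallyNormedField F] [LocallyCompactSpace F]
    [MeasurableSpace F] [BorelSpace F] :
    ∃ ϖ : Fˣ, 1 < ‖(ϖ : F)‖ ∧ 2 ≤ modulus (ϖ : F) := by
  obtain ⟨η, hη⟩ := NormedField.exists_lt_norm F 2
  have hη0 : η ≠ 0 := by
    rintro rfl
    norm_num at hη
  refine ⟨Units.mk0 η hη0 * Units.mk0 η hη0, ?_, ?_⟩
  · simp only [Units.val_mul, Units.val_mk0, norm_mul]
    nlinarith
  · set μ : Measure F := Measure.addHaar
    set ϖ := Units.mk0 η hη0 * Units.mk0 η hη0 with hϖ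
    have hn : ‖(ϖ : F)‖ = ‖η‖ * ‖η‖ := by simp [hϖ]
    have hdisj : Disjoint (Metric.closedBall (0 : F) 1) (Metric.closedBall η 1) := by
      refine Metric.closedBall_disjoint_closedBall ?_
      rw [dist_zero_left]
      linarith
    have hsub : Metric.closedBall (0 : F) 1 ∪ Metric.closedBall η 1 ⊆
        Metric.closedBall 0 ‖(ϖ : F)‖ := by
      refine Set.union_subset (Metric.closedBall_subset_closedBall ?_)
        (Metric.closedBall_subset_closedBall' ?_)
      · rw [hn]; nlinarith
      · rw [hn, dist_zero_right]; nlinarith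
    have hle := measure_mono (μ := μ) hsub
    rw [measure_union hdisj Metric.isClosed_closedBall.measurableSet, measure_closedBall_norm,
      Measure.addHaar_closedBall_center μ η 1, ← two_mul,
      ENNReal.mul_le_mul_iff_left (measure_closedBall_one_pos _)
        (measure_closedBall_lt_top _ _ _).ne] at hle
    rw [show (2 : ENNReal) = ENNReal.ofReal 2 by simp] at hle
    exact (ENNReal.ofReal_le_ofReal_iff (modulus_unit_pos _).le).1 hle

end Modulus

section MulHaar

variable (μ : Measure F) [μ.IsAddHaarMeasure]

lemma comap_val_preimage_mul (c : Fˣ) (s : Set Fˣ) :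
    ENNReal.ofReal (modulus (c : F)) * μ.comap Units.val ((c * ·) ⁻¹' s) =
      μ.comap (Units.val : Fˣ → F) s := by
  rw [measurableEmbedding_unitsVal.comap_apply, measurableEmbedding_unitsVal.comap_apply,
    ofReal_modulus_mul]
  congr 1
  ext x
  simp only [Set.mem_smul_set, Set.mem_image, Set.mem_preimage, exists_exists_and_eq_and]
  constructor
  · rintro ⟨y, hy, rfl⟩
    exact ⟨c * y, hy, rfl⟩
  · rintro ⟨y, hy, rfl⟩
    exact ⟨c⁻¹ * y, by simpa using hy, by simp [Units.smul_def]⟩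

lemma measurable_density :
    Measurable fun x : Fˣ => ENNReal.ofReal (modulus (x : F))⁻¹ :=
  measurable_modulus.inv.ennreal_ofReal

instance isMulLeftInvariant_mulHaar : (mulHaar μ).IsMulLeftInvariant := by
  refine ⟨fun c => ?_⟩
  ext s hs
  have hc : Measurable (c * · : Fˣ → Fˣ) := measurable_const_mul c
  have hmap : Measure.map (c * ·) (μ.comap (Units.val : Fˣ → F)) =
      (ENNReal.ofReal (modulus (c : F)))⁻¹ • μ.comap (Units.val : Fˣ → F) := by
    ext t ht
    have h0 : ENNReal.ofReal (modulus (c : F)) ≠ 0 := by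
      simpa using modulus_unit_pos c
    rw [Measure.map_apply hc ht, Measure.smul_apply, ← comap_val_preimage_mul μ c t, smul_eq_mul,
      ← mul_assoc, ENNReal.inv_mul_cancel h0 ENNReal.ofReal_ne_top, one_mul]
  have h0 : ENNReal.ofReal (modulus (c : F)) ≠ 0 := by
    simpa using modulus_unit_pos c
  rw [Measure.map_apply hc hs, mulHaar, withDensity_apply _ (hc hs), withDensity_apply _ hs,
    ← lintegral_indicator (hc hs), ← lintegral_indicator hs]
  have hrw : ∀ x : Fˣ, ((c * ·) ⁻¹' s).indicator
      (fun x : Fˣ => ENNReal.ofReal (modulus (x : F))⁻¹) x =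
      ENNReal.ofReal (modulus (c : F)) * s.indicator
        (fun x : Fˣ => ENNReal.ofReal (modulus (x : F))⁻¹) (c * x) := by
    intro x
    by_cases hx : c * x ∈ s
    · rw [Set.indicator_of_mem (show x ∈ (c * ·) ⁻¹' s from hx), Set.indicator_of_mem hx,
        ← ENNReal.ofReal_mul (modulus_unit_pos c).le, modulus_mul_unit, mul_inv,
        mul_inv_cancel_left₀ (modulus_unit_pos c).ne']
    · rw [Set.indicator_of_notMem (show x ∉ (c * ·) ⁻¹' s from hx), Set.indicator_of_notMem hx,
        mul_zero]
  have hm : Measurable (s.indicator fun x : Fˣ => ENNReal.ofReal (modulus (x : F))⁻¹) :=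
    measurable_density.indicator hs
  simp only [hrw]
  rw [lintegral_const_mul _ (show Measurable fun x => s.indicator
      (fun x : Fˣ => ENNReal.ofReal (modulus (x : F))⁻¹) (c * x) from hm.comp hc), ← lintegral_map hm hc, hmap, lintegral_smul_measure,
    smul_eq_mul, ← mul_assoc, ENNReal.mul_inv_cancel h0 ENNReal.ofReal_ne_top, one_mul]

instance isHaarMeasure_mulHaar : (mulHaar μ).IsHaarMeasure where
  lt_top_of_isCompact := by
    intro K hK
    rcases K.eq_empty_or_nonempty with rfl | hne
    · simp
    obtain ⟨x₀, hx₀, hmin⟩ := hK.exists_isMinOn hne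
      (f := fun x : Fˣ => ‖(x : F)‖) (Units.continuous_val.norm.continuousOn)
    rw [mulHaar, withDensity_apply _ hK.isClosed.measurableSet]
    have hb : ∀ x ∈ K, ENNReal.ofReal (modulus (x : F))⁻¹ ≤
        ENNReal.ofReal (modulus (x₀ : F))⁻¹ := fun x hx =>
      ENNReal.ofReal_le_ofReal (inv_anti₀ (modulus_unit_pos x₀) (modulus_le_modulus (hmin hx)))
    refine (setLIntegral_mono measurable_const hb).trans_lt ?_
    rw [setLIntegral_const, measurableEmbedding_unitsVal.comap_apply]
    exact ENNReal.mul_lt_top ENNReal.ofReal_lt_top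
      (hK.image Units.continuous_val).measure_lt_top
  open_pos := by
    intro U hU hne h0
    rw [mulHaar, withDensity_apply _ hU.measurableSet, lintegral_eq_zero_iff measurable_density]
      at h0
    have hpos : ∀ x : Fˣ, ENNReal.ofReal (modulus (x : F))⁻¹ ≠ 0 := fun x => by
      simpa using modulus_unit_pos x
    have h1 : μ.comap (Units.val : Fˣ → F) U = 0 := by
      rw [← Measure.restrict_eq_zero, ← ae_eq_bot, ← Filter.eventually_false_iff_eq_bot]
      filter_upwards [h0] with x hx using hpos x hx
    rw [measurableEmbedding_unitsVal.comap_apply] at h1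
    exact ((isOpenEmbedding_unitsVal F).isOpenMap U hU).measure_ne_zero μ (hne.image _) h1

instance noAtoms_mulHaar : NullSingletonClass (mulHaar μ) := by
  have h : NullSingletonClass (μ.comap (Units.val : Fˣ → F)) := ⟨fun x => by
    rw [measurableEmbedding_unitsVal.comap_apply]
    simp⟩
  exact ⟨fun x => withDensity_absolutelyContinuous _ _ (measure_singleton x)⟩

lemma ae_val_ne (c : F) : ∀ᵐ x : Fˣ ∂(mulHaar μ), (x : F) ≠ c := by
  by_cases hc : c = 0
  · subst hc
    exact ae_of_all _ fun x => x.ne_zero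
  · filter_upwards [compl_mem_ae_iff.2 (measure_singleton (μ := mulHaar μ) (Units.mk0 c hc))]
      with x hx h
    exact hx (Units.ext h)

/-- The unit `1 + x`, with junk value `1` for `x = -1`. -/
def onePlus (x : Fˣ) : Fˣ :=
  open Classical in if h : 1 + (x : F) = 0 then 1 else Units.mk0 (1 + (x : F)) h

lemma onePlus_eq {x : Fˣ} (h : 1 + (x : F) ≠ 0) : onePlus x = Units.mk0 (1 + (x : F)) h :=
  dif_neg h

lemma val_onePlus {x : Fˣ} (h : 1 + (x : F) ≠ 0) : (onePlus x : F) = 1 + x := by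
  rw [onePlus_eq h, Units.val_mk0]

lemma continuousAt_onePlus {x : Fˣ} (h : 1 + (x : F) ≠ 0) : ContinuousAt onePlus x := by
  rw [Units.isEmbedding_val₀.continuousAt_iff]
  have hc : Continuous fun x : Fˣ => 1 + (x : F) := by fun_prop
  refine hc.continuousAt.congr ?_
  filter_upwards [hc.continuousAt.eventually_ne h] with y hy
  exact (val_onePlus hy).symm

lemma measurable_onePlus : Measurable (onePlus : Fˣ → Fˣ) := by
  classical
  rw [← measurableEmbedding_unitsVal.measurable_comp_iff]
  have hc : Continuous fun x : Fˣ => 1 + (x : F) := by fun_prop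
  have : Units.val ∘ (onePlus : Fˣ → Fˣ) = fun x : Fˣ => if 1 + (x : F) = 0 then 1 else 1 + (x : F) := by
    funext x
    simp only [Function.comp, onePlus]
    split_ifs <;> simp
  rw [this]
  exact Measurable.ite (hc.measurable (measurableSet_singleton 0)) measurable_const hc.measurable

end MulHaar

end LocalFieldMeasure

section LogWeight

variable {F : Type*} [NontriviallyNormedField F] [LocallyCompactSpace F]
  [MeasurableSpace F] [BorelSpace F]

lemma measurePreserving_onePlus (μ : Measure F) [μ.IsAddHaarMeasure] :
    MeasurePreserving (onePlus : Fˣ → Fˣ) (μ.comap Units.val) (μ.comap Units.val) := by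
  refine ⟨measurable_onePlus, ?_⟩
  ext s hs
  rw [Measure.map_apply measurable_onePlus hs, measurableEmbedding_unitsVal.comap_apply,
    measurableEmbedding_unitsVal.comap_apply,
    ← measure_preimage_add μ 1 (Units.val '' s)]
  refine measure_congr ?_
  filter_upwards [compl_mem_ae_iff.2 (measure_singleton (μ := μ) (0 : F)),
    compl_mem_ae_iff.2 (measure_singleton (μ := μ) (-1 : F))] with x h0 h1
  have h0 : x ≠ 0 := h0
  have h1 : 1 + x ≠ 0 := fun h => h1 (eq_neg_of_add_eq_zero_right h)
  apply propext
  constructor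
  · rintro ⟨u, hu, rfl⟩
    exact ⟨onePlus u, hu, val_onePlus h1⟩
  · rintro ⟨v, hv, hvx⟩
    refine ⟨Units.mk0 x h0, ?_, rfl⟩
    have : onePlus (Units.mk0 x h0) = v := Units.ext ((val_onePlus (by simpa using h1)).trans
      (by simpa using hvx.symm))
    rwa [Set.mem_preimage, this]

/-- A logarithmic weight. -/
def logWeight (x : Fˣ) : ℝ := 1 + |Real.log ‖(x : F)‖|

lemma one_le_logWeight (x : Fˣ) : 1 ≤ logWeight x := by
  have := abs_nonneg (Real.log ‖(x : F)‖)
  unfold logWeight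
  linarith

lemma logWeight_pos (x : Fˣ) : 0 < logWeight x := one_pos.trans_le (one_le_logWeight x)

lemma norm_unit_pos (x : Fˣ) : 0 < ‖(x : F)‖ := norm_pos_iff.2 x.ne_zero

lemma log_norm_mul (x y : Fˣ) :
    Real.log ‖((x * y : Fˣ) : F)‖ = Real.log ‖(x : F)‖ + Real.log ‖(y : F)‖ := by
  rw [Units.val_mul, norm_mul, Real.log_mul (norm_unit_pos x).ne' (norm_unit_pos y).ne']

lemma logWeight_mul_le (x y : Fˣ) : logWeight (x * y) ≤ logWeight x * logWeight y := by
  unfold logWeight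
  rw [log_norm_mul]
  have := abs_add_le (Real.log ‖(x : F)‖) (Real.log ‖(y : F)‖)
  have h1 := abs_nonneg (Real.log ‖(x : F)‖)
  have h2 := abs_nonneg (Real.log ‖(y : F)‖)
  nlinarith

lemma logWeight_inv (x : Fˣ) : logWeight x⁻¹ = logWeight x := by
  unfold logWeight
  rw [Units.val_inv_eq_inv_val, norm_inv, Real.log_inv, abs_neg]

lemma continuous_log_norm : Continuous fun x : Fˣ => Real.log ‖(x : F)‖ :=
  Units.continuous_val.norm.log fun x => (norm_unit_pos x).ne'

lemma continuous_logWeight : Continuous (logWeight : Fˣ → ℝ) :=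
  continuous_const.add continuous_log_norm.abs

lemma exists_theta_mul_logWeight_le {C : Set Fˣ} (hC : IsCompact C) :
    ∃ c : ℝ, 0 ≤ c ∧ ∀ x, theta C x * logWeight x ≤ c := by
  obtain ⟨L, hL⟩ := hC.exists_bound_of_continuousOn continuous_log_norm.continuousOn
  set L' := |L| + 1 with hL'
  have hL0 : 0 < L' := by positivity
  have hpow : ∀ (k : ℕ) (x : Fˣ), x ∈ C ^ k → |Real.log ‖(x : F)‖| ≤ k * L' := by
    intro k
    induction k with
    | zero =>
      intro x hx
      rw [pow_zero, Set.mem_one] at hx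
      simp [hx]
    | succ k ih =>
      intro x hx
      rw [pow_succ] at hx
      obtain ⟨y, hy, z, hz, rfl⟩ := Set.mem_mul.1 hx
      rw [log_norm_mul]
      have h1 := ih y hy
      have h2 := (Real.norm_eq_abs _).symm.le.trans ((hL z hz).trans (le_abs_self L))
      have h3 := abs_add_le (Real.log ‖(y : F)‖) (Real.log ‖(z : F)‖)
      push_cast
      linarith
  refine ⟨2 + L', by positivity, fun x => ?_⟩
  set a := |Real.log ‖(x : F)‖| with ha
  have ha0 : 0 ≤ a := abs_nonneg _
  have h0 := theta_nonneg C x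
  have h1 := theta_le_one C x
  suffices h : theta C x * a ≤ 1 + L' by
    unfold logWeight
    rw [← ha]
    linarith
  set k := ⌊a / (L' + 1)⌋₊ with hk
  have hk1 : k * (L' + 1) ≤ a := by
    rw [← le_div_iff₀ (by positivity)]
    exact Nat.floor_le (by positivity)
  have hk2 : a ≤ (k + 1) * (L' + 1) := by
    rw [← div_le_iff₀ (by positivity)]
    exact (Nat.lt_floor_add_one _).le
  rcases ha0.eq_or_lt with h | hpos
  · rw [← h, mul_zero]; positivity
  have hx : x ∉ C ^ k := by
    intro hx
    have h2 := hpow k x hx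
    rcases Nat.eq_zero_or_pos k with h3 | h3
    · rw [h3] at h2
      simp only [Nat.cast_zero, zero_mul] at h2
      linarith
    · have : (1 : ℝ) ≤ k := by exact_mod_cast h3
      nlinarith
  calc theta C x * a ≤ 1 / ((k : ℝ) + 1) * ((k + 1) * (L' + 1)) := by
        gcongr
        exact theta_le_of_notMem hx
    _ = 1 + L' := by field_simp; ring

lemma isCompact_annulus (R : ℝ) (hR : 0 < R) :
    IsCompact {x : Fˣ | R⁻¹ ≤ ‖(x : F)‖ ∧ ‖(x : F)‖ ≤ R} := by
  have := properSpace_localField F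
  rw [Units.isEmbedding_val₀.isCompact_iff]
  have : Units.val '' {x : Fˣ | R⁻¹ ≤ ‖(x : F)‖ ∧ ‖(x : F)‖ ≤ R} =
      Metric.closedBall (0 : F) R ∩ {x : F | R⁻¹ ≤ ‖x‖} := by
    ext x
    simp only [Set.mem_image, Set.mem_ofPred_eq, Set.mem_inter_iff, mem_closedBall_zero_iff]
    constructor
    · rintro ⟨u, hu, rfl⟩
      exact ⟨hu.2, hu.1⟩
    · rintro ⟨h1, h2⟩
      have hx : x ≠ 0 := norm_pos_iff.1 (lt_of_lt_of_le (by positivity) h2)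
      exact ⟨Units.mk0 x hx, ⟨h2, h1⟩, rfl⟩
  rw [this]
  exact (isCompact_closedBall 0 R).inter_right (isClosed_le continuous_const continuous_norm)

lemma exists_one_le_theta_mul_logWeight (F : Type*) [NontriviallyNormedField F]
    [LocallyCompactSpace F] [MeasurableSpace F] [BorelSpace F] :
    ∃ C : Set Fˣ, IsCompact C ∧ ∃ c : ℝ, 0 ≤ c ∧ ∀ x : Fˣ, 1 ≤ c * (logWeight x * theta C x) := by
  obtain ⟨η, hη⟩ := NormedField.exists_one_lt_norm F
  have hη0 : η ≠ 0 := by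
    rintro rfl
    norm_num at hη
  set ϖ : Fˣ := Units.mk0 η hη0 with hϖ
  set R := ‖η‖ with hR
  have hR0 : 0 < R := by positivity
  have hR1 : R⁻¹ ≤ 1 := inv_le_one_of_one_le₀ hη.le
  have hlog : 0 < Real.log R := Real.log_pos hη
  set C : Set Fˣ := {x : Fˣ | R⁻¹ ≤ ‖(x : F)‖ ∧ ‖(x : F)‖ ≤ R} with hC
  have h1C : (1 : Fˣ) ∈ C := by simp [hC, hR1, hη.le]
  have hϖC : ϖ ∈ C := by simp [hC, hϖ, ← hR, hR1.trans hη.le]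
  have hϖC' : ϖ⁻¹ ∈ C := by simp [hC, hϖ, ← hR, hR1.trans hη.le]
  have hzpow : ∀ j : ℤ, ϖ ^ j ∈ C ^ j.natAbs := by
    intro j
    rcases Int.natAbs_eq j with h | h
    · have : ϖ ^ j = ϖ ^ j.natAbs := by conv_lhs => rw [h, zpow_natCast]
      rw [this]
      exact Set.pow_mem_pow hϖC
    · have : ϖ ^ j = ϖ⁻¹ ^ j.natAbs := by conv_lhs => rw [h, zpow_neg, zpow_natCast, ← inv_pow]
      rw [this]
      exact Set.pow_mem_pow hϖC'
  refine ⟨C, isCompact_annulus R hR0, 2 + 1 / Real.log R, by positivity, fun x => ?_⟩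
  set l := Real.log ‖(x : F)‖ with hl
  set j := ⌊l / Real.log R⌋ with hj
  have hj1 : j * Real.log R ≤ l := by
    rw [← le_div_iff₀ hlog]
    exact Int.floor_le _
  have hj2 : l ≤ (j + 1) * Real.log R := by
    rw [← div_le_iff₀ hlog]
    exact (Int.lt_floor_add_one _).le
  have hu : x * (ϖ ^ j)⁻¹ ∈ C := by
    have hpos := norm_unit_pos (x * (ϖ ^ j)⁻¹)
    have hn : Real.log ‖((x * (ϖ ^ j)⁻¹ : Fˣ) : F)‖ = l - j * Real.log R := by
      rw [log_norm_mul, Units.val_inv_eq_inv_val, norm_inv, Real.log_inv, Units.val_zpow_eq_zpow_val,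
        norm_zpow, Real.log_zpow, ← sub_eq_add_neg]
      rfl
    constructor
    · rw [← Real.log_le_log_iff (by positivity) hpos, hn, Real.log_inv]
      linarith
    · rw [← Real.log_le_log_iff hpos hR0, hn]
      linarith
  have hxC : x ∈ C ^ (j.natAbs + 1) := by
    have := Set.mul_mem_mul (hzpow j) hu
    rwa [← pow_succ, mul_comm x, mul_inv_cancel_left] at this
  have hth : 1 / ((j.natAbs : ℝ) + 1) ≤ theta C x := by
    refine le_theta ?_ fun k hk => ?_
    · rw [div_le_one (by positivity)]
      linarith [(Nat.cast_nonneg j.natAbs : (0 : ℝ) ≤ j.natAbs)]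
    · have hk' : k < j.natAbs + 1 := by
        by_contra! hcon
        exact hk (Set.pow_subset_pow_right h1C hcon hxC)
      have : (k : ℝ) ≤ j.natAbs := by exact_mod_cast Nat.lt_succ_iff.1 hk'
      gcongr
  have hja : (j.natAbs : ℝ) ≤ |l| / Real.log R + 1 := by
    rw [Nat.cast_natAbs, Int.cast_abs, abs_le]
    constructor
    · have : -|l| ≤ l := neg_abs_le l
      have h3 : -(|l| / Real.log R) ≤ l / Real.log R := by rw [← neg_div]; gcongr
      have h4 := Int.lt_floor_add_one (l / Real.log R)
      linarith
    · have h3 : l / Real.log R ≤ |l| / Real.log R := by gcongr; exact le_abs_self l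
      have h4 := Int.floor_le (l / Real.log R)
      linarith
  have hw : (j.natAbs : ℝ) + 1 ≤ (2 + 1 / Real.log R) * logWeight x := by
    unfold logWeight
    rw [← hl]
    have h0 := abs_nonneg l
    have h5 : |l| / Real.log R = 1 / Real.log R * |l| := by ring
    have h6 : 0 < 1 / Real.log R := by positivity
    nlinarith
  have hw0 := logWeight_pos x
  calc (1 : ℝ) = ((j.natAbs : ℝ) + 1) * (1 / ((j.natAbs : ℝ) + 1)) := by field_simp
    _ ≤ ((2 + 1 / Real.log R) * logWeight x) * theta C x := by
        gcongr
    _ = _ := by ring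

lemma exists_integrable_logWeight (μ : Measure F) [μ.IsAddHaarMeasure] :
    ∃ N : ℕ, ∀ n : ℕ, N ≤ n → Integrable (fun x : Fˣ => ((logWeight x)⁻¹) ^ n) (mulHaar μ) := by
  obtain ⟨C, hC, c, hc, h⟩ := exists_one_le_theta_mul_logWeight F
  obtain ⟨N, hN⟩ := exists_integrable_theta_pow (mulHaar μ) hC
  refine ⟨N, fun n hn => ((hN n hn).const_mul (c ^ n)).mono' ?_ (ae_of_all _ fun x => ?_)⟩
  · exact ((continuous_logWeight.inv₀ fun x => (logWeight_pos x).ne').pow n).aestronglyMeasurable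
  · have h0 := logWeight_pos x
    rw [Real.norm_of_nonneg (by positivity), ← mul_pow]
    gcongr
    rw [inv_le_iff_one_le_mul₀ h0]
    linarith [h x]

lemma exists_modulus_mul_logWeight_le (F : Type*) [NontriviallyNormedField F]
    [LocallyCompactSpace F] [MeasurableSpace F] [BorelSpace F] (n : ℕ) :
    ∃ c : ℝ, 0 ≤ c ∧ ∀ x : Fˣ, ‖(x : F)‖ ≤ 1 → modulus (x : F) * logWeight x ^ n ≤ c := by
  obtain ⟨ϖ, hϖ, hmod⟩ := exists_modulus_ge_two F
  set r := Real.log ‖(ϖ : F)‖ with hr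
  have hr0 : 0 < r := Real.log_pos hϖ
  have hlim := tendsto_pow_const_mul_const_pow_of_abs_lt_one n (r := (1 / 2 : ℝ))
    (by rw [abs_of_pos] <;> norm_num)
  obtain ⟨B, hB⟩ := hlim.bddAbove_range
  have hB' : ∀ k : ℕ, (k : ℝ) ^ n * (1 / 2) ^ k ≤ B := fun k => hB ⟨k, rfl⟩
  have hB0 : 0 ≤ B := le_trans (by positivity) (hB' 0)
  refine ⟨(1 + r) ^ n * (4 * B), by positivity, fun x hx => ?_⟩
  have hl : Real.log ‖(x : F)‖ ≤ 0 := Real.log_nonpos (norm_nonneg _) hx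
  set l := -Real.log ‖(x : F)‖ with hldef
  have hl0 : 0 ≤ l := by linarith
  set k := ⌊l / r⌋₊ with hk
  have hk1 : k * r ≤ l := by
    rw [← le_div_iff₀ hr0]
    exact Nat.floor_le (by positivity)
  have hk2 : l ≤ (k + 1) * r := by
    rw [← div_le_iff₀ hr0]
    exact (Nat.lt_floor_add_one _).le
  have hmx : modulus (x : F) ≤ (1 / 2) ^ k := by
    have h1 : modulus ((ϖ ^ k * x : Fˣ) : F) ≤ modulus ((1 : Fˣ) : F) := by
      refine modulus_le_modulus ?_
      rw [← Real.log_le_log_iff (norm_unit_pos _) (norm_unit_pos _), log_norm_mul,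
        Units.val_pow_eq_pow_val, norm_pow, Real.log_pow, Units.val_one, norm_one, Real.log_one]
      linarith
    have h2 : ∀ k : ℕ, (2 : ℝ) ^ k ≤ modulus ((ϖ ^ k : Fˣ) : F) := by
      intro k
      induction k with
      | zero => rw [pow_zero, pow_zero, modulus_of_unit, map_one]; simp
      | succ k ih =>
        rw [pow_succ, pow_succ, modulus_mul_unit]
        gcongr
        exact (modulus_unit_pos _).le
    rw [modulus_mul_unit, modulus_of_unit 1, map_one, NNReal.coe_one] at h1
    have h3 := modulus_unit_pos x
    have h4 := h2 k
    rw [one_div, inv_pow, le_inv_comm₀ h3 (by positivity), ← one_div, le_div_iff₀ h3]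
    nlinarith
  have hw : logWeight x ≤ (1 + r) * ((k + 2 : ℕ) : ℝ) := by
    unfold logWeight
    rw [abs_of_nonpos hl, ← hldef]
    push_cast
    nlinarith
  have h0 := logWeight_pos x
  calc modulus (x : F) * logWeight x ^ n
      ≤ (1 / 2) ^ k * ((1 + r) * ((k + 2 : ℕ) : ℝ)) ^ n := by gcongr
    _ = (1 + r) ^ n * (4 * (((k + 2 : ℕ) : ℝ) ^ n * (1 / 2) ^ (k + 2))) := by
        rw [mul_pow, pow_add (1 / 2 : ℝ) k 2]; ring
    _ ≤ (1 + r) ^ n * (4 * B) := by gcongr; exact hB' _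

lemma logWeight_onePlus_le {y : Fˣ} (h : 1 / 2 ≤ ‖1 + (y : F)‖) :
    logWeight (onePlus y) ≤ 3 * logWeight y := by
  have hne : 1 + (y : F) ≠ 0 := norm_pos_iff.1 (by linarith)
  have hlog2 : Real.log 2 ≤ 1 := by
    have := Real.log_two_lt_d9
    linarith
  have hlog2' : 0 ≤ Real.log 2 := Real.log_nonneg one_le_two
  have h0 := abs_nonneg (Real.log ‖(y : F)‖)
  unfold logWeight
  rw [val_onePlus hne]
  have hub : Real.log ‖1 + (y : F)‖ ≤ Real.log 2 + |Real.log ‖(y : F)‖| := by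
    have h1 : ‖1 + (y : F)‖ ≤ 1 + ‖(y : F)‖ := (norm_add_le _ _).trans (by simp)
    rcases le_total ‖(y : F)‖ 1 with h2 | h2
    · have : Real.log ‖1 + (y : F)‖ ≤ Real.log 2 :=
        Real.log_le_log (by linarith) (by linarith)
      linarith
    · have : Real.log ‖1 + (y : F)‖ ≤ Real.log (2 * ‖(y : F)‖) :=
        Real.log_le_log (by linarith) (by linarith)
      rw [Real.log_mul two_ne_zero (by linarith)] at this
      linarith [le_abs_self (Real.log ‖(y : F)‖)]
  have hlb : -Real.log 2 ≤ Real.log ‖1 + (y : F)‖ := by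
    rw [← Real.log_inv]
    exact Real.log_le_log (by norm_num) (by simpa using h)
  have : |Real.log ‖1 + (y : F)‖| ≤ Real.log 2 + |Real.log ‖(y : F)‖| :=
    abs_le.2 ⟨by linarith, hub⟩
  linarith

lemma integrable_logWeight_onePlus_near (μ : Measure F) [μ.IsAddHaarMeasure] (n : ℕ) :
    ∫⁻ y : Fˣ, (onePlus ⁻¹' {u : Fˣ | ‖(u : F)‖ ≤ 1 / 2} ∩ {y : Fˣ | 1 + (y : F) ≠ 0}).indicator
      (fun y => ENNReal.ofReal (logWeight (onePlus y) ^ n)) y ∂(mulHaar μ) < ⊤ := by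
  obtain ⟨N, hN⟩ := exists_integrable_logWeight μ
  obtain ⟨c, hc, hcb⟩ := exists_modulus_mul_logWeight_le F (n + N)
  obtain ⟨η, hη0, hη⟩ := NormedField.exists_norm_lt F (r := 1 / 2) (by norm_num)
  set y₀ : Fˣ := Units.mk0 η (norm_pos_iff.1 hη0) with hy₀
  set A : Set Fˣ := {u : Fˣ | ‖(u : F)‖ ≤ 1 / 2} with hA
  have hAm : MeasurableSet A :=
    (isClosed_le Units.continuous_val.norm continuous_const).measurableSet
  set g : Fˣ → ENNReal := A.indicator fun u => ENNReal.ofReal (logWeight u ^ n) with hg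
  have hgm : Measurable g :=
    ((continuous_logWeight.pow n).measurable.ennreal_ofReal).indicator hAm
  set κ : Measure Fˣ := μ.comap Units.val
  set w : Fˣ → ENNReal := fun x => ENNReal.ofReal (modulus (x : F))⁻¹
  set S : Set Fˣ := onePlus ⁻¹' A ∩ {y : Fˣ | 1 + (y : F) ≠ 0}
  have hSm : MeasurableSet S := (measurable_onePlus hAm).inter
    (isOpen_ne_fun (by fun_prop) continuous_const).measurableSet
  have hfm : Measurable (S.indicator
      fun y => ENNReal.ofReal (logWeight (onePlus y) ^ n)) :=
    (((continuous_logWeight.pow n).measurable.comp measurable_onePlus).ennreal_ofReal).indicator hSm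
  have hpt : ∀ y : Fˣ, w y * S.indicator
      (fun y => ENNReal.ofReal (logWeight (onePlus y) ^ n)) y ≤
      w y₀ * g (onePlus y) := by
    intro y
    by_cases hy : y ∈ S
    · rw [Set.indicator_of_mem hy, hg, Set.indicator_of_mem (show onePlus y ∈ A from hy.1)]
      refine mul_le_mul_left ?_ _
      refine ENNReal.ofReal_le_ofReal (inv_anti₀ (modulus_unit_pos y₀) (modulus_le_modulus ?_))
      have h1 : ‖(onePlus y : F)‖ ≤ 1 / 2 := hy.1
      rw [val_onePlus hy.2] at h1
      have h2 : ‖(1 : F)‖ ≤ ‖1 + (y : F)‖ + ‖(y : F)‖ := by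
        have := norm_sub_le (1 + (y : F)) (y : F)
        simpa using this
      rw [norm_one] at h2
      simp only [hy₀, Units.val_mk0]
      linarith
    · rw [Set.indicator_of_notMem hy, mul_zero]
      exact zero_le
  have hpt2 : ∀ u : Fˣ, g u ≤ ENNReal.ofReal c * (w u * ENNReal.ofReal ((logWeight u)⁻¹ ^ N)) := by
    intro u
    by_cases hu : u ∈ A
    · rw [hg, Set.indicator_of_mem hu, ← ENNReal.ofReal_mul (by
          have := modulus_unit_pos u; positivity), ← ENNReal.ofReal_mul hc]
      refine ENNReal.ofReal_le_ofReal ?_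
      have h1 := hcb u (le_trans hu (by norm_num))
      have h2 := modulus_unit_pos u
      have h3 := logWeight_pos u
      rw [inv_pow, ← mul_inv, ← div_eq_mul_inv, le_div_iff₀ (by positivity)]
      calc _ = modulus (u : F) * logWeight u ^ (n + N) := by ring
        _ ≤ c := h1
    · rw [hg, Set.indicator_of_notMem hu]
      exact zero_le
  have hint : ∫⁻ u, w u * ENNReal.ofReal ((logWeight u)⁻¹ ^ N) ∂κ < ⊤ := by
    have h1 := (hN N le_rfl).2
    rw [hasFiniteIntegral_iff_norm, mulHaar, lintegral_withDensity_eq_lintegral_mul₀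
      measurable_density.aemeasurable] at h1
    · refine lt_of_le_of_lt (lintegral_mono fun u => ?_) h1
      have h3 := logWeight_pos u
      simp only [Pi.mul_apply]
      rw [Real.norm_of_nonneg (by positivity)]
    · exact (((continuous_logWeight.inv₀ fun x => (logWeight_pos x).ne').pow
        N).norm.measurable.ennreal_ofReal).aemeasurable
  rw [mulHaar, lintegral_withDensity_eq_lintegral_mul₀ measurable_density.aemeasurable
    hfm.aemeasurable]
  calc _ ≤ ∫⁻ y, w y₀ * g (onePlus y) ∂κ := lintegral_mono hpt
    _ = w y₀ * ∫⁻ u, g u ∂κ := by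
        rw [lintegral_const_mul _ (show Measurable fun y => g (onePlus y) from
          hgm.comp measurable_onePlus),
          (measurePreserving_onePlus μ).lintegral_comp hgm]
    _ ≤ w y₀ * ∫⁻ u, ENNReal.ofReal c * (w u * ENNReal.ofReal ((logWeight u)⁻¹ ^ N)) ∂κ := by
        gcongr
        exact hpt2 _
    _ < ⊤ := by
        rw [lintegral_const_mul' _ _ ENNReal.ofReal_ne_top]
        exact ENNReal.mul_lt_top ENNReal.ofReal_lt_top
          (ENNReal.mul_lt_top ENNReal.ofReal_lt_top hint)

lemma measurable_logWeight_onePlus : Measurable fun y : Fˣ => logWeight (onePlus y) :=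
  continuous_logWeight.measurable.comp measurable_onePlus

/-- Integrability of the logarithmic singularity at `y = -1`. -/
lemma exists_integrable_logWeight_onePlus (μ : Measure F) [μ.IsAddHaarMeasure] (n : ℕ) :
    ∃ m : ℕ, Integrable (fun y : Fˣ => logWeight (onePlus y) ^ n * ((logWeight y)⁻¹) ^ m)
      (mulHaar μ) := by
  obtain ⟨N, hN⟩ := exists_integrable_logWeight μ
  refine ⟨n + N, ?_⟩
  have hm : Measurable fun y : Fˣ => logWeight (onePlus y) ^ n * ((logWeight y)⁻¹) ^ (n + N) :=
    (measurable_logWeight_onePlus.pow_const n).mul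
      (continuous_logWeight.measurable.inv.pow_const _)
  have hnear := integrable_logWeight_onePlus_near μ n
  set S : Set Fˣ := onePlus ⁻¹' {u : Fˣ | ‖(u : F)‖ ≤ 1 / 2} ∩ {y : Fˣ | 1 + (y : F) ≠ 0}
  refine ⟨hm.aestronglyMeasurable, ?_⟩
  rw [hasFiniteIntegral_iff_norm]
  have hpt : ∀ᵐ y ∂(mulHaar μ), ENNReal.ofReal ‖logWeight (onePlus y) ^ n *
      ((logWeight y)⁻¹) ^ (n + N)‖ ≤
      ENNReal.ofReal (3 ^ n * (logWeight y)⁻¹ ^ N) +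
        S.indicator (fun y => ENNReal.ofReal (logWeight (onePlus y) ^ n)) y := by
    filter_upwards [ae_val_ne μ (-1)] with y hy
    have hne : 1 + (y : F) ≠ 0 := fun h => hy (eq_neg_of_add_eq_zero_right h)
    have h0 := logWeight_pos y
    have h1 := logWeight_pos (onePlus y)
    rw [Real.norm_of_nonneg (by positivity)]
    by_cases hS : y ∈ S
    · rw [Set.indicator_of_mem hS]
      refine le_trans (ENNReal.ofReal_le_ofReal ?_) le_add_self
      exact mul_le_of_le_one_right (by positivity)
        (pow_le_one₀ (by positivity) (inv_le_one_of_one_le₀ (one_le_logWeight y)))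
    · rw [Set.indicator_of_notMem hS, add_zero]
      refine ENNReal.ofReal_le_ofReal ?_
      have h2 : 1 / 2 ≤ ‖1 + (y : F)‖ := by
        by_contra! hcon
        exact hS ⟨by simpa [val_onePlus hne] using hcon.le, hne⟩
      calc logWeight (onePlus y) ^ n * ((logWeight y)⁻¹) ^ (n + N)
          ≤ (3 * logWeight y) ^ n * ((logWeight y)⁻¹) ^ (n + N) := by
            gcongr; exact logWeight_onePlus_le h2
        _ = 3 ^ n * (logWeight y)⁻¹ ^ N * (logWeight y * (logWeight y)⁻¹) ^ n := by ring
        _ = _ := by rw [mul_inv_cancel₀ h0.ne', one_pow, mul_one]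
  refine (lintegral_mono_ae hpt).trans_lt ?_
  rw [lintegral_add_left]
  · refine ENNReal.add_lt_top.2 ⟨?_, hnear⟩
    have h1 := ((hN N le_rfl).const_mul ((3 : ℝ) ^ n)).2
    rw [hasFiniteIntegral_iff_norm] at h1
    refine lt_of_le_of_lt (lintegral_mono fun u => ?_) h1
    exact ENNReal.ofReal_le_ofReal (le_abs_self _)
  · exact (((continuous_logWeight.inv₀ fun x => (logWeight_pos x).ne').pow
        N).measurable.const_mul _).ennreal_ofReal

end LogWeight

instance sigmaFinite_of_isLCA {G : Type*} [CommGroup G] [TopologicalSpace G] [MeasurableSpace G]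
    [IsLCA G] (μ : Measure G) [μ.IsHaarMeasure] : SigmaFinite μ := inferInstance

instance isHaarMeasure_prod {G H : Type*} [CommGroup G] [TopologicalSpace G] [MeasurableSpace G]
    [IsLCA G] [CommGroup H] [TopologicalSpace H] [MeasurableSpace H] [IsLCA H] (μ : Measure G)
    [μ.IsHaarMeasure] (ν : Measure H) [ν.IsHaarMeasure] : (μ.prod ν).IsHaarMeasure :=
  Measure.prod.instIsHaarMeasure μ ν

section PentagonTest

variable {A : Type*} [CommGroup A] [TopologicalSpace A] [MeasurableSpace A] [IsLCA A]
  {κ : A → A → Circle} {m : Measure A} [m.IsHaarMeasure]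

lemma IsSchwartzBruhat.mul_kernel (hκ : IsPairing κ) (hsymm : ∀ a b, κ a b = κ b a)
    (hI : InversionHolds κ m m) {f : A × A → ℂ}
    (hf : IsSchwartzBruhat (prodPairing κ κ) (m.prod m) f) :
    IsSchwartzBruhat (prodPairing κ κ) (m.prod m) fun p => f p * κ p.1 p.2 := by
  refine hf.mul_gaussian (q := fun p => κ p.1 p.2) (hκ.prod hκ) (hI.prod hI hκ hκ) hκ.continuous
    (MulEquiv.prodComm : A × A ≃* A × A).toMonoidHom continuous_swap fun x y => ?_
  simp only [Prod.fst_mul, Prod.snd_mul, hκ.map_mul_left, hκ.map_mul_right, prodPairing,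
    MulEquiv.toMonoidHom_eq_coe, MonoidHom.coe_coe, MulEquiv.coe_prodComm, Prod.fst_swap,
    Prod.snd_swap, hsymm x.2 y.1]
  ac_rfl

/-- The coordinates `((u * z, w * z), z)` on triples `(u, w, z)`. -/
def shearEquiv (A : Type*) [CommGroup A] [TopologicalSpace A] [IsTopologicalGroup A] :
    A × A × A ≃ₜ* (A × A) × A where
  toFun p := ((p.1 * p.2.2, p.2.1 * p.2.2), p.2.2)
  invFun p := (p.1.1 / p.2, p.1.2 / p.2, p.2)
  left_inv p := by simp
  right_inv p := by simp
  map_mul' p p' := by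
    simp only [Prod.fst_mul, Prod.snd_mul, Prod.mk_mul_mk, mul_mul_mul_comm]
  continuous_toFun := by fun_prop
  continuous_invFun := by fun_prop

/-- The adjoint coordinates of `shearEquiv`. -/
def shearDualEquiv (A : Type*) [CommGroup A] [TopologicalSpace A] [IsTopologicalGroup A] :
    A × A × A ≃ₜ* (A × A) × A where
  toFun p := ((p.1, p.2.1), p.2.2 / (p.1 * p.2.1))
  invFun p := (p.1.1, p.1.2, p.2 * (p.1.1 * p.1.2))
  left_inv p := by simp
  right_inv p := by simp
  map_mul' p p' := by
    simp only [Prod.fst_mul, Prod.snd_mul, Prod.mk_mul_mk, ← mul_div_mul_comm]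
    rw [mul_mul_mul_comm p.1]
  continuous_toFun := by fun_prop
  continuous_invFun := by fun_prop

lemma IsSchwartzBruhat.pentagonTestRight (hκ : IsPairing κ)
    (hI : InversionHolds κ m m) {f : A × A → ℂ}
    (hf : IsSchwartzBruhat (prodPairing κ κ) (m.prod m) f) {χ : A → ℂ}
    (hχ : IsSchwartzBruhat κ m χ) {q : A → Circle} (hq : Continuous q)
    (hqκ : ∀ a b, q (a * b) = q a * q b * κ a b) :
    IsSchwartzBruhat (prodPairing κ (prodPairing κ κ)) (m.prod (m.prod m))
      (pentagonTestRight q f χ) := by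
  have h1 := hf.tensor (hχ.mul_gaussian hκ hI hq (MonoidHom.id A) continuous_id hqκ)
  have h2 := h1.comp_equiv (μ₁ := m.prod (m.prod m)) (e₁ := prodPairing κ (prodPairing κ κ))
    (shearEquiv A) (shearDualEquiv A) fun h x => by
      simp only [prodPairing, shearEquiv, shearDualEquiv, ContinuousMulEquiv.coe_mk,
        MulEquiv.coe_mk, Equiv.coe_fn_mk, hκ.map_mul_right, hκ.map_mul_left, hκ.map_div_left]
      generalize κ h.1 x.1 = a
      generalize κ h.1 x.2.2 = b
      generalize κ h.2.1 x.2.1 = c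
      generalize κ h.2.1 x.2.2 = d
      generalize κ h.2.2 x.2.2 = k
      rw [mul_mul_mul_comm, mul_assoc (a * c), mul_div_cancel, mul_assoc]
  convert h2 using 2 with p
  simp only [QDilog.pentagonTestRight, shearEquiv, mul_assoc]
  rfl

end PentagonTest

section Interchange

/-- The middle four interchange of a product of four groups. -/
def interchange (H₁ H₂ G₁ G₂ : Type*) [CommGroup H₁] [TopologicalSpace H₁] [CommGroup H₂]
    [TopologicalSpace H₂] [CommGroup G₁] [TopologicalSpace G₁] [CommGroup G₂]
    [TopologicalSpace G₂] : (H₁ × H₂) × (G₁ × G₂) ≃ₜ* (H₁ × G₁) × (H₂ × G₂) :=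
  { MulEquiv.prodProdProdComm H₁ H₂ G₁ G₂ with
    continuous_toFun := (Homeomorph.prodProdProdComm H₁ H₂ G₁ G₂).continuous
    continuous_invFun := (Homeomorph.prodProdProdComm H₁ H₂ G₁ G₂).symm.continuous }

lemma measurePreserving_interchange {H₁ H₂ G₁ G₂ : Type*} [MeasurableSpace H₁]
    [MeasurableSpace H₂] [MeasurableSpace G₁] [MeasurableSpace G₂] (ν₁ : Measure H₁)
    (ν₂ : Measure H₂) (μ₁ : Measure G₁) (μ₂ : Measure G₂) [SFinite ν₁] [SFinite ν₂] [SFinite μ₁]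
    [SFinite μ₂] :
    MeasurePreserving (fun s : (H₁ × H₂) × (G₁ × G₂) => ((s.1.1, s.2.1), (s.1.2, s.2.2)))
      ((ν₁.prod ν₂).prod (μ₁.prod μ₂)) ((ν₁.prod μ₁).prod (ν₂.prod μ₂)) := by
  have h1 := measurePreserving_prodAssoc ν₁ ν₂ (μ₁.prod μ₂)
  have h2 := (MeasurePreserving.id ν₁).prod (measurePreserving_prodAssoc ν₂ μ₁ μ₂).symm
  have h3 := (MeasurePreserving.id ν₁).prod
    ((Measure.measurePreserving_swap (μ := ν₂) (ν := μ₁)).prod (MeasurePreserving.id μ₂))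
  have h4 := (MeasurePreserving.id ν₁).prod (measurePreserving_prodAssoc μ₁ ν₂ μ₂)
  have h5 := (measurePreserving_prodAssoc ν₁ μ₁ (ν₂.prod μ₂)).symm
  exact h5.comp (h4.comp (h3.comp (h2.comp h1)))

/-- The rearrangement of a triple of points and a triple of dual points into a triple of pairs. -/
def tripleInterchange (H G : Type*) [CommGroup H] [TopologicalSpace H] [CommGroup G]
    [TopologicalSpace G] :
    ((H × H) × H) × ((G × G) × G) ≃ₜ* (H × G) × (H × G) × (H × G) where
  toFun s := ((s.1.1.1, s.2.1.1), (s.1.1.2, s.2.1.2), (s.1.2, s.2.2))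
  invFun t := (((t.1.1, t.2.1.1), t.2.2.1), ((t.1.2, t.2.1.2), t.2.2.2))
  left_inv _ := rfl
  right_inv _ := rfl
  map_mul' _ _ := rfl
  continuous_toFun := by fun_prop
  continuous_invFun := by fun_prop

lemma measurePreserving_tripleInterchange {H G : Type*} [MeasurableSpace H]
    [MeasurableSpace G] (ν : Measure H) (μ : Measure G) [SFinite ν] [SFinite μ] :
    MeasurePreserving (fun s : ((H × H) × H) × ((G × G) × G) =>
        ((s.1.1.1, s.2.1.1), (s.1.1.2, s.2.1.2), (s.1.2, s.2.2)))
      (((ν.prod ν).prod ν).prod ((μ.prod μ).prod μ))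
      ((ν.prod μ).prod ((ν.prod μ).prod (ν.prod μ))) :=
  (measurePreserving_prodAssoc _ _ _).comp
    (((measurePreserving_interchange ν ν μ μ).prod (MeasurePreserving.id _)).comp
      (measurePreserving_interchange (ν.prod ν) ν (μ.prod μ) μ))

end Interchange

section Evaluation

variable {A : Type*} [CommGroup A] [TopologicalSpace A] [MeasurableSpace A] [IsLCA A]
  {G : Type*} [CommGroup G] [TopologicalSpace G] [MeasurableSpace G] [IsLCA G]
  {H : Type*} [CommGroup H] [TopologicalSpace H] [MeasurableSpace H] [IsLCA H]
  {κ : A → A → Circle} {m : Measure A} [m.IsHaarMeasure]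
  {e : H → G → Circle} {μ : Measure G} [μ.IsHaarMeasure] {ν : Measure H} [ν.IsHaarMeasure]

lemma IsSchwartzBruhat.comp_rearrangement {f : A → ℂ} (hf : IsSchwartzBruhat κ m f)
    (T : H × G ≃ₜ* A) (hT : ∀ s t, swapPairing e s t = κ (T s) (T t)) :
    IsSchwartzBruhat (swapPairing e) (ν.prod μ) fun s => f (T s) :=
  hf.comp_equiv T T hT

lemma integral_mul_invFourier_rearrangement (he : IsPairing e) (hI : InversionHolds e μ ν)
    (T : H × G ≃ₜ* A) (hT : ∀ s t, swapPairing e s t = κ (T s) (T t))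
    (hTm : MeasurePreserving T (ν.prod μ) m) {f : A → ℂ} (hf : IsSchwartzBruhat κ m f)
    {φ : A → ℂ} {σ : G → G} (hφ : ∀ᵐ x ∂μ, ∀ α, φ (T (α, x)) = e α (σ x))
    (hm : Integrable (fun a => φ a * invFourier κ m f a) m) :
    ∫ a, φ a * invFourier κ m f a ∂m =
      ∫ x, partialFourier e ν (fun s => f (T s)) (σ x) x ∂μ := by
  have hTe : MeasurableEmbedding T := T.toHomeomorph.measurableEmbedding
  have hF : ∀ s, invFourier κ m f (T s) =
      invFourier (swapPairing e) (ν.prod μ) (fun s => f (T s)) s := fun s => by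
    rw [invFourier_comp_equiv T T hT (c := 1) (by rw [hTm.map_eq, one_smul])]
    simp
  rw [← hTm.integral_comp hTe]
  simp only [hF]
  refine integral_mul_invFourier hI (hf.comp_rearrangement T hT) he hφ ?_
  have := (hTm.integrable_comp_emb hTe).2 hm
  simpa only [Function.comp_def, hF] using this

end Evaluation

section PartialFourier

variable {G : Type*} [CommGroup G] [TopologicalSpace G] [MeasurableSpace G] [IsLCA G]
  {H : Type*} [CommGroup H] [TopologicalSpace H] [MeasurableSpace H] [IsLCA H]
  {e : H → G → Circle} {μ : Measure G} [μ.IsHaarMeasure] {ν : Measure H} [ν.IsHaarMeasure]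

/-- The partial Fourier transform in both dual variables of a function on `(H × G) × (H × G)`. -/
def partialFourierTwo (e : H → G → Circle) (ν : Measure H) (f : (H × G) × (H × G) → ℂ)
    (p u : G × G) : ℂ :=
  partialFourier (prodPairing e e) (ν.prod ν) (fun s => f (interchange H H G G s)) p u

lemma partialFourierTwo_mul_kernel (he : IsPairing e) (f : (H × G) × (H × G) → ℂ) (p u : G × G) :
    partialFourierTwo e ν (fun s => f s * swapPairing e s.1 s.2) p u =
      partialFourierTwo e ν f p (u.1 / p.2, u.2 / p.1) := by
  unfold partialFourierTwo partialFourier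
  refine integral_congr_ae (ae_of_all _ fun π => ?_)
  have h : swapPairing e (interchange H H G G (π, p)).1 (interchange H H G G (π, p)).2 *
      (prodPairing e e π u)⁻¹ = (prodPairing e e π (u.1 / p.2, u.2 / p.1))⁻¹ := by
    change e π.1 p.2 * e π.2 p.1 * (e π.1 u.1 * e π.2 u.2)⁻¹ =
      (e π.1 (u.1 / p.2) * e π.2 (u.2 / p.1))⁻¹
    rw [he.map_div_right, he.map_div_right, ← mul_div_mul_comm, inv_div, div_eq_mul_inv]
  change f (interchange H H G G (π, p)) * (swapPairing e (interchange H H G G (π, p)).1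
      (interchange H H G G (π, p)).2 : ℂ) * (((prodPairing e e π u)⁻¹ : Circle) : ℂ) =
    f (interchange H H G G (π, p)) * (((prodPairing e e π (u.1 / p.2, u.2 / p.1))⁻¹ : Circle) : ℂ)
  rw [← h, mul_assoc, Circle.coe_mul]

lemma partialFourier_pentagonTestRight (he : IsPairing e) {f : (H × G) × (H × G) → ℂ}
    {χ : H × G → ℂ}
    (hf : IsSchwartzBruhat (prodPairing (swapPairing e) (prodPairing (swapPairing e)
      (swapPairing e))) ((ν.prod μ).prod ((ν.prod μ).prod (ν.prod μ)))
      (pentagonTestRight (fun a => e a.1 a.2) f χ)) (p u : G × G) (s t : G) :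
    partialFourier (prodPairing (prodPairing e e) e) ((ν.prod ν).prod ν)
      (fun s => pentagonTestRight (fun a => e a.1 a.2) f χ (tripleInterchange H G s))
      (p, s) (u, t) =
      partialFourierTwo e ν f (p.1 * s, p.2 * s) u * ∫ c, χ (c, s) * e c (s * u.1 * u.2 / t) ∂ν := by
  have hT := (hf.rapid.comp_equiv (tripleInterchange H G)).fst (p, s)
  have hTc := (hf.continuous.comp (tripleInterchange H G).continuous).comp
    (by fun_prop : Continuous fun h : (H × H) × H => (h, (p, s)))
  have hi : Integrable (fun h : (H × H) × H =>
      pentagonTestRight (fun a => e a.1 a.2) f χ (tripleInterchange H G (h, (p, s))))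
      ((ν.prod ν).prod ν) := hT.integrable hTc.aestronglyMeasurable
  unfold partialFourier
  rw [integral_prod_symm _ (integrable_mul_circle hi
    (c := fun h => (prodPairing (prodPairing e e) e h (u, t))⁻¹) ?_)]
  swap
  · exact (((he.prod he).prod he).flip.measurable_coe_inv (u, t) _)
  rw [← integral_const_mul]
  refine integral_congr_ae (ae_of_all _ fun c => ?_)
  unfold partialFourierTwo partialFourier
  simp only
  rw [← integral_mul_const]
  conv_rhs => rw [← integral_mul_right_eq_self _ ((c, c) : H × H)]
  refine integral_congr_ae (ae_of_all _ fun h => ?_)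
  have h1 : (e c s : Circle) * (e h.1 u.1 * e h.2 u.2 * e c t)⁻¹ =
      (e (h.1 * c) u.1 * e (h.2 * c) u.2)⁻¹ * e c (s * u.1 * u.2 / t) := by
    simp only [he.map_mul_left, he.map_mul_right, he.map_div_right]
    rw [mul_mul_mul_comm, mul_assoc (e c s), mul_inv, mul_inv (e h.1 u.1 * e h.2 u.2),
      div_eq_mul_inv]
    generalize (e h.1 u.1 * e h.2 u.2)⁻¹ = a
    generalize e c u.1 * e c u.2 = b
    rw [mul_assoc a, ← mul_assoc b⁻¹, ← mul_assoc b⁻¹, mul_comm b⁻¹, inv_mul_cancel_right,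
      mul_left_comm]
  change f ((h.1 * c, p.1 * s), (h.2 * c, p.2 * s)) * χ (c, s) * (e c s : ℂ) *
      (((e h.1 u.1 * e h.2 u.2 * e c t)⁻¹ : Circle) : ℂ) =
    f ((h.1 * c, p.1 * s), (h.2 * c, p.2 * s)) *
      (((e (h.1 * c) u.1 * e (h.2 * c) u.2)⁻¹ : Circle) : ℂ) *
        (χ (c, s) * (e c (s * u.1 * u.2 / t) : ℂ))
  have h2 := congrArg (fun z : Circle => (z : ℂ)) h1
  simp only [Circle.coe_mul] at h2
  rw [mul_assoc (f _ * _), h2]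
  ring

end PartialFourier

section MeasurePreserving

lemma measurePreserving_shear {α G : Type*} [MeasurableSpace α] [Group G] [MeasurableSpace G]
    [MeasurableMul₂ G] (ma : Measure α) [SFinite ma] (m : Measure G) [SFinite m]
    [m.IsMulLeftInvariant] {h : α → G} (hh : Measurable h) :
    MeasurePreserving (fun p : α × G => (p.1, h p.1 * p.2)) (ma.prod m) (ma.prod m) :=
  (MeasurePreserving.id ma).skew_product (g := fun a x => h a * x)
    ((hh.comp measurable_fst).mul measurable_snd)
    (ae_of_all _ fun a => map_mul_left_eq_self m (h a))

lemma integral_comp_measurePreserving {α β E : Type*} [MeasurableSpace α] [MeasurableSpace β]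
    [NormedAddCommGroup E] [NormedSpace ℝ E] {ma : Measure α} {mb : Measure β} {T : α → β}
    (hT : MeasurePreserving T ma mb) {f : β → E} (hf : AEStronglyMeasurable f mb) :
    ∫ a, f (T a) ∂ma = ∫ b, f b ∂mb := by
  rw [← hT.map_eq] at hf ⊢
  exact (integral_map hT.measurable.aemeasurable hf).symm

end MeasurePreserving

section Substitution

variable {F : Type*} [NontriviallyNormedField F] [LocallyCompactSpace F]
  [MeasurableSpace F] [BorelSpace F]

lemma Rapid.logWeight_bound_prod {N : (Fˣ × Fˣ) × (Fˣ × Fˣ) → ℂ} (hN : Rapid N) (n k : ℕ) :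
    ∃ M : ℝ, 0 ≤ M ∧ ∀ p r u w, ‖N ((p, r), (u, w))‖ ≤
      M * ((logWeight r)⁻¹ ^ n * (logWeight u)⁻¹ ^ n * (logWeight w)⁻¹ ^ k) := by
  obtain ⟨C₁, C₂, hC₁, hC₂, h⟩ := hN.prod_bound
  obtain ⟨c₁, hc₁, h₁⟩ := exists_theta_mul_logWeight_le (hC₁.image continuous_snd)
  obtain ⟨c₂, hc₂, h₂⟩ := exists_theta_mul_logWeight_le (hC₂.image continuous_fst)
  obtain ⟨c₃, hc₃, h₃⟩ := exists_theta_mul_logWeight_le (hC₂.image continuous_snd)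
  obtain ⟨M, hM, h⟩ := h (n + k)
  refine ⟨M * (c₁ ^ n * (c₂ ^ n * c₃ ^ k)), by positivity, fun p r u w => (h _ _).trans ?_⟩
  have hle : ∀ {C : Set Fˣ} {c : ℝ}, (∀ x, theta C x * logWeight x ≤ c) → ∀ x,
      theta C x ≤ c * (logWeight x)⁻¹ := fun h x => by
    rw [← div_eq_mul_inv, le_div_iff₀ (logWeight_pos x)]
    exact h x
  have t1 := theta_nonneg C₁ (p, r)
  have t2 := theta_nonneg C₂ (u, w)
  have b1 : theta C₁ (p, r) ^ (n + k) ≤ (c₁ * (logWeight r)⁻¹) ^ n :=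
    (pow_le_pow_of_le_one t1 (theta_le_one _ _) (Nat.le_add_right n k)).trans
      (pow_le_pow_left₀ t1 ((theta_snd_le _ _ _).trans (hle h₁ r)) n)
  have b2 : theta C₂ (u, w) ^ n ≤ (c₂ * (logWeight u)⁻¹) ^ n :=
    pow_le_pow_left₀ t2 ((theta_fst_le _ _ _).trans (hle h₂ u)) n
  have b3 : theta C₂ (u, w) ^ k ≤ (c₃ * (logWeight w)⁻¹) ^ k :=
    pow_le_pow_left₀ t2 ((theta_snd_le _ _ _).trans (hle h₃ w)) k
  have l1 := logWeight_pos r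
  have l2 := logWeight_pos u
  rw [pow_add (theta C₂ _)]
  calc M * (theta C₁ (p, r) ^ (n + k) * (theta C₂ (u, w) ^ n * theta C₂ (u, w) ^ k))
      ≤ M * ((c₁ * (logWeight r)⁻¹) ^ n *
        ((c₂ * (logWeight u)⁻¹) ^ n * (c₃ * (logWeight w)⁻¹) ^ k)) := by gcongr
    _ = _ := by rw [mul_pow, mul_pow, mul_pow]; ring

/-- The point `x` in the substitution `z = v y`, `x = t v / (1 + v y)`. -/
def substPoint (w : (Fˣ × Fˣ) × Fˣ) : Fˣ := w.1.2 / onePlus (w.1.2 * w.1.1) * w.2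

lemma measurable_substPoint : Measurable (substPoint : (Fˣ × Fˣ) × Fˣ → Fˣ) := by
  have h : Measurable fun w : (Fˣ × Fˣ) × Fˣ => onePlus (w.1.2 * w.1.1) :=
    measurable_onePlus.comp (by fun_prop)
  unfold substPoint
  fun_prop

/-- The integrand of the right-hand side of the pentagon identity after the substitution. -/
def pentagonKernel (N : Fˣ × Fˣ → Fˣ × Fˣ → ℂ) (w : (Fˣ × Fˣ) × Fˣ) : ℂ :=
  N (onePlus (substPoint w) * onePlus (w.1.2 * w.1.1), onePlus w.1.1 * onePlus (w.1.2 * w.1.1))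
    (substPoint w, w.1.1)

lemma measurable_pentagonKernel {N : Fˣ × Fˣ → Fˣ × Fˣ → ℂ}
    (hN : Continuous fun z : (Fˣ × Fˣ) × (Fˣ × Fˣ) => N z.1 z.2) :
    Measurable (pentagonKernel N) := by
  have h : Measurable fun w : (Fˣ × Fˣ) × Fˣ => onePlus (w.1.2 * w.1.1) :=
    measurable_onePlus.comp (by fun_prop)
  have h1 := measurable_substPoint (F := F)
  have h2 : Measurable fun w : (Fˣ × Fˣ) × Fˣ => onePlus (substPoint w) :=
    measurable_onePlus.comp h1
  have h3 : Measurable fun w : (Fˣ × Fˣ) × Fˣ => onePlus w.1.1 :=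
    measurable_onePlus.comp (by fun_prop)
  exact hN.measurable.comp (by fun_prop : Measurable fun w : (Fˣ × Fˣ) × Fˣ =>
    ((onePlus (substPoint w) * onePlus (w.1.2 * w.1.1),
      onePlus w.1.1 * onePlus (w.1.2 * w.1.1)), (substPoint w, w.1.1)))

variable (μ : Measure F) [μ.IsAddHaarMeasure]

lemma measurePreserving_subst :
    MeasurePreserving (fun w : (Fˣ × Fˣ) × Fˣ => ((substPoint w, w.1.1), w.1.1 * w.1.2))
      (((mulHaar μ).prod (mulHaar μ)).prod (mulHaar μ))
      (((mulHaar μ).prod (mulHaar μ)).prod (mulHaar μ)) := by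
  have h1 := measurePreserving_shear ((mulHaar μ).prod (mulHaar μ)) (mulHaar μ)
    (h := fun w => w.2 / onePlus (w.2 * w.1))
    (measurable_snd.div (measurable_onePlus.comp (by fun_prop)))
  have h2 := (measurePreserving_shear (mulHaar μ) (mulHaar μ) measurable_id).prod
    (MeasurePreserving.id (mulHaar μ))
  have h3 := Measure.measurePreserving_swap (μ := (mulHaar μ).prod (mulHaar μ)) (ν := mulHaar μ)
  have h4 := (measurePreserving_prodAssoc (mulHaar μ) (mulHaar μ) (mulHaar μ)).symm
  exact h4.comp (h3.comp (h2.comp h1))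

lemma integral_subst {N : Fˣ × Fˣ → Fˣ × Fˣ → ℂ}
    (hN : Continuous fun z : (Fˣ × Fˣ) × (Fˣ × Fˣ) => N z.1 z.2) {R : Fˣ → Fˣ → ℂ}
    (hR : Continuous fun z : Fˣ × Fˣ => R z.1 z.2) :
    ∫ z, N (onePlus z.1.1 * onePlus z.2, onePlus z.1.2 * onePlus z.2) z.1 *
        R (onePlus z.2) (onePlus z.2 * z.1.1 * z.1.2 / z.2)
          ∂((mulHaar μ).prod (mulHaar μ)).prod (mulHaar μ) =
      ∫ w, pentagonKernel N w * R (onePlus (w.1.2 * w.1.1)) w.2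
        ∂((mulHaar μ).prod (mulHaar μ)).prod (mulHaar μ) := by
  have h1 : Measurable fun z : (Fˣ × Fˣ) × Fˣ => onePlus z.1.1 :=
    measurable_onePlus.comp (by fun_prop)
  have h2 : Measurable fun z : (Fˣ × Fˣ) × Fˣ => onePlus z.1.2 :=
    measurable_onePlus.comp (by fun_prop)
  have h3 : Measurable fun z : (Fˣ × Fˣ) × Fˣ => onePlus z.2 :=
    measurable_onePlus.comp (by fun_prop)
  have hm := (hN.measurable.comp (by fun_prop : Measurable fun z : (Fˣ × Fˣ) × Fˣ =>
    ((onePlus z.1.1 * onePlus z.2, onePlus z.1.2 * onePlus z.2), z.1))).mul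
    (hR.measurable.comp (by fun_prop : Measurable fun z : (Fˣ × Fˣ) × Fˣ =>
      (onePlus z.2, onePlus z.2 * z.1.1 * z.1.2 / z.2)))
  refine (integral_comp_measurePreserving (measurePreserving_subst μ)
    hm.aestronglyMeasurable).symm.trans (integral_congr_ae (ae_of_all _ fun w => ?_))
  have h : onePlus (w.1.2 * w.1.1) * substPoint w * w.1.1 / (w.1.1 * w.1.2) = w.2 := by
    refine Units.ext ?_
    unfold substPoint
    push_cast
    field_simp
  simp only [pentagonKernel, Pi.mul_apply, Function.comp_apply, mul_comm w.1.1 w.1.2] at h ⊢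
  rw [h]

lemma exists_bound_pentagonKernel {N : Fˣ × Fˣ → Fˣ × Fˣ → ℂ}
    (hN : Rapid fun z : (Fˣ × Fˣ) × (Fˣ × Fˣ) => N z.1 z.2) :
    ∃ b : Fˣ × Fˣ → ℝ, Integrable b ((mulHaar μ).prod (mulHaar μ)) ∧
      ∀ (w : Fˣ × Fˣ) (t : Fˣ), logWeight t ≤ 3 → ‖pentagonKernel N (w, t)‖ ≤ b w := by
  obtain ⟨n, hn⟩ := exists_integrable_logWeight μ
  obtain ⟨k, hk⟩ := exists_integrable_logWeight_onePlus μ n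
  obtain ⟨M, hM, h⟩ := hN.logWeight_bound_prod n k
  refine ⟨fun w => M * 3 ^ n * ((logWeight (onePlus w.1) ^ n * (logWeight w.1)⁻¹ ^ k) *
    (logWeight w.2)⁻¹ ^ n), (hk.mul_prod (hn n le_rfl)).const_mul _, fun w t ht => ?_⟩
  refine (h _ _ _ _).trans ?_
  obtain ⟨y, v⟩ := w
  simp only
  set x := substPoint ((y, v), t) with hx
  set r := onePlus y * onePlus (v * y) with hr
  have hv : v = x * (r * ((onePlus y)⁻¹ * t⁻¹)) := by
    simp only [hx, hr, substPoint]
    refine Units.ext ?_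
    push_cast
    field_simp
  have hle : logWeight v ≤ logWeight x * (logWeight r * (logWeight (onePlus y) * 3)) := by
    have l1 := logWeight_pos x
    have l2 := logWeight_pos r
    have l3 := logWeight_pos (onePlus y)
    conv_lhs => rw [hv]
    refine (logWeight_mul_le _ _).trans ?_
    gcongr
    refine (logWeight_mul_le _ _).trans ?_
    gcongr
    refine (logWeight_mul_le _ _).trans ?_
    rw [logWeight_inv, logWeight_inv]
    gcongr
  have l1 := logWeight_pos x
  have l2 := logWeight_pos r
  have l3 := logWeight_pos (onePlus y)
  have l4 := logWeight_pos v
  have l5 := logWeight_pos y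
  have key : (logWeight r)⁻¹ * (logWeight x)⁻¹ ≤ 3 * logWeight (onePlus y) * (logWeight v)⁻¹ := by
    rw [← mul_inv, ← div_eq_mul_inv, le_div_iff₀ l4, inv_mul_le_iff₀ (by positivity)]
    linarith
  calc M * ((logWeight r)⁻¹ ^ n * (logWeight x)⁻¹ ^ n * (logWeight y)⁻¹ ^ k)
      = M * (((logWeight r)⁻¹ * (logWeight x)⁻¹) ^ n * (logWeight y)⁻¹ ^ k) := by rw [mul_pow]
    _ ≤ M * ((3 * logWeight (onePlus y) * (logWeight v)⁻¹) ^ n * (logWeight y)⁻¹ ^ k) := by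
        gcongr
    _ = _ := by rw [mul_pow, mul_pow]; ring

lemma ae_prod_affine_ne {p : Fˣ → F} (hp : Measurable p) (hp0 : ∀ᵐ y ∂mulHaar μ, p y ≠ 0) :
    ∀ᵐ w ∂(mulHaar μ).prod (mulHaar μ), 1 + (w.2 : F) * p w.1 ≠ 0 := by
  have := secondCountable_localField F
  have hm : MeasurableSet {w : Fˣ × Fˣ | 1 + (w.2 : F) * p w.1 ≠ 0} := by
    have hv : Measurable fun w : Fˣ × Fˣ => (w.2 : F) :=
      Units.continuous_val.measurable.comp measurable_snd
    have : Measurable fun w : Fˣ × Fˣ => 1 + (w.2 : F) * p w.1 :=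
      (hv.mul (hp.comp measurable_fst)).const_add 1
    exact this (measurableSet_singleton 0).compl
  refine (Measure.ae_prod_iff_ae_ae hm).2 ?_
  filter_upwards [hp0] with y hy
  filter_upwards [ae_val_ne μ (-(p y)⁻¹)] with v hv h
  exact hv (by field_simp; linear_combination h)

lemma ae_pentagon_generic :
    ∀ᵐ w ∂(mulHaar μ).prod (mulHaar μ), 1 + (w.1 : F) ≠ 0 ∧ 1 + (w.2 : F) * w.1 ≠ 0 ∧
      1 + (w.2 : F) * (1 + w.1) ≠ 0 := by
  have h1 : ∀ᵐ y : Fˣ ∂mulHaar μ, 1 + (y : F) ≠ 0 := by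
    filter_upwards [ae_val_ne μ (-1)] with y hy h
    exact hy (eq_neg_of_add_eq_zero_right h)
  have hv : Measurable fun y : Fˣ => (y : F) := Units.continuous_val.measurable
  have h2 : ∀ᵐ w : Fˣ × Fˣ ∂(mulHaar μ).prod (mulHaar μ), 1 + (w.1 : F) ≠ 0 :=
    Measure.quasiMeasurePreserving_fst.ae h1
  filter_upwards [h2,
    ae_prod_affine_ne μ hv (ae_of_all _ fun y => y.ne_zero),
    ae_prod_affine_ne μ (hv.const_add 1) h1] with w a b c
  exact ⟨a, b, c⟩

end Substitution

section Mollify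

variable {F : Type*} [NontriviallyNormedField F] [LocallyCompactSpace F]
  [MeasurableSpace F] [BorelSpace F]
  {H : Type*} [CommGroup H] [TopologicalSpace H] [MeasurableSpace H] [IsLCA H]
  {e : H → Fˣ → Circle} {N : Fˣ × Fˣ → Fˣ × Fˣ → ℂ}

lemma onePlus_mul_onePlus_div {y v : Fˣ} (h1 : 1 + (y : F) ≠ 0) (h2 : 1 + (v : F) * y ≠ 0)
    (h3 : 1 + (v : F) * (1 + y) ≠ 0) :
    onePlus (v / onePlus (v * y)) * onePlus (v * y) = onePlus (onePlus y * v) ∧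
    onePlus (onePlus (onePlus y * v) * y) = onePlus y * onePlus (v * y) ∧
    1 + ((v / onePlus (v * y) : Fˣ) : F) ≠ 0 := by
  have e2 : (onePlus (v * y) : F) = 1 + v * y := by
    rw [val_onePlus (by simpa using h2), Units.val_mul]
  have e1 : (onePlus y : F) = 1 + y := val_onePlus h1
  have eX : (onePlus (onePlus y * v) : F) = 1 + (1 + y) * v := by
    rw [val_onePlus (by rw [Units.val_mul, e1, mul_comm]; exact h3), Units.val_mul, e1]
  have ex : 1 + ((v / onePlus (v * y) : Fˣ) : F) = (1 + v * (1 + y)) / (1 + v * y) := by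
    rw [Units.val_div_eq_div_val, e2]
    field_simp
    ring
  have hx : 1 + ((v / onePlus (v * y) : Fˣ) : F) ≠ 0 := by
    rw [ex]
    exact div_ne_zero h3 h2
  have eY : 1 + ((onePlus (onePlus y * v) * y : Fˣ) : F) = (1 + y) * (1 + v * y) := by
    rw [Units.val_mul, eX]
    ring
  refine ⟨Units.ext ?_, Units.ext ?_, hx⟩
  · rw [Units.val_mul, val_onePlus hx, ex, e2, eX]
    field_simp
  · rw [val_onePlus (by rw [eY]; exact mul_ne_zero h1 h2), eY, Units.val_mul, e1, e2]

variable (μ : Measure F) [μ.IsAddHaarMeasure]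

/-- The function against which a mollifier is integrated in the improper integral of the pentagon
identity. -/
def pentagonPhase (e : H → Fˣ → Circle) (N : Fˣ × Fˣ → Fˣ × Fˣ → ℂ) (a : H × Fˣ) : ℂ :=
  ∫ w, pentagonKernel N (w, a.2) * (((e a.1 (onePlus (w.2 * w.1)))⁻¹ : Circle) : ℂ)
    ∂(mulHaar μ).prod (mulHaar μ)

lemma eventually_logWeight_le : ∀ᶠ a : H × Fˣ in 𝓝 1, logWeight a.2 ≤ 3 := by
  have hc : Continuous fun a : H × Fˣ => logWeight a.2 := continuous_logWeight.comp continuous_snd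
  have h1 : logWeight (1 : H × Fˣ).2 < 3 := by
    simp [logWeight]
  exact (hc.continuousAt.eventually_lt_const h1).mono fun a ha => ha.le

lemma measurable_circle_onePlus (he : IsPairing e) :
    Measurable fun z : (Fˣ × Fˣ) × (H × Fˣ) =>
      (((e z.2.1 (onePlus (z.1.2 * z.1.1)))⁻¹ : Circle) : ℂ) := by
  have h : Measurable fun z : (Fˣ × Fˣ) × (H × Fˣ) => onePlus (z.1.2 * z.1.1) :=
    measurable_onePlus.comp (by fun_prop)
  exact (continuous_coe_inv he).measurable.comp (by fun_prop :
    Measurable fun z : (Fˣ × Fˣ) × (H × Fˣ) => (z.2.1, onePlus (z.1.2 * z.1.1)))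

lemma continuousAt_pentagonPhase (he : IsPairing e)
    (hN : Continuous fun z : (Fˣ × Fˣ) × (Fˣ × Fˣ) => N z.1 z.2)
    (hNr : Rapid fun z : (Fˣ × Fˣ) × (Fˣ × Fˣ) => N z.1 z.2) :
    ContinuousAt (pentagonPhase μ e N) 1 := by
  obtain ⟨b, hb, hbd⟩ := exists_bound_pentagonKernel μ hNr
  refine continuousAt_of_dominated (bound := b) (.of_forall fun a => ?_) ?_ hb ?_
  · exact (((measurable_pentagonKernel hN).comp (by fun_prop : Measurable fun w : Fˣ × Fˣ =>
      (w, a.2))).mul ((measurable_circle_onePlus he).comp (by fun_prop : Measurable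
        fun w : Fˣ × Fˣ => (w, a)))).aestronglyMeasurable
  · filter_upwards [eventually_logWeight_le] with a ha
    exact ae_of_all _ fun w => by simpa using hbd w a.2 ha
  · filter_upwards [ae_pentagon_generic μ] with w hw
    obtain ⟨y, v⟩ := w
    have hx := (onePlus_mul_onePlus_div hw.1 hw.2.1 hw.2.2).2.2
    refine ContinuousAt.mul ?_ ?_
    · have hs : Continuous fun a : H × Fˣ => substPoint ((y, v), a.2) := by
        exact continuous_snd.const_mul (v / onePlus (v * y))
      have hs1 : substPoint ((y, v), (1 : H × Fˣ).2) = v / onePlus (v * y) := by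
        simp [substPoint]
      have ho : ContinuousAt (fun a : H × Fˣ => onePlus (substPoint ((y, v), a.2))) 1 :=
        ContinuousAt.comp (g := onePlus) (by rw [hs1]; exact continuousAt_onePlus hx)
          hs.continuousAt
      exact ContinuousAt.comp (g := fun z : (Fˣ × Fˣ) × (Fˣ × Fˣ) => N z.1 z.2)
        (f := fun a : H × Fˣ => ((onePlus (substPoint ((y, v), a.2)) * onePlus (v * y),
          onePlus y * onePlus (v * y)), (substPoint ((y, v), a.2), y))) hN.continuousAt
        (((ho.mul continuousAt_const).prodMk continuousAt_const).prodMk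
          (hs.continuousAt.prodMk continuousAt_const))
    · exact ((continuous_coe_inv he).comp (by fun_prop : Continuous fun a : H × Fˣ =>
        (a.1, onePlus (v * y)))).continuousAt

lemma pentagonPhase_one (he : IsPairing e)
    (hN : Continuous fun z : (Fˣ × Fˣ) × (Fˣ × Fˣ) => N z.1 z.2) :
    pentagonPhase μ e N 1 = ∫ z, N (onePlus z.1, onePlus z.2)
      (z.1 / onePlus z.2, z.2 / onePlus z.1) ∂(mulHaar μ).prod (mulHaar μ) := by
  have h1 : Measurable fun z : Fˣ × Fˣ => onePlus z.1 := measurable_onePlus.comp measurable_fst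
  have h2 : Measurable fun z : Fˣ × Fˣ => onePlus z.2 := measurable_onePlus.comp measurable_snd
  have hm := hN.measurable.comp (by fun_prop : Measurable fun z : Fˣ × Fˣ =>
    ((onePlus z.1, onePlus z.2), (z.1 / onePlus z.2, z.2 / onePlus z.1)))
  have hT := (measurePreserving_shear (mulHaar μ) (mulHaar μ) measurable_onePlus).comp
    ((Measure.measurePreserving_swap (μ := mulHaar μ) (ν := mulHaar μ)).comp
      (measurePreserving_shear (mulHaar μ) (mulHaar μ) measurable_onePlus))
  refine Eq.trans (integral_congr_ae ?_)
    (integral_comp_measurePreserving hT hm.aestronglyMeasurable)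
  filter_upwards [ae_pentagon_generic μ] with w hw
  obtain ⟨y, v⟩ := w
  obtain ⟨e1, e2, -⟩ := onePlus_mul_onePlus_div hw.1 hw.2.1 hw.2.2
  have e3 : onePlus y * v / (onePlus y * onePlus (v * y)) = v / onePlus (v * y) :=
    mul_div_mul_left_eq_div _ _ _
  have e4 : onePlus (onePlus y * v) * y / onePlus (onePlus y * v) = y := mul_div_cancel_left _ _
  simp only [pentagonKernel, substPoint, Prod.snd_one, Prod.fst_one, mul_one, he.map_one_left,
    inv_one, Circle.coe_one, Function.comp_apply, Prod.swap_prod_mk, e1, e2, e3, e4]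

lemma integral_pentagonKernel_mul_partialFourier (he : IsPairing e)
    (hN : Continuous fun z : (Fˣ × Fˣ) × (Fˣ × Fˣ) => N z.1 z.2)
    (hNr : Rapid fun z : (Fˣ × Fˣ) × (Fˣ × Fˣ) => N z.1 z.2) (ν : Measure H) [ν.IsHaarMeasure]
    {ρ : H × Fˣ → ℂ} (hρ : Integrable ρ (ν.prod (mulHaar μ)))
    (hρc : Continuous ρ) (hsupp : ∀ a, ρ a ≠ 0 → logWeight a.2 ≤ 3) :
    Integrable (fun a => ρ a * pentagonPhase μ e N a) (ν.prod (mulHaar μ)) ∧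
      ∫ w, pentagonKernel N w * partialFourier e ν ρ w.2 (onePlus (w.1.2 * w.1.1))
        ∂((mulHaar μ).prod (mulHaar μ)).prod (mulHaar μ) =
      ∫ a, ρ a * pentagonPhase μ e N a ∂ν.prod (mulHaar μ) := by
  obtain ⟨b, hb, hbd⟩ := exists_bound_pentagonKernel μ hNr
  set J : (Fˣ × Fˣ) × (H × Fˣ) → ℂ := fun z => pentagonKernel N (z.1, z.2.2) *
    (ρ z.2 * (((e z.2.1 (onePlus (z.1.2 * z.1.1)))⁻¹ : Circle) : ℂ)) with hJ
  have hJm : Measurable J := ((measurable_pentagonKernel hN).comp (by fun_prop)).mul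
    ((hρc.measurable.comp measurable_snd).mul (measurable_circle_onePlus he))
  have hJi : Integrable J (((mulHaar μ).prod (mulHaar μ)).prod (ν.prod (mulHaar μ))) := by
    refine (hb.mul_prod hρ.norm).mono' hJm.aestronglyMeasurable (ae_of_all _ fun z => ?_)
    simp only [hJ, norm_mul, norm_coe_circle, mul_one]
    by_cases h : ρ z.2 = 0
    · simp [h]
    · gcongr
      exact hbd _ _ (hsupp _ h)
  have hphase : ∀ a, ∫ w, J (w, a) ∂(mulHaar μ).prod (mulHaar μ) = ρ a * pentagonPhase μ e N a :=
    fun a => by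
      rw [pentagonPhase, ← integral_const_mul]
      refine integral_congr_ae (ae_of_all _ fun w => ?_)
      simp only [hJ]
      ring
  have hT := ((MeasurePreserving.id ((mulHaar μ).prod (mulHaar μ))).prod
    (Measure.measurePreserving_swap (μ := mulHaar μ) (ν := ν))).comp
      (measurePreserving_prodAssoc ((mulHaar μ).prod (mulHaar μ)) (mulHaar μ) ν)
  constructor
  · simpa only [hphase] using hJi.integral_prod_right
  · calc _ = ∫ w, ∫ π, J (w.1, (π, w.2)) ∂ν
          ∂((mulHaar μ).prod (mulHaar μ)).prod (mulHaar μ) := by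
          refine integral_congr_ae (ae_of_all _ fun w => ?_)
          simp only [partialFourier, hJ]
          rw [integral_const_mul]
      _ = ∫ z, J z ∂((mulHaar μ).prod (mulHaar μ)).prod (ν.prod (mulHaar μ)) := by
          rw [← integral_comp_measurePreserving hT hJi.1]
          exact (integral_prod _ (hT.integrable_comp_of_integrable hJi)).symm
      _ = _ := by
          rw [integral_prod_symm _ hJi]
          simp only [hphase]

lemma exists_nhds_pentagon (he : IsPairing e)
    (hN : Continuous fun z : (Fˣ × Fˣ) × (Fˣ × Fˣ) => N z.1 z.2)
    (hNr : Rapid fun z : (Fˣ × Fˣ) × (Fˣ × Fˣ) => N z.1 z.2) (ν : Measure H) [ν.IsHaarMeasure]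
    {ε : ℝ} (hε : 0 < ε) :
    ∃ U ∈ 𝓝 (1 : H × Fˣ), ∀ ρ : H × Fˣ → ℝ,
      IsSchwartzBruhat (swapPairing e) (ν.prod (mulHaar μ)) (fun a => (ρ a : ℂ)) →
      (∀ a, 0 ≤ ρ a) → ∫ a, ρ a ∂ν.prod (mulHaar μ) = 1 → (∀ a, a ∉ U → ρ a = 0) →
      ‖∫ z, N (onePlus z.1.1 * onePlus z.2, onePlus z.1.2 * onePlus z.2) z.1 *
          partialFourier e ν (fun a => (ρ a : ℂ)) (onePlus z.2 * z.1.1 * z.1.2 / z.2) (onePlus z.2)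
          ∂((mulHaar μ).prod (mulHaar μ)).prod (mulHaar μ) -
        ∫ z, N (onePlus z.1, onePlus z.2) (z.1 / onePlus z.2, z.2 / onePlus z.1)
          ∂(mulHaar μ).prod (mulHaar μ)‖ < ε := by
  have hc := continuousAt_pentagonPhase μ he hN hNr
  have hev : ∀ᶠ a in 𝓝 (1 : H × Fˣ), logWeight a.2 ≤ 3 ∧
      ‖pentagonPhase μ e N a - pentagonPhase μ e N 1‖ ≤ ε / 2 := by
    refine eventually_logWeight_le.and ?_
    filter_upwards [hc.eventually (Metric.ball_mem_nhds _ (half_pos hε))] with a ha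
    rw [← dist_eq_norm]
    exact (Metric.mem_ball.1 ha).le
  refine ⟨_, hev, fun ρ hρ h0 h1 hU => ?_⟩
  have hi : Integrable ρ (ν.prod (mulHaar μ)) := by
    have := hρ.integrable.re
    simpa using this
  obtain ⟨hP, heq⟩ := integral_pentagonKernel_mul_partialFourier μ he hN hNr ν hρ.integrable
    hρ.continuous fun a ha => by
      by_contra hcon
      exact ha (by rw [hU a fun h => hcon h.1, Complex.ofReal_zero])
  have hR : Continuous fun z : Fˣ × Fˣ => partialFourier e ν (fun a => (ρ a : ℂ)) z.2 z.1 :=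
    (continuous_partialFourier hρ he).comp continuous_swap
  rw [integral_subst μ hN (R := fun s t => partialFourier e ν (fun a => (ρ a : ℂ)) t s) hR, heq, ← pentagonPhase_one μ he hN]
  have hsub : ∫ a, (ρ a : ℂ) * pentagonPhase μ e N a ∂ν.prod (mulHaar μ) - pentagonPhase μ e N 1 =
      ∫ a, (ρ a : ℂ) * (pentagonPhase μ e N a - pentagonPhase μ e N 1) ∂ν.prod (mulHaar μ) := by
    simp only [mul_sub]
    rw [integral_sub hP (hρ.integrable.mul_const _), integral_mul_const, integral_complex_ofReal,
      h1, Complex.ofReal_one, one_mul]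
  rw [hsub]
  refine (norm_integral_le_of_norm_le (hi.mul_const (ε / 2)) (ae_of_all _ fun a => ?_)).trans_lt ?_
  · rw [norm_mul, Complex.norm_real, Real.norm_of_nonneg (h0 a)]
    by_cases ha : ρ a = 0
    · simp [ha]
    · refine mul_le_mul_of_nonneg_left ?_ (h0 a)
      by_contra hcon
      exact ha (hU a fun h => hcon h.2)
  · rw [integral_mul_const, h1]
    linarith

end Mollify

section Unimodular

variable {X Y : Type*} [MeasurableSpace X] [MeasurableSpace Y] {m : Measure X} {m' : Measure Y}

/-- Measurable functions of absolute value one. -/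
def AEUnimodular (φ : X → ℂ) (m : Measure X) : Prop :=
  AEStronglyMeasurable φ m ∧ ∀ᵐ x ∂m, ‖φ x‖ = 1

lemma AEUnimodular.mul_prod [SFinite m] [SFinite m'] {φ : X → ℂ} {ψ : Y → ℂ}
    (hφ : AEUnimodular φ m) (hψ : AEUnimodular ψ m') :
    AEUnimodular (fun p : X × Y => φ p.1 * ψ p.2) (m.prod m') := by
  refine ⟨hφ.1.comp_fst.mul hψ.1.comp_snd, ?_⟩
  have h1 : ∀ᵐ p : X × Y ∂m.prod m', ‖φ p.1‖ = 1 := Measure.quasiMeasurePreserving_fst.ae hφ.2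
  have h2 : ∀ᵐ p : X × Y ∂m.prod m', ‖ψ p.2‖ = 1 := Measure.quasiMeasurePreserving_snd.ae hψ.2
  filter_upwards [h1, h2] with p a b
  rw [norm_mul, a, b, one_mul]

lemma AEUnimodular.integrable_mul {φ f : X → ℂ} (hφ : AEUnimodular φ m) (hf : Integrable f m) :
    Integrable (fun x => φ x * f x) m := by
  refine hf.norm.mono' (hφ.1.mul hf.1) ?_
  filter_upwards [hφ.2] with x hx
  rw [norm_mul, hx, one_mul]

variable {A : Type*} [CommGroup A] [TopologicalSpace A] [MeasurableSpace A] [IsLCA A]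
  {q : A → Circle} {μ : Measure A} [μ.IsHaarMeasure] {φ f : A → ℂ}

lemma AEUnimodular.tildeConverges (hφ : AEUnimodular φ μ) (hq : IsPairing (fourierKernel q))
    (hf : IsTest q μ f) : TildeConverges q μ φ f :=
  ⟨IsSchwartzBruhat.integrable hf,
    hφ.integrable_mul (IsSchwartzBruhat.integrable_fourier hf hq μ)⟩

lemma AEUnimodular.representsTempered (hφ : AEUnimodular φ μ) : RepresentsTempered q μ φ := by
  refine ⟨?_, fun f hf => hφ.integrable_mul (IsSchwartzBruhat.integrable hf), fun C D hC _ => ?_⟩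
  · refine (locallyIntegrable_const (1 : ℂ)).mono hφ.1 ?_
    filter_upwards [hφ.2] with x hx
    rw [hx, norm_one]
  · obtain ⟨n, hn⟩ := exists_integrable_theta_pow μ hC
    refine ⟨n, 2 ^ n * ∫ x, theta C x ^ n ∂μ, fun f _ M hM _ => ?_⟩
    refine (norm_integral_le_of_norm_le ((hn n le_rfl).const_mul (2 ^ n * M)) ?_).trans_eq ?_
    · filter_upwards [hφ.2] with x hx
      rw [norm_mul, hx, one_mul]
      exact hM.norm_le_theta x
    · rw [integral_const_mul]
      ring

end Unimodular

section Kernel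

lemma fourierKernel_gaussProd {A A' : Type*} [CommGroup A] [CommGroup A'] (q : A → Circle)
    (q' : A' → Circle) :
    fourierKernel (gaussProd q q') = prodPairing (fourierKernel q) (fourierKernel q') := by
  funext x y
  simp only [fourierKernel, gaussProd, prodPairing, Prod.fst_mul, Prod.snd_mul]
  rw [mul_mul_mul_comm, mul_div_mul_comm]

lemma fourierKernel_dualGauss (B : Type*) [CommGroup B] [TopologicalSpace B] :
    fourierKernel (dualGauss (B := B)) = swapPairing dualPairing := by
  funext x y
  have h : dualGauss (x * y) = dualGauss x * dualGauss y * swapPairing dualPairing x y := by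
    change x.1 (x.2 * y.2) * y.1 (x.2 * y.2) = x.1 x.2 * y.1 y.2 * (x.1 y.2 * y.1 x.2)
    rw [map_mul, map_mul]
    ac_rfl
  rw [fourierKernel, h, mul_div_cancel_left]

end Kernel

section LocalField

variable {F : Type*} [NontriviallyNormedField F] [LocallyCompactSpace F]
  [MeasurableSpace F] [BorelSpace F]
  [MeasurableSpace (PontryaginDual Fˣ)] [BorelSpace (PontryaginDual Fˣ)]
  {μ : Measure F} [μ.IsAddHaarMeasure] {ν : Measure (PontryaginDual Fˣ)} [ν.IsHaarMeasure]
  {φ : PontryaginDual Fˣ × Fˣ → ℂ}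

lemma dualPairing_separates (α : PontryaginDual Fˣ) (h : ∀ x, dualPairing α x = 1) : α = 1 :=
  DFunLike.ext _ _ h

lemma ae_eq_dualPairing_onePlus (μ : Measure F) [μ.IsAddHaarMeasure]
    (hφ : ∀ (α : PontryaginDual Fˣ) (x : Fˣ) (h : 1 + (x : F) ≠ 0),
      φ (α, x) = (α (Units.mk0 (1 + (x : F)) h) : ℂ)) :
    ∀ᵐ x ∂mulHaar μ, ∀ α, φ (α, x) = (dualPairing α (onePlus x) : ℂ) := by
  filter_upwards [ae_val_ne μ (-1)] with x hx α
  have h : 1 + (x : F) ≠ 0 := fun h => hx (eq_neg_of_add_eq_zero_right h)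
  rw [hφ α x h, onePlus_eq h]
  rfl

lemma aeUnimodular_of_ae_eq
    (hφ : ∀ᵐ x ∂mulHaar μ, ∀ α, φ (α, x) = (dualPairing α (onePlus x) : ℂ)) :
    AEUnimodular φ (ν.prod (mulHaar μ)) := by
  have h : ∀ᵐ a : PontryaginDual Fˣ × Fˣ ∂ν.prod (mulHaar μ),
      ∀ α, φ (α, a.2) = (dualPairing α (onePlus a.2) : ℂ) :=
    Measure.quasiMeasurePreserving_snd.ae hφ
  have ho : Measurable fun a : PontryaginDual Fˣ × Fˣ => onePlus a.2 :=
    measurable_onePlus.comp measurable_snd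
  have hm : Measurable fun a : PontryaginDual Fˣ × Fˣ =>
      (dualPairing a.1 (onePlus a.2) : ℂ) :=
    (continuous_subtype_val.comp isPairing_dualPairing.continuous).measurable.comp
      (measurable_fst.prodMk ho)
  refine ⟨hm.aestronglyMeasurable.congr ?_, ?_⟩
  · filter_upwards [h] with a ha
    exact (ha a.1).symm
  · filter_upwards [h] with a ha
    rw [← Prod.mk.eta (p := a), ha a.1, norm_coe_circle]

lemma ae_inversion_relation
    (hφ : ∀ (α : PontryaginDual Fˣ) (x : Fˣ) (h : 1 + (x : F) ≠ 0),
      φ (α, x) = (α (Units.mk0 (1 + (x : F)) h) : ℂ)) :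
    ∀ᵐ a ∂ν.prod (mulHaar μ), φ a * φ a⁻¹ = (dualGauss a : ℂ) := by
  have h : ∀ᵐ a : PontryaginDual Fˣ × Fˣ ∂ν.prod (mulHaar μ), (a.2 : F) ≠ -1 :=
    Measure.quasiMeasurePreserving_snd.ae (ae_val_ne μ (-1))
  filter_upwards [h] with a ha
  obtain ⟨α, x⟩ := a
  have h1 : 1 + (x : F) ≠ 0 := fun h => ha (eq_neg_of_add_eq_zero_right h)
  have h2 : 1 + ((x⁻¹ : Fˣ) : F) ≠ 0 := by
    rw [Units.val_inv_eq_inv_val]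
    intro h
    refine h1 ?_
    field_simp at h
    linear_combination h
  have h3 : Units.mk0 (1 + (x : F)) h1 = x * Units.mk0 (1 + ((x⁻¹ : Fˣ) : F)) h2 := by
    refine Units.ext ?_
    simp only [Units.val_mk0, Units.val_mul, mul_add, mul_one, Units.mul_inv]
    ring
  rw [Prod.inv_mk, hφ α x h1, hφ α⁻¹ x⁻¹ h2, h3, ← Circle.coe_mul]
  congr 1
  change α _ * (α _)⁻¹ = α x
  rw [map_mul, mul_inv_cancel_right]

section Evaluation

variable {f : (PontryaginDual Fˣ × Fˣ) × (PontryaginDual Fˣ × Fˣ) → ℂ}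

lemma inversionHolds_swap_dualPairing (hν : InversionHolds dualPairing (mulHaar μ) ν) :
    InversionHolds (swapPairing dualPairing) (ν.prod (mulHaar μ)) (ν.prod (mulHaar μ)) :=
  hν.swap isPairing_dualPairing dualPairing_separates

lemma isTest_gaussProd_two_iff :
    IsTest (gaussProd dualGauss dualGauss) ((ν.prod (mulHaar μ)).prod (ν.prod (mulHaar μ))) f ↔
      IsSchwartzBruhat (prodPairing (swapPairing dualPairing) (swapPairing dualPairing))
        ((ν.prod (mulHaar μ)).prod (ν.prod (mulHaar μ))) f := by
  rw [IsTest, fourierKernel_gaussProd, fourierKernel_dualGauss]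

lemma isTest_pentagonTestLeft (hν : InversionHolds dualPairing (mulHaar μ) ν)
    (hf : IsTest (gaussProd dualGauss dualGauss)
      ((ν.prod (mulHaar μ)).prod (ν.prod (mulHaar μ))) f) :
    IsTest (gaussProd dualGauss dualGauss) ((ν.prod (mulHaar μ)).prod (ν.prod (mulHaar μ)))
      (pentagonTestLeft dualGauss f) := by
  rw [isTest_gaussProd_two_iff] at hf ⊢
  unfold pentagonTestLeft
  rw [fourierKernel_dualGauss]
  exact hf.mul_kernel isPairing_dualPairing.swap (fun a b => mul_comm _ _)
    (inversionHolds_swap_dualPairing hν)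

lemma isTest_pentagonTestRight (hν : InversionHolds dualPairing (mulHaar μ) ν)
    (hf : IsTest (gaussProd dualGauss dualGauss)
      ((ν.prod (mulHaar μ)).prod (ν.prod (mulHaar μ))) f) {χ : PontryaginDual Fˣ × Fˣ → ℂ}
    (hχ : IsTest dualGauss (ν.prod (mulHaar μ)) χ) :
    IsTest (gaussProd dualGauss (gaussProd dualGauss dualGauss))
      ((ν.prod (mulHaar μ)).prod ((ν.prod (mulHaar μ)).prod (ν.prod (mulHaar μ))))
      (pentagonTestRight dualGauss f χ) := by
  rw [isTest_gaussProd_two_iff] at hf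
  rw [IsTest, fourierKernel_dualGauss] at hχ
  rw [IsTest, fourierKernel_gaussProd, fourierKernel_gaussProd, fourierKernel_dualGauss]
  refine hf.pentagonTestRight isPairing_dualPairing.swap (inversionHolds_swap_dualPairing hν) hχ
    isPairing_dualPairing.continuous fun a b => ?_
  rw [← fourierKernel_dualGauss, fourierKernel, mul_div_cancel]

lemma pentagonLeft_eq (hν : InversionHolds dualPairing (mulHaar μ) ν)
    (hφ : ∀ᵐ x ∂mulHaar μ, ∀ α, φ (α, x) = (dualPairing α (onePlus x) : ℂ))
    (hf : IsTest (gaussProd dualGauss dualGauss)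
      ((ν.prod (mulHaar μ)).prod (ν.prod (mulHaar μ))) f)
    (hc : TildeConverges (gaussProd dualGauss dualGauss)
      ((ν.prod (mulHaar μ)).prod (ν.prod (mulHaar μ))) (tensorTwo φ)
      (pentagonTestLeft dualGauss f)) :
    pentagonLeft dualGauss (ν.prod (mulHaar μ)) φ f =
      ∫ z, partialFourierTwo dualPairing ν f (onePlus z.1, onePlus z.2)
        (z.1 / onePlus z.2, z.2 / onePlus z.1) ∂(mulHaar μ).prod (mulHaar μ) := by
  have he : IsPairing (dualPairing (B := Fˣ)) := isPairing_dualPairing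
  have hL := isTest_gaussProd_two_iff.1 (isTest_pentagonTestLeft hν hf)
  have hm := hc.2
  rw [fourierKernel_gaussProd, fourierKernel_dualGauss] at hm
  rw [pentagonLeft, tilde, fourierKernel_gaussProd, fourierKernel_dualGauss,
    integral_mul_invFourier_rearrangement (he.prod he) (hν.prod hν he he)
      (interchange _ _ _ _) (σ := fun z => (onePlus z.1, onePlus z.2)) ?_
      (measurePreserving_interchange ν ν (mulHaar μ) (mulHaar μ)) hL ?_ hm]
  · refine integral_congr_ae (ae_of_all _ fun z => ?_)
    have := partialFourierTwo_mul_kernel (ν := ν) he f (onePlus z.1, onePlus z.2) z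
    unfold pentagonTestLeft
    rw [fourierKernel_dualGauss]
    exact this
  · intro s t
    exact mul_mul_mul_comm _ _ _ _
  · have h1 : ∀ᵐ z : Fˣ × Fˣ ∂(mulHaar μ).prod (mulHaar μ), ∀ α, φ (α, z.1) =
      (dualPairing α (onePlus z.1) : ℂ) := Measure.quasiMeasurePreserving_fst.ae hφ
    have h2 : ∀ᵐ z : Fˣ × Fˣ ∂(mulHaar μ).prod (mulHaar μ), ∀ α, φ (α, z.2) =
      (dualPairing α (onePlus z.2) : ℂ) := Measure.quasiMeasurePreserving_snd.ae hφ
    filter_upwards [h1, h2] with z a b α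
    change φ (α.1, z.1) * φ (α.2, z.2) = _
    rw [a, b, ← Circle.coe_mul]
    rfl

lemma pentagonRight_eq (hν : InversionHolds dualPairing (mulHaar μ) ν)
    (hφ : ∀ᵐ x ∂mulHaar μ, ∀ α, φ (α, x) = (dualPairing α (onePlus x) : ℂ))
    (hf : IsTest (gaussProd dualGauss dualGauss)
      ((ν.prod (mulHaar μ)).prod (ν.prod (mulHaar μ))) f) {ρ : PontryaginDual Fˣ × Fˣ → ℂ}
    (hρ : IsSchwartzBruhat (swapPairing dualPairing) (ν.prod (mulHaar μ)) ρ)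
    (hχ : IsTest dualGauss (ν.prod (mulHaar μ))
      (invFourier (swapPairing dualPairing) (ν.prod (mulHaar μ)) ρ))
    (hc : TildeConverges (gaussProd dualGauss (gaussProd dualGauss dualGauss))
      ((ν.prod (mulHaar μ)).prod ((ν.prod (mulHaar μ)).prod (ν.prod (mulHaar μ)))) (tensorThree φ)
      (pentagonTestRight dualGauss f
        (invFourier (swapPairing dualPairing) (ν.prod (mulHaar μ)) ρ))) :
    pentagonRight dualGauss (ν.prod (mulHaar μ)) φ f
        (invFourier (swapPairing dualPairing) (ν.prod (mulHaar μ)) ρ) =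
      ∫ z, partialFourierTwo dualPairing ν f
          (onePlus z.1.1 * onePlus z.2, onePlus z.1.2 * onePlus z.2) z.1 *
        partialFourier dualPairing ν ρ (onePlus z.2 * z.1.1 * z.1.2 / z.2) (onePlus z.2)
        ∂((mulHaar μ).prod (mulHaar μ)).prod (mulHaar μ) := by
  have he : IsPairing (dualPairing (B := Fˣ)) := isPairing_dualPairing
  have hR := isTest_pentagonTestRight hν hf hχ
  have hm := hc.2
  rw [IsTest, fourierKernel_gaussProd, fourierKernel_gaussProd, fourierKernel_dualGauss] at hR
  rw [fourierKernel_gaussProd, fourierKernel_gaussProd, fourierKernel_dualGauss] at hm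
  rw [pentagonRight, tilde, fourierKernel_gaussProd, fourierKernel_gaussProd,
    fourierKernel_dualGauss,
    integral_mul_invFourier_rearrangement ((he.prod he).prod he)
      ((hν.prod hν he he).prod hν (he.prod he) he)
      (tripleInterchange _ _) (σ := fun z => ((onePlus z.1.1, onePlus z.1.2), onePlus z.2)) ?_
      (measurePreserving_tripleInterchange ν (mulHaar μ)) hR ?_ hm]
  · refine integral_congr_ae (ae_of_all _ fun z => ?_)
    beta_reduce
    rw [partialFourier_eq_integral hν hρ he]
    exact partialFourier_pentagonTestRight he hR (onePlus z.1.1, onePlus z.1.2) z.1 (onePlus z.2)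
      z.2
  · intro s t
    change dualPairing s.1.1.1 t.2.1.1 * dualPairing s.1.1.2 t.2.1.2 * dualPairing s.1.2 t.2.2 *
      (dualPairing t.1.1.1 s.2.1.1 * dualPairing t.1.1.2 s.2.1.2 * dualPairing t.1.2 s.2.2) =
      dualPairing s.1.1.1 t.2.1.1 * dualPairing t.1.1.1 s.2.1.1 *
        (dualPairing s.1.1.2 t.2.1.2 * dualPairing t.1.1.2 s.2.1.2 *
          (dualPairing s.1.2 t.2.2 * dualPairing t.1.2 s.2.2))
    ac_rfl
  · have h1 : ∀ᵐ z : (Fˣ × Fˣ) × Fˣ ∂((mulHaar μ).prod (mulHaar μ)).prod (mulHaar μ), ∀ α,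
        φ (α, z.1.1) = (dualPairing α (onePlus z.1.1) : ℂ) :=
      (Measure.quasiMeasurePreserving_fst.comp Measure.quasiMeasurePreserving_fst).ae hφ
    have h2 : ∀ᵐ z : (Fˣ × Fˣ) × Fˣ ∂((mulHaar μ).prod (mulHaar μ)).prod (mulHaar μ), ∀ α,
        φ (α, z.1.2) = (dualPairing α (onePlus z.1.2) : ℂ) :=
      (Measure.quasiMeasurePreserving_snd.comp Measure.quasiMeasurePreserving_fst).ae hφ
    have h3 : ∀ᵐ z : (Fˣ × Fˣ) × Fˣ ∂((mulHaar μ).prod (mulHaar μ)).prod (mulHaar μ), ∀ α,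
        φ (α, z.2) = (dualPairing α (onePlus z.2) : ℂ) :=
      Measure.quasiMeasurePreserving_snd.ae hφ
    filter_upwards [h1, h2, h3] with z a b c α
    change φ (α.1.1, z.1.1) * φ (α.1.2, z.1.2) * φ (α.2, z.2) = _
    rw [a, b, c, ← Circle.coe_mul, ← Circle.coe_mul]
    rfl

end Evaluation

lemma isQuantumDilogarithm_onePlus (hν : InversionHolds dualPairing (mulHaar μ) ν)
    (hφ : ∀ (α : PontryaginDual Fˣ) (x : Fˣ) (h : 1 + (x : F) ≠ 0),
      φ (α, x) = (α (Units.mk0 (1 + (x : F)) h) : ℂ)) :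
    IsQuantumDilogarithm dualGauss (ν.prod (mulHaar μ)) φ := by
  have he : IsPairing (dualPairing (B := Fˣ)) := isPairing_dualPairing
  have hae := ae_eq_dualPairing_onePlus μ hφ
  have hu : AEUnimodular φ (ν.prod (mulHaar μ)) := aeUnimodular_of_ae_eq hae
  have hk : IsPairing (fourierKernel (dualGauss (B := Fˣ))) := by
    rw [fourierKernel_dualGauss]
    exact he.swap
  have hk2 : IsPairing (fourierKernel (gaussProd (dualGauss (B := Fˣ)) (dualGauss (B := Fˣ)))) := by
    rw [fourierKernel_gaussProd]
    exact hk.prod hk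
  have hk3 : IsPairing (fourierKernel (gaussProd (dualGauss (B := Fˣ))
      (gaussProd (dualGauss (B := Fˣ)) (dualGauss (B := Fˣ))))) := by
    rw [fourierKernel_gaussProd]
    exact hk.prod hk2
  have hu3 : AEUnimodular (tensorThree φ)
      ((ν.prod (mulHaar μ)).prod ((ν.prod (mulHaar μ)).prod (ν.prod (mulHaar μ)))) := by
    have h : tensorThree φ = fun p => φ p.1 * (φ p.2.1 * φ p.2.2) :=
      funext fun p => mul_assoc _ _ _
    rw [h]
    exact hu.mul_prod (hu.mul_prod hu)
  have hleft := fun f hf => AEUnimodular.tildeConverges (hu.mul_prod hu) hk2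
    (isTest_pentagonTestLeft (μ := μ) (f := f) hν hf)
  have hright := fun f hf χ hχ => hu3.tildeConverges hk3
    (isTest_pentagonTestRight (μ := μ) (f := f) hν hf (χ := χ) hχ)
  refine ⟨hu.representsTempered, ⟨1, one_ne_zero, ?_⟩, hleft, hright, fun f hf ε hε => ?_⟩
  · simpa only [one_mul] using ae_inversion_relation hφ
  have hf2 := (isTest_gaussProd_two_iff.1 hf).comp_rearrangement
    (e := prodPairing dualPairing dualPairing) (ν := ν.prod ν) (μ := (mulHaar μ).prod (mulHaar μ))
    (interchange (PontryaginDual Fˣ) (PontryaginDual Fˣ) Fˣ Fˣ)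
    (fun s t => mul_mul_mul_comm _ _ _ _)
  obtain ⟨U, hU, h⟩ := exists_nhds_pentagon μ he (N := partialFourierTwo dualPairing ν f)
    (continuous_partialFourier hf2 (he.prod he))
    (rapid_partialFourier (hν.prod hν he he) hf2 (he.prod he)) ν hε
  refine ⟨U, hU, fun ρ hρ => ?_⟩
  have hρ1 := hρ.test
  rw [IsTest, fourierKernel_dualGauss] at hρ1
  have hχ : IsTest dualGauss (ν.prod (mulHaar μ)) (invFourier (swapPairing dualPairing)
      (ν.prod (mulHaar μ)) fun a => (ρ a : ℂ)) := by
    have := hρ1.fourier he.swap (inversionHolds_swap_dualPairing hν)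
    rw [IsTest, fourierKernel_dualGauss]
    convert this using 1
    exact funext₂ fun a b => mul_comm _ _
  rw [fourierKernel_dualGauss, pentagonLeft_eq hν hae hf (hleft f hf),
    pentagonRight_eq hν hae hf hρ1 hχ (hright f hf _ hχ)]
  exact h ρ hρ1 hρ.nonneg hρ.integral_eq_one hρ.eq_zero

end LocalField

section TildeFormula

variable {F : Type*} [NontriviallyNormedField F] [LocallyCompactSpace F]
  [MeasurableSpace F] [BorelSpace F]

/-- The unit `y - 1`, with a junk value for `y = 1`. -/
def subOne (y : Fˣ) : Fˣ := -onePlus (-y)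

lemma val_subOne {y : Fˣ} (h : (y : F) ≠ 1) : (subOne y : F) = y - 1 := by
  have : 1 + ((-y : Fˣ) : F) ≠ 0 := by
    rw [Units.val_neg, ← sub_eq_add_neg]
    exact sub_ne_zero.2 h.symm
  rw [subOne, Units.val_neg, val_onePlus this, Units.val_neg]
  ring

lemma subOne_onePlus {x : Fˣ} (h : 1 + (x : F) ≠ 0) : subOne (onePlus x) = x := by
  refine Units.ext ?_
  rw [val_subOne, val_onePlus h, add_sub_cancel_left]
  rw [val_onePlus h]
  simp

lemma measurable_subOne : Measurable (subOne : Fˣ → Fˣ) := by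
  have hneg : Continuous fun y : Fˣ => -y := by
    rw [Units.isEmbedding_val₀.continuous_iff]
    exact Units.continuous_val.neg
  exact hneg.measurable.comp (measurable_onePlus.comp hneg.measurable)

lemma tildeFormula_eq (β : PontryaginDual Fˣ) {y : Fˣ} (h : (y : F) ≠ 1) :
    tildeFormula (β, y) = (((dualPairing β (subOne y))⁻¹ : Circle) : ℂ) *
      ((modulus (y : F) * (modulus (subOne y : F))⁻¹ : ℝ) : ℂ) := by
  have h1 : (y : F) - 1 ≠ 0 := sub_ne_zero.2 h
  have h2 : Units.mk0 ((y : F) - 1) h1 = subOne y := Units.ext (val_subOne h).symm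
  have h3 : 1 - (y : F)⁻¹ = ((subOne y * y⁻¹ : Fˣ) : F) := by
    rw [Units.val_mul, val_subOne h, Units.val_inv_eq_inv_val, sub_mul,
      mul_inv_cancel₀ y.ne_zero, one_mul]
  have h4 : modulus ((y⁻¹ : Fˣ) : F) = (modulus (y : F))⁻¹ := by
    rw [modulus_of_unit, modulus_of_unit, map_inv, NNReal.coe_inv]
  rw [tildeFormula, dif_neg h1, h2, h3, modulus_mul_unit, h4, mul_inv, inv_inv,
    mul_comm (modulus _)⁻¹]
  rfl

variable (μ : Measure F) [μ.IsAddHaarMeasure]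

lemma integral_modulus_mul (g : Fˣ → ℂ) :
    ∫ x, (modulus (x : F) : ℂ) * g x ∂mulHaar μ = ∫ x, g x ∂μ.comap Units.val := by
  rw [mulHaar, integral_withDensity_eq_integral_toReal_smul measurable_density
    (ae_of_all _ fun x => ENNReal.ofReal_lt_top)]
  refine integral_congr_ae (ae_of_all _ fun x => ?_)
  have h := modulus_unit_pos x
  simp only
  rw [ENNReal.toReal_ofReal (by positivity), Complex.real_smul, ← mul_assoc, ← Complex.ofReal_mul,
    inv_mul_cancel₀ h.ne', Complex.ofReal_one, one_mul]

lemma exists_le_modulus_of_notMem {U : Set Fˣ} (hU : U ∈ 𝓝 (1 : Fˣ)) :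
    ∃ c : ℝ, 0 < c ∧ ∀ y : Fˣ, (y : F) ≠ 1 → y ∉ U →
      modulus (y : F) * (modulus (subOne y : F))⁻¹ ≤ c := by
  have hU' : Units.val '' U⁻¹ ∈ 𝓝 (1 : F) := by
    have h := (isOpenEmbedding_unitsVal F).image_mem_nhds.2
      (show U⁻¹ ∈ 𝓝 (1 : Fˣ) from inv_mem_nhds_one Fˣ hU)
    simpa using h
  obtain ⟨δ, hδ, hball⟩ := Metric.mem_nhds_iff.1 hU'
  obtain ⟨η, hη0, hη⟩ := NormedField.exists_norm_lt F hδ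
  set c₀ : Fˣ := Units.mk0 η (norm_pos_iff.1 hη0) with hc₀
  refine ⟨(modulus (c₀ : F))⁻¹, inv_pos.2 (modulus_unit_pos _), fun y hy hyU => ?_⟩
  have h4 : modulus ((y⁻¹ : Fˣ) : F) = (modulus (y : F))⁻¹ := by
    rw [modulus_of_unit, modulus_of_unit, map_inv, NNReal.coe_inv]
  have h5 : modulus (y : F) * (modulus (subOne y : F))⁻¹ =
      (modulus ((subOne y * y⁻¹ : Fˣ) : F))⁻¹ := by
    rw [modulus_mul_unit, h4, mul_inv, inv_inv, mul_comm]
  rw [h5]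
  refine inv_anti₀ (modulus_unit_pos _) (modulus_le_modulus ?_)
  have h6 : δ ≤ ‖((y⁻¹ : Fˣ) : F) - 1‖ := by
    by_contra! hcon
    obtain ⟨z, hz, hzy⟩ := hball (mem_ball_iff_norm.2 hcon)
    rw [Units.ext hzy] at hz
    exact hyU (by simpa using hz)
  rw [Units.val_mul, val_subOne hy, Units.val_inv_eq_inv_val, sub_mul, mul_inv_cancel₀ y.ne_zero,
    one_mul, norm_sub_rev, ← Units.val_inv_eq_inv_val]
  exact hη.le.trans h6

variable [MeasurableSpace (PontryaginDual Fˣ)] [BorelSpace (PontryaginDual Fˣ)]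
  {μ} {ν : Measure (PontryaginDual Fˣ)} [ν.IsHaarMeasure]
  {φ f : PontryaginDual Fˣ × Fˣ → ℂ}

lemma ae_snd_ne_one (μ : Measure F) [μ.IsAddHaarMeasure] (ν : Measure (PontryaginDual Fˣ))
    [ν.IsHaarMeasure] : ∀ᵐ b : PontryaginDual Fˣ × Fˣ ∂ν.prod (mulHaar μ), (b.2 : F) ≠ 1 :=
  Measure.quasiMeasurePreserving_snd.ae (ae_val_ne μ 1)

lemma aestronglyMeasurable_tildeFormula :
    AEStronglyMeasurable (tildeFormula (F := F)) (ν.prod (mulHaar μ)) := by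
  have hs : Measurable fun b : PontryaginDual Fˣ × Fˣ => subOne b.2 :=
    measurable_subOne.comp measurable_snd
  have h1 := (continuous_coe_inv (isPairing_dualPairing (F := F))).measurable.comp
    (measurable_fst.prodMk hs)
  have h2 : Measurable fun b : PontryaginDual Fˣ × Fˣ =>
      modulus (b.2 : F) * (modulus (subOne b.2 : F))⁻¹ :=
    (measurable_modulus.comp measurable_snd).mul (measurable_modulus.comp hs).inv
  refine (h1.mul (Complex.measurable_ofReal.comp h2)).aestronglyMeasurable.congr ?_
  filter_upwards [ae_snd_ne_one μ ν] with b hb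
  exact (tildeFormula_eq b.1 hb).symm

lemma integrable_tildeFormula_mul (hf : Integrable f (ν.prod (mulHaar μ)))
    (hU : ∃ U ∈ 𝓝 (1 : Fˣ), ∀ (β : PontryaginDual Fˣ) (y : Fˣ), y ∈ U → f (β, y) = 0) :
    Integrable (fun b => tildeFormula b * f b) (ν.prod (mulHaar μ)) := by
  obtain ⟨U, hU, h0⟩ := hU
  obtain ⟨c, hc, hb⟩ := exists_le_modulus_of_notMem hU
  refine (hf.norm.const_mul c).mono' (aestronglyMeasurable_tildeFormula.mul hf.1) ?_
  filter_upwards [ae_snd_ne_one μ ν] with b hb1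
  obtain ⟨β, y⟩ := b
  by_cases hy : y ∈ U
  · simp [h0 β y hy]
  · have h1 := modulus_unit_pos y
    have h2 := modulus_unit_pos (subOne y)
    rw [norm_mul, tildeFormula_eq β hb1, norm_mul, norm_coe_circle, one_mul, Complex.norm_real,
      Real.norm_of_nonneg (by positivity)]
    gcongr
    exact hb y hb1 hy

lemma tilde_eq_integral_tildeFormula (hν : InversionHolds dualPairing (mulHaar μ) ν)
    (hφ : ∀ᵐ x ∂mulHaar μ, ∀ α, φ (α, x) = (dualPairing α (onePlus x) : ℂ))
    (hf : IsTest dualGauss (ν.prod (mulHaar μ)) f)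
    (hi : Integrable (fun b => tildeFormula b * f b) (ν.prod (mulHaar μ))) :
    tilde dualGauss (ν.prod (mulHaar μ)) φ f =
      ∫ b, tildeFormula b * f b ∂(ν.prod (mulHaar μ)) := by
  have he : IsPairing (dualPairing (B := Fˣ)) := isPairing_dualPairing
  rw [IsTest, fourierKernel_dualGauss] at hf
  have hu : AEUnimodular φ (ν.prod (mulHaar μ)) := aeUnimodular_of_ae_eq hφ
  set G : Fˣ → ℂ := fun y =>
    (((modulus (subOne y : F))⁻¹ : ℝ) : ℂ) * partialFourier dualPairing ν f y (subOne y) with hG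
  have hGm : Measurable G := (Complex.measurable_ofReal.comp
    (measurable_modulus.comp measurable_subOne).inv).mul
      ((continuous_partialFourier hf he).measurable.comp (measurable_id.prodMk measurable_subOne))
  calc tilde dualGauss (ν.prod (mulHaar μ)) φ f
      = ∫ x, partialFourier dualPairing ν f (onePlus x) x ∂mulHaar μ := by
        rw [tilde, fourierKernel_dualGauss]
        exact integral_mul_invFourier hν hf he hφ
          (hu.integrable_mul (hf.integrable_fourier he.swap _))
    _ = ∫ x, (modulus (x : F) : ℂ) * G (onePlus x) ∂mulHaar μ := by
        refine integral_congr_ae ?_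
        filter_upwards [ae_val_ne μ (-1)] with x hx
        have h1 : 1 + (x : F) ≠ 0 := fun h => hx (eq_neg_of_add_eq_zero_right h)
        have h2 := modulus_unit_pos x
        simp only [hG]
        rw [subOne_onePlus h1, ← mul_assoc, ← Complex.ofReal_mul, mul_inv_cancel₀ h2.ne',
          Complex.ofReal_one, one_mul]
    _ = ∫ y, (modulus (y : F) : ℂ) * G y ∂mulHaar μ := by
        rw [integral_modulus_mul μ fun x => G (onePlus x), integral_modulus_mul μ G]
        exact integral_comp_measurePreserving (measurePreserving_onePlus μ)
          hGm.aestronglyMeasurable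
    _ = _ := by
        rw [integral_prod_symm _ hi]
        refine integral_congr_ae ?_
        filter_upwards [ae_val_ne μ 1] with y hy
        simp only [hG, tildeFormula_eq _ hy, partialFourier]
        rw [← mul_assoc, ← integral_const_mul]
        refine integral_congr_ae (ae_of_all _ fun β => ?_)
        simp only [Complex.ofReal_mul]
        ring

end TildeFormula

end QDilog

end

theorem theorem3p2 {F : Type*} [NontriviallyNormedField F] [LocallyCompactSpace F]
    [MeasurableSpace F] [BorelSpace F]
    [MeasurableSpace (PontryaginDual Fˣ)] [BorelSpace (PontryaginDual Fˣ)]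
    (μ : Measure F) [μ.IsAddHaarMeasure]
    (ν : Measure (PontryaginDual Fˣ)) [ν.IsHaarMeasure]
    (hν : QDilog.IsDualNormalized (QDilog.mulHaar μ) ν)
    (φ : PontryaginDual Fˣ × Fˣ → ℂ)
    (hφ : ∀ (α : PontryaginDual Fˣ) (x : Fˣ) (h : 1 + (x : F) ≠ 0),
      φ (α, x) = (α (Units.mk0 (1 + (x : F)) h) : ℂ)) :
    QDilog.IsQuantumDilogarithm QDilog.dualGauss (ν.prod (QDilog.mulHaar μ)) φ ∧
      ∀ f : PontryaginDual Fˣ × Fˣ → ℂ,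
        QDilog.IsTest QDilog.dualGauss (ν.prod (QDilog.mulHaar μ)) f →
        (∃ U ∈ 𝓝 (1 : Fˣ), ∀ (β : PontryaginDual Fˣ) (y : Fˣ), y ∈ U → f (β, y) = 0) →
          Integrable (fun b => QDilog.tildeFormula b * f b) (ν.prod (QDilog.mulHaar μ)) ∧
          QDilog.tilde QDilog.dualGauss (ν.prod (QDilog.mulHaar μ)) φ f =
            ∫ b, QDilog.tildeFormula b * f b ∂(ν.prod (QDilog.mulHaar μ)) := by
  refine ⟨QDilog.isQuantumDilogarithm_onePlus hν hφ, fun f hf hU => ?_⟩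
  have hi := QDilog.integrable_tildeFormula_mul (QDilog.IsSchwartzBruhat.integrable hf) hU
  exact ⟨hi, QDilog.tilde_eq_integral_tildeFormula hν (QDilog.ae_eq_dualPairing_onePlus μ hφ) hf hi⟩
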